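/- **Cyclic Dyck paths.** Let $n\ge 1$ and $\mathcal U=\{1,\dots,2n\}$. A *cyclic Dyck path* $\vec\sigma$ of length $2n$ is a Dyck path with $2n$ steps whose steps carry the labels $\ell,\ell+1,\dots,2n,1,\dots,\ell-1$ from left to right, for some $\ell\in\mathcal U$. Each up step forms a *chord* with the closest down step to its right at the same height; the chords give an oriented pairing of $\mathcal U$ (from up step to down step). Write $\vec\sigma\sim\vec\tau$ if the two paths have the same oriented pairing (equivalently, if they differ by a cyclic permutation of mountaintops together with their labels). Let $\mathcal A(\vec\sigma)$ be the sum of the heights of the $2n+1$ vertices and $W(\vec\sigma)$ the height of the starting point of the step labelled $1$. A chord is *wrapped* if the label of its up step exceeds that of its down step. For $R\subset\mathcal U$ with $|R|=n$: $R\cap\vec\sigma$ means that $R$ contains exactly one label of each chord; $R\cdot\vec\sigma$ is the number of up steps with label in $R$; $R:\vec\sigma$ is the number of up steps of wrapped chords with label in $R$; $R|\vec\sigma_{\ell(1)}$ is the number of steps strictly to the left of the step $1$ with label in $R$; $|D^{\vec\sigma}_{\ell(1)}|$ is the number of down steps strictly to the left of the step $1$; $\Sigma R=\sum_{r\in R}r$.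 Write $\vec\mu\ge\vec\sigma$ if the labels are in the same positions and the heights of $\vec\mu$ are at least those of $\vec\sigma$. A *Dyck tile* is a ribbon of $\sqrt2\times\sqrt2$ squares, rotated by $45^\circ$, centred at the vertices of a Dyck path (possibly of length zero); $\mathrm{ci}(\vec\sigma/\vec\mu)$ is the number of tilings of the region between $\vec\sigma$ and $\vec\mu$ by Dyck tiles that are *cover-inclusive*: whenever a tile $t$ has a square right above a square of a tile $t'$, the horizontal extent of $t$ is contained in that of $t'$. **The matrices.** For $w\in\mathbb C^*$ put $$(\mathbf A_n)_{R,\vec\sigma}=(-1)^{\frac12(\mathcal A(\vec\sigma)-n)+(n+1)W(\vec\sigma)}\,w^{W(\vec\sigma)-R:\vec\sigma}\ \text{ if }R\cap\vec\sigma,\qquad (\mathbf A_n)_{R,\vec\sigma}=0\ \text{ otherwise},$$ $$(\mathbf B_n)_{\vec\sigma,R}=(-1)^{\Sigma R+W(\vec\sigma)+n}\sum_{\vec\mu\ge\vec\sigma}\mathrm{ci}(\vec\sigma/\vec\mu)\,w^{\,n-W(\vec\sigma)-R\cdot\vec\mu+R|\vec\sigma_{\ell(1)}-|D^{\vec\sigma}_{\ell(1)}|}.$$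 **Networks and groves.** Let $\mathcal G$ be a finite connected simple planar graph embedded in the plane, with positive symmetric conductances $c_{u,v}$ on its edges, and a set $\mathcal D$ of vertices joined to an additional root $s$ by edges of unit conductance. Let $u_1,\dots,u_{2n}$ be distinct vertices (*nodes*) in counterclockwise order on the boundary of the outer face, and $f$ a face other than the outer one, joined to the outer face by a *zipper*: a simple path on the dual graph, reaching the outer face between $u_{2n}$ and $u_1$. For $z\in\mathbb C^*$ let $\phi_{u,v}=z$ (resp. $z^{-1}$) on the oriented edges crossed by the zipper from their left to their right (resp. from their right to their left), so that a counterclockwise cycle around $f$ has monodromy $z$, and $\phi_{u,v}=1$ on the other edges. Let $\mathbf\Delta$ be the matrix indexed by the vertices of $\mathcal G$ with $\mathbf\Delta_{u,u}$ the sum of the conductances of the edges at $u$ (including the edge to $s$ if $u\in\mathcal D$), $\mathbf\Delta_{u,v}=-c_{u,v}\phi_{u,v}^{-1}$ if $\{u,v\}$ is an edge, and $0$ otherwise; when $\det\mathbf\Delta\neq0$, let $\mathbf G=\mathbf\Delta^{-1}$ and let $\mathbf G_R^S$ be its submatrix with rows indexed by the nodes with label in $R$ and columns by those with label in $S=\mathcal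 U\setminus R$, both in ascending order. An *oriented cycle-rooted grove* of class $\vec\sigma$ is an oriented spanning subgraph whose components are: a tree containing $s$ and no node, oriented toward $s$; for each chord $(u,d)$ of $\vec\sigma$, a tree containing exactly the two nodes $u$ and $d$, oriented toward $d$, in which the path from $u$ to $d$ crosses the zipper algebraically once counterclockwise if the chord is wrapped and algebraically zero times if not; and any number of unicycles containing neither a node nor $s$, oriented toward and along their cycle. Its weight is the product of its conductances, of the factors $1-\varpi_\alpha$ over its cycles $\alpha$ ($\varpi_\alpha$ being the product of the parallel transports along $\alpha$), and of the inverses of the products of the parallel transports along the paths from $u$ to $d$. Let $\mathbf Z[\vec\sigma]$ be the sum of the weights of all groves of class $\vec\sigma$. **Proposition.** Let $n\ge1$ and $w\in\mathbb C^*$. 1. For all cyclic Dyck paths $\vec\sigma,\vec\tau$ of length $2n$, $$\sum_{R\subset\mathcal U,\,|R|=n}(\mathbf B_n)_{\vec\sigma,R}(\mathbf A_n)_{R,\vec\tau}=\begin{cases}(1-w)^n&\text{if }\vec\sigma\sim\vec\tau,\\0&\text{otherwise.}\end{cases}$$ 2. Consequently, choosing one cyclic Dyck path in each equivalence class, the matrices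 satisfy $\mathbf B_n\mathbf A_n=(1-w)^n\mathbb I$ and $\mathbf A_n\mathbf B_n=(1-w)^n\mathbb I$, so that $\mathbf A_n^{-1}=(1-w)^{-n}\mathbf B_n$ when $w\ne1$. 3. Consequently, for every network as above, if $w=z^2\neq1$ and $\det\mathbf\Delta\ne0$, then for every cyclic Dyck path $\vec\sigma$ of length $2n$, $$\mathbf Z[\vec\sigma]=\frac{\det\mathbf\Delta}{(1-w)^n}\sum_{R\subset\mathcal U,\,|R|=n}(\mathbf B_n)_{\vec\sigma,R}\,\det\mathbf G_R^S,\qquad S=\mathcal U\setminus R.$$ -/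

import Mathlib

noncomputable section

/-! ## Cyclic Dyck paths -/

/-- Height of a Dyck word after its first `j` steps. -/
def dyckHeight (p : DyckWord) (j : ℕ) : ℤ :=
  ((p.toList.take j).count DyckStep.U : ℤ) - ((p.toList.take j).count DyckStep.D : ℤ)

/-- A cyclic Dyck path of length `2 * n`: a Dyck path together with the label of its first step,
the other steps being labelled in cyclic order. The label `i ∈ {1, …, 2n}` is represented by
`i - 1 : Fin (2 * n)`; in particular the step labelled `1` has label `0`. -/
@[ext]
structure CyclicDyckPath (n : ℕ) where
  word : DyckWord
  semilength_eq : word.semilength = n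
  first : Fin (2 * n)

namespace CyclicDyckPath

variable {n : ℕ}

def equivProd (n : ℕ) :
    CyclicDyckPath n ≃ {p : DyckWord // p.semilength = n} × Fin (2 * n) where
  toFun σ := (⟨σ.word, σ.semilength_eq⟩, σ.first)
  invFun x := ⟨x.1.1, x.1.2, x.2⟩
  left_inv _ := rfl
  right_inv _ := rfl

instance : Fintype (CyclicDyckPath n) := Fintype.ofEquiv _ (equivProd n).symm

/-- Height of the vertex at position `j`, `0 ≤ j ≤ 2n` (from left to right). -/
def height (σ : CyclicDyckPath n) (j : ℕ) : ℤ := dyckHeight σ.word j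

/-- The step at position `j`, `0 ≤ j < 2n` (from left to right), is an up step. -/
def IsUp (σ : CyclicDyckPath n) (j : ℕ) : Prop := σ.word.toList[j]? = some DyckStep.U

/-- Label of the step at position `j` (addition is modulo `2n`). -/
def label (σ : CyclicDyckPath n) (j : Fin (2 * n)) : Fin (2 * n) := σ.first + j

/-- Position of the step labelled `1`. -/
def posOne (σ : CyclicDyckPath n) : ℕ := (2 * n - σ.first.val) % (2 * n)

/-- The steps at positions `i` and `j` form a chord: `i` is an up step and `j` is the closest
(down) step to its right at the same height. -/
def IsChord (σ : CyclicDyckPath n) (i j : Fin (2 * n)) : Prop :=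
  i < j ∧ σ.IsUp i ∧ σ.height (j + 1) = σ.height i ∧
    ∀ k : ℕ, (i : ℕ) < k → k ≤ j → σ.height i < σ.height k

open Classical in
/-- The oriented pairing of the labels given by the chords:
pairs (label of the up step, label of the down step). -/
def chords (σ : CyclicDyckPath n) : Finset (Fin (2 * n) × Fin (2 * n)) :=
  (Finset.univ.filter fun p : Fin (2 * n) × Fin (2 * n) => σ.IsChord p.1 p.2).image
    fun p => (σ.label p.1, σ.label p.2)

/-- Two cyclic Dyck paths are equivalent when they encode the same oriented pairing, that is,
when they agree up to a cyclic permutation of their mountaintops together with the labels. -/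
instance pairingSetoid (n : ℕ) : Setoid (CyclicDyckPath n) := Setoid.ker chords

open Classical in
instance : Fintype (Quotient (pairingSetoid n)) := Fintype.ofFinite _

/-- The area `𝒜(σ) = ∑ hᵢ(σ)` between the path and the horizontal axis. -/
def area (σ : CyclicDyckPath n) : ℤ := ∑ j ∈ Finset.range (2 * n + 1), σ.height j

/-- `W(σ) = h₀(σ)`, the height of the starting point of the step labelled `1`. -/
def winding (σ : CyclicDyckPath n) : ℤ := σ.height σ.posOne

/-- `R ∩ σ`: the set `R` contains exactly one of the two labels of each chord. -/
def MeetsEachChordOnce (R : Finset (Fin (2 * n))) (σ : CyclicDyckPath n) : Prop :=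
  ∀ c ∈ σ.chords, Xor (c.1 ∈ R) (c.2 ∈ R)

open Classical in
/-- `R · σ`: the number of up steps with label in `R`. -/
def upCount (R : Finset (Fin (2 * n))) (σ : CyclicDyckPath n) : ℕ :=
  (Finset.univ.filter fun j : Fin (2 * n) => σ.IsUp j ∧ σ.label j ∈ R).card

open Classical in
/-- `R : σ`: the number of up steps with label in `R` that belong to wrapped chords, i.e. chords
whose up step has a higher label than their down step. -/
def wrappedCount (R : Finset (Fin (2 * n))) (σ : CyclicDyckPath n) : ℕ :=
  (σ.chords.filter fun c => c.2 < c.1 ∧ c.1 ∈ R).card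

open Classical in
/-- `R | σ_{ℓ(1)}`: the number of steps strictly to the left of the step `1` with label in `R`. -/
def leftCount (R : Finset (Fin (2 * n))) (σ : CyclicDyckPath n) : ℕ :=
  (Finset.univ.filter fun j : Fin (2 * n) => (j : ℕ) < σ.posOne ∧ σ.label j ∈ R).card

open Classical in
/-- `|D^σ_{ℓ(1)}|`: the number of down steps strictly to the left of the step `1`. -/
def leftDownCount (σ : CyclicDyckPath n) : ℕ :=
  (Finset.univ.filter fun j : Fin (2 * n) => (j : ℕ) < σ.posOne ∧ ¬ σ.IsUp j).card

/-- `μ ≥ σ`: same positions of the labels and pointwise larger heights. -/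
def Dominates (μ σ : CyclicDyckPath n) : Prop :=
  μ.first = σ.first ∧ ∀ j ≤ 2 * n, σ.height j ≤ μ.height j

/-! ### Cover-inclusive Dyck tilings -/

open Classical in
/-- The centres of the unit squares (rotated by 45°) filling the shape between `σ` (below)
and `μ` (above). -/
def shape (σ μ : CyclicDyckPath n) : Finset (ℕ × ℤ) :=
  (Finset.range (2 * n + 1) ×ˢ Finset.Icc (0 : ℤ) n).filter fun b =>
    σ.height b.1 < b.2 ∧ b.2 < μ.height b.1 ∧ Odd (b.2 - σ.height b.1)

end CyclicDyckPath

/-- A Dyck tile: a ribbon of squares whose centres are the vertices of a (translated, possibly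
zero length) Dyck path. -/
def IsDyckTile (t : Finset (ℕ × ℤ)) : Prop :=
  ∃ (p : DyckWord) (a : ℕ) (b : ℤ),
    t = (Finset.range (2 * p.semilength + 1)).image fun j => (a + j, b + dyckHeight p j)

/-- A Dyck tiling of a set of squares, as a partition into Dyck tiles. -/
def IsDyckTiling {s : Finset (ℕ × ℤ)} (P : Finpartition s) : Prop :=
  ∀ t ∈ P.parts, IsDyckTile t

/-- Whenever a tile `t` has a square right above a square of a tile `t'`, the horizontal extent
of `t` is contained in that of `t'`. -/
def IsCoverInclusive {s : Finset (ℕ × ℤ)} (P : Finpartition s) : Prop :=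
  ∀ t ∈ P.parts, ∀ t' ∈ P.parts, (∃ x y, (x, y) ∈ t' ∧ (x, y + 2) ∈ t) →
    t.image Prod.fst ⊆ t'.image Prod.fst

namespace CyclicDyckPath

variable {n : ℕ}

/-- `ci(σ/μ)`: the number of cover-inclusive Dyck tilings of the shape between `μ` and `σ`. -/
def ci (σ μ : CyclicDyckPath n) : ℕ :=
  Nat.card {P : Finpartition (shape σ μ) // IsDyckTiling P ∧ IsCoverInclusive P}

end CyclicDyckPath

/-! ## The matrices `A_n` and `B_n` -/

/-- The subsets `R` of order `n` of the `2n` labels. -/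
abbrev HalfSubset (n : ℕ) : Type := {R : Finset (Fin (2 * n)) // R.card = n}

theorem HalfSubset.card_compl {n : ℕ} (R : HalfSubset n) : (R.1ᶜ).card = n := by
  rw [Finset.card_compl, R.2, Fintype.card_fin]; omega

open CyclicDyckPath in
open Classical in
/-- `(A_n)_{R,σ}`. -/
def entryA {n : ℕ} (w : ℂ) (R : HalfSubset n) (σ : CyclicDyckPath n) : ℂ :=
  if MeetsEachChordOnce R.1 σ then
    (-1) ^ ((σ.area - n) / 2 + (n + 1) * σ.winding) * w ^ (σ.winding - wrappedCount R.1 σ)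
  else 0

open CyclicDyckPath in
open Classical in
/-- `(B_n)_{σ,R}`; the sum `ΣR` is that of the labels in `{1, …, 2n}`. -/
def entryB {n : ℕ} (w : ℂ) (σ : CyclicDyckPath n) (R : HalfSubset n) : ℂ :=
  (-1) ^ ((∑ r ∈ R.1, ((r : ℤ) + 1)) + σ.winding + n) *
    ∑ μ : CyclicDyckPath n with μ.Dominates σ,
      (ci σ μ : ℂ) *
        w ^ ((n : ℤ) - σ.winding - upCount R.1 μ + leftCount R.1 σ - leftDownCount σ)

/-- The square matrix `A_n`, its columns being indexed by the inequivalent cyclic Dyck paths. -/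
def matrixA (n : ℕ) (w : ℂ) :
    Matrix (HalfSubset n) (Quotient (CyclicDyckPath.pairingSetoid n)) ℂ :=
  Matrix.of fun R q => entryA w R q.out

/-- The square matrix `B_n`, its rows being indexed by the inequivalent cyclic Dyck paths. -/
def matrixB (n : ℕ) (w : ℂ) :
    Matrix (Quotient (CyclicDyckPath.pairingSetoid n)) (HalfSubset n) ℂ :=
  Matrix.of fun q R => entryB w q.out R

/-! ## Planar graphs with a zipper, line bundle Laplacian and oriented cycle-rooted groves -/

/-- A finite connected simple graph embedded in the (oriented) sphere, given by its rotation
system: `rot` sends an oriented edge to the next one, counterclockwise, around its origin. -/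
structure PlanarMap (V : Type*) [Fintype V] where
  graph : SimpleGraph V
  connected : graph.Connected
  rot : Equiv.Perm graph.Dart
  rot_sameCycle : ∀ d e : graph.Dart, rot.SameCycle d e ↔ d.fst = e.fst
  /-- Euler's formula; the faces are the orbits of the permutation sending an oriented edge to
  the next one along the face on its left. -/
  euler : Fintype.card V + Nat.card (Quotient (Equiv.Perm.SameCycle.setoid
      ((SimpleGraph.Dart.symm_involutive (G := graph)).toPerm.trans rot.symm))) =
    Nat.card graph.edgeSet + 2

namespace PlanarMap

variable {V : Type*} [Fintype V]

/-- The next oriented edge along the face on the left. -/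
def facePerm (M : PlanarMap V) : Equiv.Perm M.graph.Dart :=
  (SimpleGraph.Dart.symm_involutive (G := M.graph)).toPerm.trans M.rot.symm

/-- The oriented edges `d` and `e` have the same face on their left. -/
def SameFace (M : PlanarMap V) (d e : M.graph.Dart) : Prop := M.facePerm.SameCycle d e

end PlanarMap

/-- A planar network: a planar graph with conductances, a set of vertices wired to the root `s`,
a marked face `f` joined to the outer face by a zipper, and `2n` nodes on the outer boundary. -/
structure Network (V : Type*) [Fintype V] (n : ℕ) extends PlanarMap V where
  conductance : V → V → ℝ
  conductance_symm : ∀ u v, conductance u v = conductance v u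
  conductance_pos : ∀ u v, graph.Adj u v → 0 < conductance u v
  /-- The vertices connected to the root `s` (by an edge of unit conductance). -/
  wired : Finset V
  /-- The zipper, a path on the dual graph from the marked face `f` (on the left of the first
  oriented edge) to the outer face (on the right of the last one). It is given by the successive
  edges it crosses, each oriented so that the zipper crosses it from its left to its right. -/
  zipper : List graph.Dart
  zipper_ne_nil : zipper ≠ []
  zipper_isChain : zipper.IsChain fun d e => toPlanarMap.SameFace d.symm e
  zipper_faces : zipper.Pairwise fun d e => ¬ toPlanarMap.SameFace d e
  zipper_outer : ∀ d ∈ zipper, ¬ toPlanarMap.SameFace d (zipper.getLast zipper_ne_nil).symm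
  /-- The nodes `u₁, …, u_{2n}`. -/
  node : Fin (2 * n) → V
  node_injective : Function.Injective node
  /-- The nodes lie on the boundary of the outer face, in counterclockwise order, and the zipper
  reaches the outer face between `u_{2n}` and `u₁`: one meets `u₁, …, u_{2n}` in this order when
  going counterclockwise once around the outer boundary, starting from the edge crossed last by
  the zipper. (The outer face lies on the left of its oriented boundary edges, so that `facePerm`
  follows the outer boundary clockwise.) -/
  node_boundary : ∃ k : Fin (2 * n) → ℕ, StrictMono k ∧ ∀ i,
    k i < Function.minimalPeriod toPlanarMap.facePerm (zipper.getLast zipper_ne_nil).symm ∧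
    node i = ((toPlanarMap.facePerm.symm ^ k i) (zipper.getLast zipper_ne_nil).symm).fst

namespace Network

variable {V : Type*} [Fintype V] {n : ℕ}

open Classical in
/-- The algebraic number of crossings of the zipper by the oriented edge from `u` to `v`. It is
counted positively for counterclockwise motion around the marked face `f`. -/
def crossing (N : Network V n) (u v : V) : ℤ :=
  ((N.zipper.map SimpleGraph.Dart.toProd).count (u, v) : ℤ) -
    ((N.zipper.map SimpleGraph.Dart.toProd).count (v, u) : ℤ)

/-- The parallel transport `φ_{u,v}`: it is `z` (resp. `z⁻¹`) on the oriented edges crossed by the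
zipper from left to right (resp. from right to left), and `1` on the other edges. -/
def transport (N : Network V n) (z : ℂ) (u v : V) : ℂ := z ^ N.crossing u v

open Classical in
/-- The line bundle Laplacian, with Dirichlet boundary conditions at the root. -/
def laplacian (N : Network V n) (z : ℂ) : Matrix V V ℂ :=
  Matrix.of fun u v =>
    if u = v then
      (∑ x : V with N.graph.Adj u x, (N.conductance u x : ℂ)) + if u ∈ N.wired then 1 else 0
    else if N.graph.Adj u v then -(N.conductance u v : ℂ) * (N.transport z u v)⁻¹
    else 0

open Classical in
/-- The line bundle Green function. -/
def green (N : Network V n) (z : ℂ) : Matrix V V ℂ := (N.laplacian z)⁻¹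

/-- `det G_R^S`, where `S` is the complement of `R`: the rows (resp. columns) are indexed by the
nodes in `R` (resp. `S`), in ascending order. -/
def greenMinor (N : Network V n) (z : ℂ) (R : HalfSubset n) : ℂ :=
  ((N.green z).submatrix (fun i => N.node (R.1.orderEmbOfFin R.2 i))
    (fun j => N.node (R.1ᶜ.orderEmbOfFin R.card_compl j))).det

end Network

/-- An oriented spanning subgraph of the graph with root `s` in which each vertex other than `s`
has at most one outgoing edge. The value at `u` is `none` when there is no edge going out of `u`,
`some none` when the edge goes to `s`, and `some (some v)` when it goes to the vertex `v`. -/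
abbrev OutEdges (V : Type*) : Type _ := V → Option (Option V)

namespace OutEdges

variable {V : Type*} [Fintype V]

/-- The subgraph contains the oriented edge from `u` to `v`. -/
def Arrow (g : OutEdges V) (u v : V) : Prop := g u = some (some v)

open Classical in
/-- The vertices (other than `s`) on the oriented path starting at `u`. -/
def trail (g : OutEdges V) (u : V) : Finset V :=
  Finset.univ.filter fun v => Relation.ReflTransGen g.Arrow u v

/-- `C` is the vertex set of an oriented cycle. -/
def IsCycle (g : OutEdges V) (C : Finset V) : Prop :=
  C.Nonempty ∧ ∀ u ∈ C, ∀ v, v ∈ C ↔ Relation.TransGen g.Arrow u v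

/-- Product (for `φ` multiplicative) of `φ u v` over the oriented edges `(u, v)` with `u ∈ C`,
edges to the root excluded. -/
def edgeProd (g : OutEdges V) (φ : V → V → ℂ) (C : Finset V) : ℂ :=
  ∏ u ∈ C, match g u with
    | some (some v) => φ u v
    | _ => 1

/-- Sum of `κ u v` over the oriented edges `(u, v)` with `u ∈ C`, edges to the root excluded. -/
def edgeSum (g : OutEdges V) (κ : V → V → ℤ) (C : Finset V) : ℤ :=
  ∑ u ∈ C, match g u with
    | some (some v) => κ u v
    | _ => 0

end OutEdges

namespace Network

variable {V : Type*} [Fintype V] {n : ℕ}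

/-- `g` is an oriented cycle-rooted grove whose nodes are distributed in the rooted trees according
to the oriented pairing `σ`, in the winding class encoded by `σ`.

The vertices without outgoing edge are exactly the nodes labelled by the down steps of `σ`, and
the node of each up step is connected to that of the down step of its chord. Every component
is thus a tree oriented toward `s`, or a tree oriented toward the node of a down step and
containing exactly the two nodes of a chord, or a cycle-rooted tree oriented toward its cycle and
containing neither a node nor `s`. For a chord `(u, d)`, the path from `u` to `d` crosses the
zipper (algebraically once, counterclockwise around `f`) if the chord is wrapped, and does not
cross it (algebraically) otherwise. -/
structure IsGrove (N : Network V n) (σ : CyclicDyckPath n) (g : OutEdges V) : Prop where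
  adj : ∀ u v, g u = some (some v) → N.graph.Adj u v
  wired : ∀ u, g u = some none → u ∈ N.wired
  sink : ∀ u, g u = none ↔ ∃ c ∈ σ.chords, u = N.node c.2
  connects : ∀ c ∈ σ.chords, Relation.ReflTransGen g.Arrow (N.node c.1) (N.node c.2)
  winding : ∀ c ∈ σ.chords,
    g.edgeSum N.crossing (g.trail (N.node c.1)) = if c.2 < c.1 then 1 else 0

open Classical in
/-- The weight of a grove: the product of its conductances, of `1 - ϖ` over its cycles (where `ϖ` is
the monodromy), and of the inverse parallel transports along the paths between its nodes. -/
def groveWeight (N : Network V n) (z : ℂ) (σ : CyclicDyckPath n) (g : OutEdges V) : ℂ :=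
  g.edgeProd (fun u v => (N.conductance u v : ℂ)) Finset.univ *
    (∏ C : Finset V with g.IsCycle C, (1 - g.edgeProd (N.transport z) C)) *
    ∏ c ∈ σ.chords, (g.edgeProd (N.transport z) (g.trail (N.node c.1)))⁻¹

open Classical in
/-- The winding partition function `𝐙[σ]` for oriented cycle-rooted groves. -/
def partitionFunction (N : Network V n) (z : ℂ) (σ : CyclicDyckPath n) : ℂ :=
  ∑ g : OutEdges V with N.IsGrove σ g, N.groveWeight z σ g

end Network

end

noncomputable section

section
/-! ## Height functions of Dyck words -/

/-- `h` is the height function of a Dyck path with `2 * n` steps, extended by zero. -/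
structure IsDyckHeight (n : ℕ) (h : ℕ → ℤ) : Prop where
  zero : h 0 = 0
  step : ∀ j < 2 * n, h (j + 1) = h j + 1 ∨ h (j + 1) = h j - 1
  nonneg : ∀ j, 0 ≤ h j
  eq_zero : ∀ j, 2 * n ≤ j → h j = 0

theorem DyckWord.length_eq (p : DyckWord) : p.toList.length = 2 * p.semilength :=
  p.two_mul_semilength_eq_length.symm

theorem dyckHeight_succ_of_U (p : DyckWord) (j : ℕ) (h : p.toList[j]? = some DyckStep.U) :
    dyckHeight p (j + 1) = dyckHeight p j + 1 := by
  unfold dyckHeight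
  rw [List.take_add_one, h]
  simp [List.count_append]
  ring

theorem dyckHeight_succ_of_D (p : DyckWord) (j : ℕ) (h : p.toList[j]? = some DyckStep.D) :
    dyckHeight p (j + 1) = dyckHeight p j - 1 := by
  unfold dyckHeight
  rw [List.take_add_one, h]
  simp [List.count_append]
  ring

theorem DyckWord.getElem?_cases (p : DyckWord) {j : ℕ} (hj : j < 2 * p.semilength) :
    p.toList[j]? = some DyckStep.U ∨ p.toList[j]? = some DyckStep.D := by
  have : j < p.toList.length := by rw [p.length_eq]; exact hj
  rw [List.getElem?_eq_getElem this]
  rcases DyckStep.dichotomy p.toList[j] with h | h <;> simp [h]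

theorem isDyckHeight_dyckHeight (p : DyckWord) : IsDyckHeight p.semilength (dyckHeight p) where
  zero := by simp [dyckHeight]
  step j hj := by
    rcases p.getElem?_cases hj with h | h
    · exact Or.inl (dyckHeight_succ_of_U p j h)
    · exact Or.inr (dyckHeight_succ_of_D p j h)
  nonneg j := by
    have := p.count_D_le_count_U j
    unfold dyckHeight; omega
  eq_zero j hj := by
    unfold dyckHeight
    rw [List.take_of_length_le (by rw [p.length_eq]; exact hj), p.count_U_eq_count_D]
    simp

theorem dyckWord_isUp_iff (p : DyckWord) (j : ℕ) :
    p.toList[j]? = some DyckStep.U ↔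
      j < 2 * p.semilength ∧ dyckHeight p (j + 1) = dyckHeight p j + 1 := by
  constructor
  · intro h
    refine ⟨?_, dyckHeight_succ_of_U p j h⟩
    rw [← p.length_eq]
    exact (List.getElem?_eq_some_iff.1 h).1
  · rintro ⟨hj, h⟩
    rcases p.getElem?_cases hj with h' | h'
    · exact h'
    · have := dyckHeight_succ_of_D p j h'
      omega

theorem DyckWord.ext_of_height {p q : DyckWord} (hs : p.semilength = q.semilength)
    (h : ∀ j ≤ 2 * p.semilength, dyckHeight p j = dyckHeight q j) : p = q := by
  apply DyckWord.ext
  apply List.ext_getElem?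
  intro j
  by_cases hj : j < 2 * p.semilength
  · have h1 := dyckWord_isUp_iff p j
    have h2 := dyckWord_isUp_iff q j
    rw [h j (by omega), h (j + 1) (by omega), hs] at h1
    rw [← h2] at h1
    rcases p.getElem?_cases hj with h' | h'
    · rw [h', h1.1 h']
    · rcases q.getElem?_cases (hs ▸ hj) with h'' | h''
      · rw [h1.2 h'', h'']
      · rw [h', h'']
  · rw [List.getElem?_eq_none (by rw [p.length_eq]; omega),
      List.getElem?_eq_none (by rw [q.length_eq]; omega)]

theorem IsDyckHeight.exists_dyckWord {n : ℕ} {h : ℕ → ℤ} (hh : IsDyckHeight n h) :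
    ∃ p : DyckWord, p.semilength = n ∧ dyckHeight p = h := by
  classical
  set f : ℕ → DyckStep := fun j => if h (j + 1) = h j + 1 then DyckStep.U else DyckStep.D with hf
  set l : List DyckStep := (List.range (2 * n)).map f with hl
  have hlen : l.length = 2 * n := by simp [hl]
  have key : ∀ j, ((l.take j).count DyckStep.U : ℤ) - ((l.take j).count DyckStep.D : ℤ) = h j := by
    intro j
    induction j with
    | zero => simp [hh.zero]
    | succ j ih =>
      by_cases hj : j < 2 * n
      · have hget : l[j]? = some (f j) := by simp [hl, hj]
        rw [List.take_add_one, hget]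
        rcases hh.step j hj with hs | hs
        · have : f j = DyckStep.U := by simp [hf, hs]
          rw [this, List.count_append, List.count_append, hs]
          simp; linarith
        · have : f j = DyckStep.D := by simp only [hf, hs]; rw [if_neg]; omega
          rw [this, List.count_append, List.count_append, hs]
          simp; linarith
      · rw [List.take_of_length_le (by omega)]
        rw [List.take_of_length_le (by omega), hh.eq_zero j (by omega)] at ih
        rw [ih, hh.eq_zero _ (by omega)]
  have htot := key (2 * n)
  rw [List.take_of_length_le (by omega), hh.eq_zero _ le_rfl] at htot
  refine ⟨⟨l, by omega, fun i => ?_⟩, ?_, ?_⟩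
  · have := key i
    have := hh.nonneg i
    omega
  · generalize_proofs h1 h2
    have := DyckWord.two_mul_semilength_eq_length (p := ⟨l, h1, h2⟩)
    simp only [hlen] at this
    omega
  · funext j
    exact key j

theorem IsDyckHeight.le_index {n : ℕ} {h : ℕ → ℤ} (hh : IsDyckHeight n h) (j : ℕ) : h j ≤ j := by
  induction j with
  | zero => simp [hh.zero]
  | succ j ih =>
    by_cases hj : j < 2 * n
    · rcases hh.step j hj with h | h <;> push_cast <;> omega
    · rw [hh.eq_zero _ (by omega)]; positivity

theorem IsDyckHeight.le_compl {n : ℕ} {h : ℕ → ℤ} (hh : IsDyckHeight n h) (j : ℕ) :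
    h (2 * n - j) ≤ j := by
  induction j with
  | zero => simp [hh.eq_zero]
  | succ j ih =>
    by_cases hj : j < 2 * n
    · have : 2 * n - j = (2 * n - (j + 1)) + 1 := by omega
      rw [this] at ih
      rcases hh.step (2 * n - (j + 1)) (by omega) with h | h <;> push_cast <;> omega
    · rw [show 2 * n - (j + 1) = 0 by omega, hh.zero]; positivity

theorem IsDyckHeight.le_half {n : ℕ} {h : ℕ → ℤ} (hh : IsDyckHeight n h) (j : ℕ) : h j ≤ n := by
  by_cases hj : j ≤ n
  · have := hh.le_index j; omega
  · by_cases hj' : j ≤ 2 * n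
    · have := hh.le_compl (2 * n - j)
      rw [show 2 * n - (2 * n - j) = j by omega] at this
      omega
    · rw [hh.eq_zero _ (by omega)]; positivity

/-- Two height functions have the same parity at each position. -/
theorem IsDyckHeight.even_sub {n : ℕ} {g h : ℕ → ℤ} (hg : IsDyckHeight n g) (hh : IsDyckHeight n h)
    (j : ℕ) : Even (g j - h j) := by
  induction j with
  | zero => simp [hh.zero, hg.zero]
  | succ j ih =>
    by_cases hj : j < 2 * n
    · obtain ⟨c, hc⟩ := ih
      rcases hg.step j hj with h1 | h1 <;> rcases hh.step j hj with h2 | h2 <;> rw [h1, h2]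
      · exact ⟨c, by linarith⟩
      · exact ⟨c + 1, by linarith⟩
      · exact ⟨c - 1, by linarith⟩
      · exact ⟨c, by linarith⟩
    · simp [hg.eq_zero (j + 1) (by omega), hh.eq_zero (j + 1) (by omega)]

namespace CyclicDyckPath

variable {n : ℕ}

theorem isDyckHeight (σ : CyclicDyckPath n) : IsDyckHeight n σ.height := by
  have := isDyckHeight_dyckHeight σ.word
  rw [σ.semilength_eq] at this
  exact this

theorem isUp_iff (σ : CyclicDyckPath n) (j : ℕ) :
    σ.IsUp j ↔ j < 2 * n ∧ σ.height (j + 1) = σ.height j + 1 := by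
  unfold IsUp
  rw [dyckWord_isUp_iff, σ.semilength_eq]; rfl

theorem ext_of_height {σ τ : CyclicDyckPath n} (h₁ : σ.first = τ.first)
    (h : ∀ j ≤ 2 * n, σ.height j = τ.height j) : σ = τ := by
  apply CyclicDyckPath.ext _ h₁
  apply DyckWord.ext_of_height (by rw [σ.semilength_eq, τ.semilength_eq])
  rw [σ.semilength_eq]
  exact h

theorem exists_of_isDyckHeight {h : ℕ → ℤ} (hh : IsDyckHeight n h) (l : Fin (2 * n)) :
    ∃ σ : CyclicDyckPath n, σ.first = l ∧ σ.height = h := by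
  obtain ⟨p, hp, hp'⟩ := hh.exists_dyckWord
  exact ⟨⟨p, hp, l⟩, rfl, hp'⟩

end CyclicDyckPath

/-! ## Ribbons -/

/-- The squares centred above the interval `[a, b]`, at the heights `g`. -/
def ribbon (g : ℕ → ℤ) (a b : ℕ) : Finset (ℕ × ℤ) := (Finset.Icc a b).image fun k => (k, g k)

theorem mem_ribbon {g : ℕ → ℤ} {a b x : ℕ} {y : ℤ} :
    (x, y) ∈ ribbon g a b ↔ a ≤ x ∧ x ≤ b ∧ y = g x := by
  simp only [ribbon, Finset.mem_image, Finset.mem_Icc, Prod.mk.injEq]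
  constructor
  · rintro ⟨k, ⟨h1, h2⟩, rfl, rfl⟩; exact ⟨h1, h2, rfl⟩
  · rintro ⟨h1, h2, rfl⟩; exact ⟨x, ⟨h1, h2⟩, rfl, rfl⟩

/-- `g` follows a translated Dyck path between `a` and `b`. -/
structure IsExcursion (g : ℕ → ℤ) (a b : ℕ) : Prop where
  le : a ≤ b
  eq : g a = g b
  step : ∀ j, a ≤ j → j < b → g (j + 1) = g j + 1 ∨ g (j + 1) = g j - 1
  ge : ∀ j, a ≤ j → j ≤ b → g a ≤ g j

theorem IsDyckTile.exists_ribbon {t : Finset (ℕ × ℤ)} (ht : IsDyckTile t) :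
    ∃ g a b, IsExcursion g a b ∧ t = ribbon g a b := by
  obtain ⟨p, a, c, rfl⟩ := ht
  have hp := isDyckHeight_dyckHeight p
  refine ⟨fun k => c + dyckHeight p (k - a), a, a + 2 * p.semilength, ⟨by omega, ?_, ?_, ?_⟩, ?_⟩
  · simp [hp.zero, hp.eq_zero]
  · intro j h1 h2
    have := hp.step (j - a) (by omega)
    rw [show j + 1 - a = j - a + 1 by omega]
    omega
  · intro j h1 h2
    have := hp.nonneg (j - a)
    simp [hp.zero]; omega
  · ext ⟨x, y⟩
    rw [mem_ribbon]
    simp only [Finset.mem_image, Finset.mem_range, Prod.mk.injEq]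
    constructor
    · rintro ⟨j, hj, rfl, rfl⟩
      exact ⟨by omega, by omega, by simp⟩
    · rintro ⟨h1, h2, rfl⟩
      exact ⟨x - a, by omega, by omega, rfl⟩

theorem IsExcursion.parity {g : ℕ → ℤ} {a b : ℕ} (hg : IsExcursion g a b) (m : ℕ)
    (hm : a + m ≤ b) : Even (g (a + m) - g a - m) := by
  induction m with
  | zero => simp
  | succ m ih =>
    obtain ⟨c, hc⟩ := ih (by omega)
    rcases hg.step (a + m) (by omega) (by omega) with h | h
    · exact ⟨c, by rw [← add_assoc, h]; push_cast; linarith⟩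
    · exact ⟨c - 1, by rw [← add_assoc, h]; push_cast; linarith⟩

theorem IsExcursion.isDyckTile {g : ℕ → ℤ} {a b : ℕ} (hg : IsExcursion g a b) :
    IsDyckTile (ribbon g a b) := by
  have hle := hg.le
  have hpar := hg.parity (b - a) (by omega)
  rw [show a + (b - a) = b by omega, hg.eq, sub_self, zero_sub] at hpar
  obtain ⟨m, hm⟩ := hpar
  set n := (b - a) / 2 with hn
  have hb : b = a + 2 * n := by omega
  have hh : IsDyckHeight n (fun j => if j ≤ 2 * n then g (a + j) - g a else 0) := by
    refine ⟨by simp, ?_, ?_, ?_⟩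
    · intro j hj
      simp only [show j + 1 ≤ 2 * n by omega, show j ≤ 2 * n by omega, if_true]
      have := hg.step (a + j) (by omega) (by omega)
      rw [← add_assoc]; omega
    · intro j
      split_ifs with h
      · have := hg.ge (a + j) (by omega) (by omega); omega
      · exact le_rfl
    · intro j hj
      split_ifs with h
      · rw [show a + j = b by omega, hg.eq]; ring
      · rfl
  obtain ⟨p, hp, hp'⟩ := hh.exists_dyckWord
  refine ⟨p, a, g a, ?_⟩
  ext ⟨x, y⟩
  rw [mem_ribbon, hp, hp']
  simp only [Finset.mem_image, Finset.mem_range, Prod.mk.injEq]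
  constructor
  · rintro ⟨h1, h2, rfl⟩
    refine ⟨x - a, by omega, by omega, ?_⟩
    simp only [show x - a ≤ 2 * n by omega, if_true, show a + (x - a) = x by omega]; ring
  · rintro ⟨j, hj, rfl, rfl⟩
    refine ⟨by omega, by omega, ?_⟩
    simp only [show j ≤ 2 * n by omega, if_true]; ring

end

section
/-! ## Cover-inclusive tilings of the region between two paths -/

/-- `(x, y)` is the centre of a square between the paths of heights `s` (below) and `t` (above). -/
def InRegion (n : ℕ) (s t : ℕ → ℤ) (x : ℕ) (y : ℤ) : Prop :=
  x ≤ 2 * n ∧ s x < y ∧ y < t x ∧ Odd (y - s x)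

/-- `P` is the set of tiles of a cover-inclusive Dyck tiling of the region between `s` and `t`. -/
structure IsCITiling (n : ℕ) (s t : ℕ → ℤ) (P : Finset (Finset (ℕ × ℤ))) : Prop where
  sub : ∀ T ∈ P, ∀ x y, (x, y) ∈ T → InRegion n s t x y
  cover : ∀ x y, InRegion n s t x y → ∃ T ∈ P, (x, y) ∈ T
  disj : ∀ T ∈ P, ∀ T' ∈ P, ∀ x y, (x, y) ∈ T → (x, y) ∈ T' → T = T'
  tile : ∀ T ∈ P, IsDyckTile T
  incl : ∀ T ∈ P, ∀ T' ∈ P, ∀ x y, (x, y) ∈ T' → (x, y + 2) ∈ T →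
    ∀ z w, (z, w) ∈ T → ∃ w', (z, w') ∈ T'

/-- A function with even values and steps at most `2` vanishes when it changes sign. -/
theorem exists_eq_zero_of_sign_change (D : ℕ → ℤ) (i : ℕ) (m : ℕ)
    (hstep : ∀ k, i ≤ k → k < i + m → D (k + 1) ≤ D k + 2 ∧ D k - 2 ≤ D (k + 1))
    (heven : ∀ k, i ≤ k → k ≤ i + m → Even (D k))
    (hsign : (0 ≤ D i ∧ D (i + m) ≤ 0) ∨ (D i ≤ 0 ∧ 0 ≤ D (i + m))) :
    ∃ k, i ≤ k ∧ k ≤ i + m ∧ D k = 0 := by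
  induction m with
  | zero => exact ⟨i, le_rfl, le_rfl, by simp only [add_zero] at hsign; omega⟩
  | succ m ih =>
    by_cases h1 : D (i + (m + 1)) = 0
    · exact ⟨_, by omega, le_rfl, h1⟩
    by_cases h0 : D (i + m) = 0
    · exact ⟨_, by omega, by omega, h0⟩
    have hs := hstep (i + m) (by omega) (by omega)
    rw [add_assoc] at hs
    obtain ⟨c, hc⟩ := heven (i + m) (by omega) (by omega)
    obtain ⟨d, hd⟩ := heven (i + (m + 1)) (by omega) (by omega)
    obtain ⟨k, hk1, hk2, hk3⟩ := ih (fun k h1 h2 => hstep k h1 (by omega))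
      (fun k h1 h2 => heven k h1 (by omega)) (by omega)
    exact ⟨k, hk1, by omega, hk3⟩

theorem IsCITiling.ribbon_of_mem {n : ℕ} {s t : ℕ → ℤ} {P : Finset (Finset (ℕ × ℤ))}
    (hP : IsCITiling n s t P) (hs : IsDyckHeight n s) (ht : IsDyckHeight n t)
    {T : Finset (ℕ × ℤ)} (hT : T ∈ P) {x : ℕ} (hx : (x, s x + 1) ∈ T) :
    ∃ a b, a + 1 ≤ x ∧ x ≤ b ∧ b < 2 * n ∧ T = ribbon (fun k => s k + 1) (a + 1) b ∧
      IsExcursion s (a + 1) b := by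
  obtain ⟨g, a, b, hg, rfl⟩ := (hP.tile T hT).exists_ribbon
  obtain ⟨hax, hxb, hgx⟩ := mem_ribbon.1 hx
  have key : ∀ k, a ≤ k → k ≤ b → g k = s k + 1 := by
    intro k hak hkb
    by_contra hne
    have hreg := hP.sub _ hT k (g k) (mem_ribbon.2 ⟨hak, hkb, rfl⟩)
    obtain ⟨r1, r2, r3, c, hc⟩ := hreg
    have hge : s k + 3 ≤ g k := by omega
    obtain ⟨T', hT', hmem'⟩ := hP.cover k (g k - 2) ⟨r1, by omega, by omega, ⟨c - 1, by omega⟩⟩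
    have hincl := hP.incl _ hT T' hT' k (g k - 2) hmem'
      (mem_ribbon.2 ⟨hak, hkb, by ring⟩)
    obtain ⟨g', a', b', hg', rfl⟩ := (hP.tile T' hT').exists_ribbon
    have hin : ∀ z, a ≤ z → z ≤ b → a' ≤ z ∧ z ≤ b' := by
      intro z h1 h2
      obtain ⟨w', hw'⟩ := hincl z (g z) (mem_ribbon.2 ⟨h1, h2, rfl⟩)
      obtain ⟨h3, h4, -⟩ := mem_ribbon.1 hw'
      exact ⟨h3, h4⟩
    have hk' := (mem_ribbon.1 hmem').2.2
    have hx' : s x + 1 ≤ g' x := by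
      have := (hP.sub _ hT' x (g' x) (mem_ribbon.2 ⟨(hin x hax hxb).1, (hin x hax hxb).2, rfl⟩)).2.1
      omega
    have hz : ∃ z, a ≤ z ∧ z ≤ b ∧ g' z - g z = 0 := by
      have hst : ∀ z, a ≤ z → z < b → g' (z + 1) - g (z + 1) ≤ g' z - g z + 2 ∧
          g' z - g z - 2 ≤ g' (z + 1) - g (z + 1) := by
        intro z h1 h2
        have e1 := hg.step z h1 h2
        have e2 := hg'.step z (hin z h1 h2.le).1
          (by have := (hin (z + 1) (by omega) (by omega)).2; omega)
        omega
      have hev : ∀ z, a ≤ z → z ≤ b → Even (g' z - g z) := by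
        intro z h1 h2
        obtain ⟨c1, hc1⟩ := (hP.sub _ hT z (g z) (mem_ribbon.2 ⟨h1, h2, rfl⟩)).2.2.2
        obtain ⟨c2, hc2⟩ := (hP.sub _ hT' z (g' z)
          (mem_ribbon.2 ⟨(hin z h1 h2).1, (hin z h1 h2).2, rfl⟩)).2.2.2
        exact ⟨c2 - c1, by omega⟩
      rcases le_total x k with hxk | hxk
      · obtain ⟨z, hz1, hz2, hz3⟩ := exists_eq_zero_of_sign_change (fun z => g' z - g z) x (k - x)
          (fun z h1 h2 => hst z (by omega) (by omega)) (fun z h1 h2 => hev z (by omega) (by omega))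
          (by rw [show x + (k - x) = k by omega]; left; constructor <;> omega)
        exact ⟨z, by omega, by omega, hz3⟩
      · obtain ⟨z, hz1, hz2, hz3⟩ := exists_eq_zero_of_sign_change (fun z => g' z - g z) k (x - k)
          (fun z h1 h2 => hst z (by omega) (by omega)) (fun z h1 h2 => hev z (by omega) (by omega))
          (by rw [show k + (x - k) = x by omega]; right; constructor <;> omega)
        exact ⟨z, by omega, by omega, hz3⟩
    obtain ⟨z, hz1, hz2, hz3⟩ := hz
    have heq := hP.disj _ hT _ hT' z (g z) (mem_ribbon.2 ⟨hz1, hz2, rfl⟩)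
      (mem_ribbon.2 ⟨(hin z hz1 hz2).1, (hin z hz1 hz2).2, by omega⟩)
    rw [← heq] at hmem'
    have := (mem_ribbon.1 hmem').2.2
    omega
  have ha := hP.sub _ hT a (g a) (mem_ribbon.2 ⟨le_rfl, hg.le, rfl⟩)
  have hb := hP.sub _ hT b (g b) (mem_ribbon.2 ⟨hg.le, le_rfl, rfl⟩)
  have ha0 : a ≠ 0 := by
    rintro rfl
    have := ha.2.1; have := ha.2.2.1
    rw [hs.zero] at *; rw [ht.zero] at *; omega
  have hb0 : b ≠ 2 * n := by
    rintro rfl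
    have := hb.2.1; have := hb.2.2.1
    rw [hs.eq_zero _ le_rfl] at *; rw [ht.eq_zero _ le_rfl] at *; omega
  have hb1 := hb.1
  refine ⟨a - 1, b, by omega, hxb, by omega, ?_, ?_⟩
  · rw [show a - 1 + 1 = a by omega]
    ext ⟨u, v⟩
    simp only [mem_ribbon]
    constructor
    · rintro ⟨h1, h2, h3⟩; exact ⟨h1, h2, by rw [h3, key u h1 h2]⟩
    · rintro ⟨h1, h2, h3⟩; exact ⟨h1, h2, by rw [h3, key u h1 h2]⟩
  · rw [show a - 1 + 1 = a by omega]
    refine ⟨hg.le, ?_, ?_, ?_⟩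
    · have := key a le_rfl hg.le; have := key b hg.le le_rfl; have := hg.eq; omega
    · intro j h1 h2
      have := hg.step j h1 h2
      rw [key j h1 h2.le, key (j + 1) (by omega) (by omega)] at this
      omega
    · intro j h1 h2
      have := hg.ge j h1 h2
      rw [key j h1 h2, key a le_rfl hg.le] at this
      omega

/-! ## Paths obtained by flipping chords -/

/-- The heights `m` factor through the tree encoded by the path of heights `s`: equivalently, `m`
is obtained from `s` by exchanging the steps of some chords. -/
def Refines (n : ℕ) (m s : ℕ → ℤ) : Prop :=
  ∀ i k, i ≤ k → k ≤ 2 * n → s i = s k → (∀ j, i ≤ j → j ≤ k → s i ≤ s j) → m i = m k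

theorem Refines.refl (n : ℕ) (s : ℕ → ℤ) : Refines n s s := fun _ _ _ _ h _ => h

/-- Last visit of a level below the current height. -/
theorem exists_last_visit {s : ℕ → ℤ} {i : ℕ} (m : ℕ)
    (hstep : ∀ j, i ≤ j → j < i + m → s (j + 1) = s j + 1 ∨ s (j + 1) = s j - 1)
    {c : ℤ} (hi : s i ≤ c) (hm : c < s (i + m)) :
    ∃ k, i ≤ k ∧ k < i + m ∧ s k = c ∧ ∀ j, k < j → j ≤ i + m → c < s j := by
  induction m with
  | zero => simp at hm; omega
  | succ m ih =>
    have hs := hstep (i + m) (by omega) (by omega)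
    rw [add_assoc] at hs
    by_cases h : c < s (i + m)
    · obtain ⟨k, h1, h2, h3, h4⟩ := ih (fun j h1 h2 => hstep j h1 (by omega)) h
      refine ⟨k, h1, by omega, h3, fun j hj1 hj2 => ?_⟩
      rcases eq_or_lt_of_le hj2 with rfl | hj2
      · exact hm
      · exact h4 j hj1 (by omega)
    · refine ⟨i + m, by omega, by omega, by omega, fun j hj1 hj2 => ?_⟩
      obtain rfl : j = i + (m + 1) := by omega
      exact hm

/-- First visit of a level below the current height. -/
theorem exists_first_visit {s : ℕ → ℤ} {i : ℕ} (m : ℕ)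
    (hstep : ∀ j, i ≤ j → j < i + m → s (j + 1) = s j + 1 ∨ s (j + 1) = s j - 1)
    {c : ℤ} (hi : c < s i) (hm : s (i + m) ≤ c) :
    ∃ k, i < k ∧ k ≤ i + m ∧ s k = c ∧ ∀ j, i ≤ j → j < k → c < s j := by
  induction m with
  | zero => simp at hm; omega
  | succ m ih =>
    by_cases h : s (i + m) ≤ c
    · obtain ⟨k, h1, h2, h3⟩ := ih (fun j h1 h2 => hstep j h1 (by omega)) h
      exact ⟨k, h1, by omega, h3⟩
    · by_cases h' : ∃ j, i ≤ j ∧ j < i + m ∧ s j ≤ c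
      · obtain ⟨j, hj1, hj2, hj3⟩ := h'
        have : ∃ k, i < k ∧ k ≤ j ∧ s k = c ∧ ∀ q, i ≤ q → q < k → c < s q := by
          classical
          have hex : ∃ k, i ≤ k ∧ s k ≤ c := ⟨j, hj1, hj3⟩
          have hk := Nat.find_spec hex
          have hmin := fun q (hq : q < Nat.find hex) => Nat.find_min hex hq
          have hle : Nat.find hex ≤ j := Nat.find_min' hex ⟨hj1, hj3⟩
          set k := Nat.find hex
          have hki : i ≠ k := by rintro h; rw [← h] at hk; omega
          have hs := hstep (k - 1) (by omega) (by omega)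
          rw [show k - 1 + 1 = k by omega] at hs
          have hm1 := hmin (k - 1) (by omega)
          push Not at hm1
          have := hm1 (by omega)
          refine ⟨k, by omega, hle, by omega, fun q h1 h2 => ?_⟩
          have := hmin q h2
          push Not at this
          exact this h1
        obtain ⟨k, h1, h2, h3⟩ := this
        exact ⟨k, h1, by omega, h3⟩
      · push Not at h'
        have hs := hstep (i + m) (by omega) (by omega)
        rw [add_assoc] at hs
        refine ⟨i + (m + 1), by omega, le_rfl, by omega, fun j hj1 hj2 => ?_⟩
        by_cases hj : j = i + m
        · subst hj; omega
        · exact h' j hj1 (by omega)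

theorem Refines.le {n : ℕ} {m s : ℕ → ℤ} (h : Refines n m s) (hm : IsDyckHeight n m)
    (hs : IsDyckHeight n s) (j : ℕ) : m j ≤ s j := by
  induction j using Nat.strong_induction_on with
  | _ j ih =>
    by_cases hj : 2 * n ≤ j
    · rw [hm.eq_zero j hj, hs.eq_zero j hj]
    rcases j with _ | j
    · rw [hm.zero, hs.zero]
    have h1 := hs.step j (by omega)
    have h2 := hm.step j (by omega)
    have h3 := ih j (by omega)
    rcases h1 with h1 | h1
    · omega
    · obtain ⟨k, hk1, hk2, hk3, hk4⟩ := exists_last_visit (s := s) (i := 0) j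
        (fun q _ hq => hs.step q (by omega)) (c := s (j + 1))
        (by rw [hs.zero]; exact hs.nonneg _) (by rw [zero_add]; omega)
      have := h k (j + 1) (by omega) (by omega) hk3 (fun q hq1 hq2 => by
        rcases eq_or_lt_of_le hq1 with rfl | hq1
        · exact le_rfl
        · rcases eq_or_lt_of_le hq2 with rfl | hq2
          · omega
          · have := hk4 q hq1 (by omega); omega)
      rw [← this, ← hk3]
      exact ih k (by omega)

/-- Raise a path by `2` between the steps `a` and `b`. -/
def raisePath (s : ℕ → ℤ) (a b : ℕ) (k : ℕ) : ℤ := if a < k ∧ k ≤ b then s k + 2 else s k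

/-- Lower a path by `2` between the steps `a` and `b`. -/
def lowerPath (s : ℕ → ℤ) (a b : ℕ) (k : ℕ) : ℤ := if a < k ∧ k ≤ b then s k - 2 else s k

theorem raisePath_in {s : ℕ → ℤ} {a b k : ℕ} (h1 : a < k) (h2 : k ≤ b) :
    raisePath s a b k = s k + 2 := if_pos ⟨h1, h2⟩

theorem raisePath_out {s : ℕ → ℤ} {a b k : ℕ} (h : k ≤ a ∨ b < k) :
    raisePath s a b k = s k := if_neg (by omega)

theorem lowerPath_in {s : ℕ → ℤ} {a b k : ℕ} (h1 : a < k) (h2 : k ≤ b) :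
    lowerPath s a b k = s k - 2 := if_pos ⟨h1, h2⟩

theorem lowerPath_out {s : ℕ → ℤ} {a b k : ℕ} (h : k ≤ a ∨ b < k) :
    lowerPath s a b k = s k := if_neg (by omega)

theorem raisePath_lowerPath (s : ℕ → ℤ) (a b : ℕ) : raisePath (lowerPath s a b) a b = s := by
  funext k
  by_cases h : a < k ∧ k ≤ b
  · rw [raisePath_in h.1 h.2, lowerPath_in h.1 h.2]; ring
  · rw [raisePath_out (by omega), lowerPath_out (by omega)]

theorem lowerPath_raisePath (s : ℕ → ℤ) (a b : ℕ) : lowerPath (raisePath s a b) a b = s := by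
  funext k
  by_cases h : a < k ∧ k ≤ b
  · rw [lowerPath_in h.1 h.2, raisePath_in h.1 h.2]; ring
  · rw [lowerPath_out (by omega), raisePath_out (by omega)]

theorem isDyckHeight_raisePath {n : ℕ} {s : ℕ → ℤ} (hs : IsDyckHeight n s) {a b : ℕ} (hab : a < b)
    (hb : b < 2 * n) (h1 : s a = s (a + 1) + 1) (h2 : s (b + 1) = s b + 1) :
    IsDyckHeight n (raisePath s a b) := by
  refine ⟨?_, ?_, ?_, ?_⟩
  · rw [raisePath_out (by omega), hs.zero]
  · intro j hj
    have := hs.step j hj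
    by_cases e1 : j = a
    · subst e1; rw [raisePath_in (by omega) (by omega), raisePath_out (by omega)]; omega
    by_cases e2 : j = b
    · subst e2; rw [raisePath_in (k := j) (by omega) (by omega), raisePath_out (by omega)]; omega
    by_cases h : a < j ∧ j < b
    · rw [raisePath_in (k := j) (by omega) (by omega), raisePath_in (by omega) (by omega)]; omega
    · rw [raisePath_out (k := j) (by omega), raisePath_out (by omega)]; omega
  · intro j
    have := hs.nonneg j
    unfold raisePath; split_ifs <;> omega
  · intro j hj
    rw [raisePath_out (by omega), hs.eq_zero j hj]

theorem isDyckHeight_lowerPath {n : ℕ} {m s : ℕ → ℤ} (hm : IsDyckHeight n m)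
    (hs : IsDyckHeight n s) {a b : ℕ} (hab : a < b)
    (hb : b < 2 * n) (h1 : s (a + 1) = s a + 1) (h2 : s b = s (b + 1) + 1)
    (h : ∀ k, a < k → k ≤ b → m k < s k) :
    IsDyckHeight n (lowerPath s a b) := by
  refine ⟨?_, ?_, ?_, ?_⟩
  · rw [lowerPath_out (by omega), hs.zero]
  · intro j hj
    have := hs.step j hj
    by_cases e1 : j = a
    · subst e1; rw [lowerPath_in (by omega) (by omega), lowerPath_out (by omega)]; omega
    by_cases e2 : j = b
    · subst e2; rw [lowerPath_in (k := j) (by omega) (by omega), lowerPath_out (by omega)]; omega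
    by_cases h : a < j ∧ j < b
    · rw [lowerPath_in (k := j) (by omega) (by omega), lowerPath_in (by omega) (by omega)]; omega
    · rw [lowerPath_out (k := j) (by omega), lowerPath_out (by omega)]; omega
  · intro j
    have h0 := hs.nonneg j
    by_cases hj : a < j ∧ j ≤ b
    · rw [lowerPath_in hj.1 hj.2]
      have h3 := h j hj.1 hj.2
      have h4 := hm.nonneg j
      obtain ⟨c, hc⟩ := hs.even_sub hm j
      omega
    · rw [lowerPath_out (by omega)]; exact h0
  · intro j hj
    rw [lowerPath_out (by omega), hs.eq_zero j hj]

end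

section
/-! ## The border of a region, and the exchange of border tiles -/

/-- The interval `(a, b]` is a maximal interval on which `m < s`. -/
structure IsFlipped (n : ℕ) (m s : ℕ → ℤ) (a b : ℕ) : Prop where
  lt : a < b
  lt_two_mul : b < 2 * n
  left : m a = s a
  right : m (b + 1) = s (b + 1)
  inside : ∀ k, a < k → k ≤ b → m k < s k

/-- A flipped chord all of whose upper neighbours in `P` are contained in its extent. -/
structure IsFreeChord (n : ℕ) (m s : ℕ → ℤ) (P : Finset (Finset (ℕ × ℤ))) (a b : ℕ) : Prop
    extends IsFlipped n m s a b where
  above : ∀ T ∈ P, ∀ x, a < x → x ≤ b → (x, s x + 1) ∈ T → ∀ z w, (z, w) ∈ T → a < z ∧ z ≤ b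

/-- A tile of `P` lying on `s`, and whose removal leaves a path. -/
structure IsFreeTile (n : ℕ) (m s : ℕ → ℤ) (P : Finset (Finset (ℕ × ℤ))) (a b : ℕ) : Prop where
  lt : a < b
  lt_two_mul : b < 2 * n
  mem : ribbon (fun k => s k + 1) (a + 1) b ∈ P
  exc : IsExcursion s (a + 1) b
  left_step : s a = s (a + 1) + 1
  left : m a = s a
  right_step : s (b + 1) = s b + 1
  right : m (b + 1) = s (b + 1)

/-- A cover-inclusive tiling of the region above a path that `m` refines. -/
structure IsTilingState (n : ℕ) (m t s : ℕ → ℤ) (P : Finset (Finset (ℕ × ℤ))) : Prop where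
  height : IsDyckHeight n s
  ref : Refines n m s
  le : ∀ j, s j ≤ t j
  tiling : IsCITiling n s t P

/-- The states `(s, P)` and `(s', P')` are exchanged by moving the tile along `(a, b]`. -/
structure IsExchange (n : ℕ) (m : ℕ → ℤ) (s : ℕ → ℤ) (P : Finset (Finset (ℕ × ℤ)))
    (s' : ℕ → ℤ) (P' : Finset (Finset (ℕ × ℤ))) (a b : ℕ) : Prop where
  height_eq : s' = raisePath s a b
  parts_eq : P = insert (ribbon (fun k => s k + 1) (a + 1) b) P'
  notMem : ribbon (fun k => s k + 1) (a + 1) b ∉ P'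
  tile : IsFreeTile n m s P a b
  chord : IsFreeChord n m s' P' a b

variable {n : ℕ} {m t s s' : ℕ → ℤ} {P P' : Finset (Finset (ℕ × ℤ))} {a b : ℕ}

theorem refines_raisePath (href : Refines n m s)
    (hT : IsFreeTile n m s P a b) : Refines n m (raisePath s a b) := by
  have hab := hT.lt
  have hb := hT.lt_two_mul
  have hge := hT.exc.ge
  have heq := hT.exc.eq
  have hl := hT.left_step
  have hr := hT.right_step
  have hra : raisePath s a b a = s a := raisePath_out (by omega)
  have hrb : raisePath s a b (b + 1) = s (b + 1) := raisePath_out (by omega)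
  intro i k hik hk h1 h2
  by_cases hi : a < i ∧ i ≤ b
  · by_cases hk' : k ≤ b
    · apply href i k hik hk
      · rw [raisePath_in hi.1 hi.2, raisePath_in (by omega) hk'] at h1; omega
      · intro j hj1 hj2
        have := h2 j hj1 hj2
        rw [raisePath_in hi.1 hi.2, raisePath_in (by omega) (by omega)] at this; omega
    · exfalso
      have h3 := h2 (b + 1) (by omega) (by omega)
      rw [hrb, raisePath_in hi.1 hi.2] at h3
      have := hge i (by omega) hi.2
      omega
  · rw [raisePath_out (k := i) (by omega)] at h1 h2
    by_cases hkin : a < k ∧ k ≤ b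
    · exfalso
      rw [raisePath_in hkin.1 hkin.2] at h1
      have h3 := h2 a (by omega) (by omega)
      rw [hra] at h3
      have := hge k (by omega) hkin.2
      omega
    · rw [raisePath_out (k := k) (by omega)] at h1
      by_cases hspan : i ≤ a ∧ b < k
      · by_cases hsi : s i ≤ s (a + 1)
        · apply href i k hik hk h1
          intro j hj1 hj2
          by_cases hj : a < j ∧ j ≤ b
          · have := hge j (by omega) hj.2; omega
          · have := h2 j hj1 hj2
            rwa [raisePath_out (by omega)] at this
        · have h3 := h2 a (by omega) (by omega)
          rw [hra] at h3
          have e1 := href i a hspan.1 (by omega) (by omega) (fun j hj1 hj2 => by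
            have := h2 j hj1 (by omega)
            rwa [raisePath_out (by omega)] at this)
          have e2 := href (b + 1) k (by omega) hk (by omega) (fun j hj1 hj2 => by
            have := h2 j (by omega) (by omega)
            rw [raisePath_out (by omega)] at this
            omega)
          rw [e1, ← e2, hT.left, hT.right]; omega
      · apply href i k hik hk h1
        intro j hj1 hj2
        have := h2 j hj1 hj2
        rwa [raisePath_out (by omega)] at this

theorem IsTilingState.raise (hm : IsDyckHeight n m)
    (hS : IsTilingState n m t s P) (hT : IsFreeTile n m s P a b) :
    IsTilingState n m t (raisePath s a b) (P.erase (ribbon (fun k => s k + 1) (a + 1) b)) ∧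
      IsExchange n m s P (raisePath s a b) (P.erase (ribbon (fun k => s k + 1) (a + 1) b)) a b := by
  have hab := hT.lt
  have hb := hT.lt_two_mul
  have href := refines_raisePath hS.ref hT
  set R := ribbon (fun k => s k + 1) (a + 1) b with hR
  have hmemR : ∀ x, a < x → x ≤ b → (x, s x + 1) ∈ R := fun x h1 h2 =>
    mem_ribbon.2 ⟨h1, h2, rfl⟩
  have hne : ∀ T ∈ P.erase R, ∀ x, (x, s x + 1) ∈ T → x ≤ a ∨ b < x := by
    intro T hTP x hx
    by_contra hcon
    exact (Finset.mem_erase.1 hTP).1 (hS.tiling.disj T (Finset.mem_of_mem_erase hTP) R hT.mem x _ hx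
      (hmemR x (by omega) (by omega)))
  refine ⟨⟨isDyckHeight_raisePath hS.height hab hb hT.left_step hT.right_step, href, ?_, ?_⟩,
    ⟨rfl, (Finset.insert_erase hT.mem).symm, Finset.notMem_erase _ _, hT, ⟨⟨hab, hb, ?_, ?_, ?_⟩, ?_⟩⟩⟩
  · intro j
    by_cases hj : a < j ∧ j ≤ b
    · rw [raisePath_in hj.1 hj.2]
      have := (hS.tiling.sub R hT.mem j _ (hmemR j hj.1 hj.2)).2.2.1
      omega
    · rw [raisePath_out (by omega)]; exact hS.le j
  · refine ⟨?_, ?_, ?_, ?_, ?_⟩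
    · intro T hTP x y hxy
      obtain ⟨r1, r2, r3, c, hc⟩ := hS.tiling.sub T (Finset.mem_of_mem_erase hTP) x y hxy
      by_cases hx : a < x ∧ x ≤ b
      · refine ⟨r1, ?_, r3, ⟨c - 1, ?_⟩⟩
        · rw [raisePath_in hx.1 hx.2]
          by_contra hcon
          have : y = s x + 1 := by omega
          subst this
          have := hne T hTP x hxy
          omega
        · rw [raisePath_in hx.1 hx.2]; omega
      · refine ⟨r1, ?_, r3, ⟨c, ?_⟩⟩ <;> rw [raisePath_out (by omega)] <;> assumption
    · intro x y ⟨r1, r2, r3, c, hc⟩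
      by_cases hx : a < x ∧ x ≤ b
      · rw [raisePath_in hx.1 hx.2] at r2 hc
        obtain ⟨T, hTP, hxy⟩ := hS.tiling.cover x y ⟨r1, by omega, r3, ⟨c + 1, by omega⟩⟩
        refine ⟨T, Finset.mem_erase.2 ⟨?_, hTP⟩, hxy⟩
        rintro rfl
        have := (mem_ribbon.1 hxy).2.2
        omega
      · rw [raisePath_out (by omega)] at r2 hc
        obtain ⟨T, hTP, hxy⟩ := hS.tiling.cover x y ⟨r1, r2, r3, ⟨c, hc⟩⟩
        refine ⟨T, Finset.mem_erase.2 ⟨?_, hTP⟩, hxy⟩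
        rintro rfl
        have := mem_ribbon.1 hxy
        omega
    · exact fun T h T' h' => hS.tiling.disj T (Finset.mem_of_mem_erase h) T' (Finset.mem_of_mem_erase h')
    · exact fun T h => hS.tiling.tile T (Finset.mem_of_mem_erase h)
    · exact fun T h T' h' => hS.tiling.incl T (Finset.mem_of_mem_erase h) T' (Finset.mem_of_mem_erase h')
  · rw [raisePath_out (by omega)]; exact hT.left
  · rw [raisePath_out (by omega)]; exact hT.right
  · intro k h1 h2
    rw [raisePath_in h1 h2]
    have := hS.ref.le hm hS.height k
    omega
  · intro T hTP x h1 h2 hx z w hz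
    rw [raisePath_in h1 h2] at hx
    obtain ⟨w', hw'⟩ := hS.tiling.incl T (Finset.mem_of_mem_erase hTP) R hT.mem x (s x + 1)
      (hmemR x h1 h2) (by convert hx using 2; ring) z w hz
    have := mem_ribbon.1 hw'
    omega

/-- The boundary of a flipped chord. -/
theorem IsFlipped.shape (hm : IsDyckHeight n m) (hs : IsDyckHeight n s) (href : Refines n m s)
    (h : IsFlipped n m s a b) :
    IsExcursion s (a + 1) b ∧ s (a + 1) = s a + 1 ∧ s b = s (b + 1) + 1 ∧
      ∀ k, a < k → k ≤ b → s a + 1 ≤ s k := by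
  have hab := h.lt
  have hb := h.lt_two_mul
  have hsa := hs.step a (by omega)
  have hma := hm.step a (by omega)
  have hsb := hs.step b (by omega)
  have hmb := hm.step b (by omega)
  have h1 := h.inside (a + 1) (by omega) (by omega)
  have h2 := h.inside b (by omega) (by omega)
  have hl := h.left
  have hr := h.right
  have ea : s (a + 1) = s a + 1 := by omega
  have eb : s b = s (b + 1) + 1 := by omega
  have low : ∀ k, a < k → k ≤ b → s a + 1 ≤ s k := by
    intro k hk1 hk2
    by_contra hcon
    obtain ⟨q, hq1, hq2, hq3, hq4⟩ := exists_first_visit (s := s) (i := a + 1) (k - (a + 1))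
      (fun j _ hj => hs.step j (by omega)) (c := s a) (by omega)
      (by rw [show a + 1 + (k - (a + 1)) = k by omega]; omega)
    have := href a q (by omega) (by omega) hq3.symm (fun j hj1 hj2 => by
      by_cases e1 : j = a
      · rw [e1]
      by_cases e2 : j = q
      · rw [e2, hq3]
      exact (hq4 j (by omega) (by omega)).le)
    have := h.inside q (by omega) (by omega)
    omega
  have low' : ∀ k, a < k → k ≤ b → s (b + 1) + 1 ≤ s k := by
    intro k hk1 hk2
    by_contra hcon
    obtain ⟨q, hq1, hq2, hq3, hq4⟩ := exists_last_visit (s := s) (i := k) (b - k)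
      (fun j _ hj => hs.step j (by omega)) (c := s (b + 1)) (by omega)
      (by rw [show k + (b - k) = b by omega]; omega)
    have := href q (b + 1) (by omega) (by omega) hq3 (fun j hj1 hj2 => by
      by_cases e1 : j = q
      · rw [e1]
      by_cases e2 : j = b + 1
      · rw [e2, hq3]
      have := hq4 j (by omega) (by omega)
      omega)
    have := h.inside q (by omega) (by omega)
    omega
  have := low b (by omega) le_rfl
  have := low' (a + 1) (by omega) (by omega)
  refine ⟨⟨by omega, by omega, fun j _ hj => hs.step j (by omega), fun j hj1 hj2 => ?_⟩, ea, eb, low⟩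
  have := low j (by omega) hj2
  omega

theorem refines_lowerPath (hm : IsDyckHeight n m) (hs : IsDyckHeight n s) (href : Refines n m s)
    (h : IsFlipped n m s a b) : Refines n m (lowerPath s a b) := by
  obtain ⟨hexc, ea, eb, low⟩ := h.shape hm hs href
  have hab := h.lt
  have hb := h.lt_two_mul
  have heq := hexc.eq
  have hla : lowerPath s a b a = s a := lowerPath_out (by omega)
  have hle := href.le hm hs
  have hma : m (a + 1) = s a - 1 := by
    have := hm.step a (by omega); have := h.inside (a + 1) (by omega) (by omega)
    have := h.left; omega
  have hmb : m b = s a - 1 := by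
    have := hm.step b (by omega); have := h.inside b (by omega) (by omega)
    have := h.right; omega
  have hl := h.left
  have hr := h.right
  intro i k hik hk h1 h2
  by_cases hi : a < i ∧ i ≤ b
  · rw [lowerPath_in hi.1 hi.2] at h1 h2
    by_cases hk' : k ≤ b
    · rw [lowerPath_in (by omega) hk'] at h1
      apply href i k hik hk (by omega)
      intro j hj1 hj2
      have := h2 j hj1 hj2
      rw [lowerPath_in (by omega) (by omega)] at this; omega
    · rw [lowerPath_out (by omega)] at h1
      have h3 := h2 b (by omega) (by omega)
      rw [lowerPath_in (by omega) le_rfl] at h3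
      have h4 := low i hi.1 hi.2
      have e1 := href i b hi.2 (by omega) (by omega) (fun j hj1 hj2 => by
        have := low j (by omega) hj2; omega)
      have hkb : b + 1 < k := by
        by_contra hcon
        obtain rfl : k = b + 1 := by omega
        omega
      obtain ⟨q, hq1, hq2, hq3, hq4⟩ := exists_first_visit (s := s) (i := b + 1) (k - (b + 1))
        (fun j _ hj => hs.step j (by omega)) (c := s k) (by omega)
        (by rw [show b + 1 + (k - (b + 1)) = k by omega])
      have e2 := href q k (by omega) hk hq3 (fun j hj1 hj2 => by
        have := h2 j (by omega) (by omega)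
        rw [lowerPath_out (by omega)] at this; omega)
      have e3 := href (b + 1) (q - 1) (by omega) (by omega) (by
          have := hs.step (q - 1) (by omega)
          rw [show q - 1 + 1 = q by omega] at this
          have := hq4 (q - 1) (by omega) (by omega)
          omega)
        (fun j hj1 hj2 => by
          have := hq4 j (by omega) (by omega); omega)
      have e4 := hm.step (q - 1) (by omega)
      rw [show q - 1 + 1 = q by omega] at e4
      have := hle q
      omega
  · rw [lowerPath_out (k := i) (by omega)] at h1 h2
    by_cases hkin : a < k ∧ k ≤ b
    · rw [lowerPath_in hkin.1 hkin.2] at h1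
      have h3 := h2 (a + 1) (by omega) (by omega)
      rw [lowerPath_in (by omega) (by omega)] at h3
      have h4 := low k hkin.1 hkin.2
      have e1 := href (a + 1) k (by omega) (by omega) (by omega) (fun j hj1 hj2 => by
        have := low j (by omega) (by omega); omega)
      have hia : i < a := by
        by_contra hcon
        obtain rfl : i = a := by omega
        omega
      obtain ⟨q, hq1, hq2, hq3, hq4⟩ := exists_last_visit (s := s) (i := i) (a - i)
        (fun j _ hj => hs.step j (by omega)) (c := s i) le_rfl
        (by rw [show i + (a - i) = a by omega]; omega)
      have e2 := href i q (by omega) (by omega) hq3.symm (fun j hj1 hj2 => by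
        have := h2 j (by omega) (by omega)
        rwa [lowerPath_out (by omega)] at this)
      have e3 := href (q + 1) a (by omega) (by omega) (by
          have := hs.step q (by omega)
          have := hq4 (q + 1) (by omega) (by omega)
          omega)
        (fun j hj1 hj2 => by
          have := hs.step q (by omega)
          have := hq4 (q + 1) (by omega) (by omega)
          have := hq4 j (by omega) (by omega); omega)
      have e4 := hm.step q (by omega)
      have := hle q
      omega
    · rw [lowerPath_out (k := k) (by omega)] at h1
      apply href i k hik hk h1
      intro j hj1 hj2
      have := h2 j hj1 hj2
      unfold lowerPath at this
      split_ifs at this <;> omega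

theorem IsTilingState.lower (hm : IsDyckHeight n m)
    (hS : IsTilingState n m t s P) (hT : IsFreeChord n m s P a b) :
    IsTilingState n m t (lowerPath s a b)
        (insert (ribbon (fun k => lowerPath s a b k + 1) (a + 1) b) P) ∧
      IsExchange n m (lowerPath s a b)
        (insert (ribbon (fun k => lowerPath s a b k + 1) (a + 1) b) P) s P a b := by
  have hs := hS.height
  have hflip := hT.toIsFlipped
  obtain ⟨hexc, ea, eb, low⟩ := hflip.shape hm hs hS.ref
  have hab := hT.lt
  have hb := hT.lt_two_mul
  have heq := hexc.eq
  set R := ribbon (fun k => lowerPath s a b k + 1) (a + 1) b with hR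
  have hmemR : ∀ {x y}, (x, y) ∈ R ↔ a < x ∧ x ≤ b ∧ y = s x - 1 := by
    intro x y
    rw [hR, mem_ribbon]
    constructor
    · rintro ⟨h1, h2, h3⟩
      rw [lowerPath_in h1 h2] at h3
      exact ⟨h1, h2, by omega⟩
    · rintro ⟨h1, h2, h3⟩
      refine ⟨h1, h2, ?_⟩
      rw [lowerPath_in h1 h2]; omega
  have hlowexc : IsExcursion (lowerPath s a b) (a + 1) b := by
    refine ⟨hab, ?_, ?_, ?_⟩
    · rw [lowerPath_in (by omega) (by omega), lowerPath_in (by omega) (by omega), heq]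
    · intro j h1 h2
      rw [lowerPath_in (k := j + 1) (by omega) (by omega), lowerPath_in (by omega) (by omega)]
      have := hs.step j (by omega)
      omega
    · intro j h1 h2
      rw [lowerPath_in (by omega) (by omega), lowerPath_in (by omega) (by omega)]
      have := low j (by omega) h2
      omega
  have hdisj : ∀ T ∈ P, ∀ x y, (x, y) ∈ T → (x, y) ∉ R := by
    intro T hTP x y h1 h2
    have := (hS.tiling.sub T hTP x y h1).2.1
    have := (hmemR.1 h2).2.2
    omega
  have hnotMem : R ∉ P := by
    intro hcon
    exact hdisj R hcon (a + 1) (s (a + 1) - 1) (hmemR.2 ⟨by omega, by omega, rfl⟩)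
      (hmemR.2 ⟨by omega, by omega, rfl⟩)
  have hsl : ∀ x, lowerPath s a b x ≤ s x := by
    intro x; unfold lowerPath; split_ifs <;> omega
  refine ⟨⟨isDyckHeight_lowerPath hm hs hab hb ea eb hT.inside,
      refines_lowerPath hm hs hS.ref hflip, fun j => (hsl j).trans (hS.le j), ?_⟩,
    ⟨(raisePath_lowerPath s a b).symm, rfl, hnotMem, ⟨hab, hb, Finset.mem_insert_self _ _, hlowexc,
      ?_, ?_, ?_, ?_⟩, hT⟩⟩
  · refine ⟨?_, ?_, ?_, ?_, ?_⟩
    · intro T hTP x y hxy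
      rcases Finset.mem_insert.1 hTP with rfl | hTP
      · obtain ⟨h1, h2, rfl⟩ := hmemR.1 hxy
        refine ⟨by omega, ?_, ?_, ?_⟩
        · rw [lowerPath_in h1 h2]; omega
        · have := hS.le x; omega
        · rw [lowerPath_in h1 h2]; exact ⟨0, by ring⟩
      · obtain ⟨r1, r2, r3, c, hc⟩ := hS.tiling.sub T hTP x y hxy
        refine ⟨r1, (hsl x).trans_lt r2, r3, ?_⟩
        by_cases hx : a < x ∧ x ≤ b
        · rw [lowerPath_in hx.1 hx.2]; exact ⟨c + 1, by omega⟩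
        · rw [lowerPath_out (by omega)]; exact ⟨c, hc⟩
    · intro x y ⟨r1, r2, r3, c, hc⟩
      by_cases hx : a < x ∧ x ≤ b
      · rw [lowerPath_in hx.1 hx.2] at r2 hc
        by_cases hy : y = s x - 1
        · exact ⟨R, Finset.mem_insert_self _ _, hmemR.2 ⟨hx.1, hx.2, hy⟩⟩
        · obtain ⟨T, hTP, hxy⟩ := hS.tiling.cover x y ⟨r1, by omega, r3, ⟨c - 1, by omega⟩⟩
          exact ⟨T, Finset.mem_insert_of_mem hTP, hxy⟩
      · rw [lowerPath_out (by omega)] at r2 hc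
        obtain ⟨T, hTP, hxy⟩ := hS.tiling.cover x y ⟨r1, r2, r3, ⟨c, hc⟩⟩
        exact ⟨T, Finset.mem_insert_of_mem hTP, hxy⟩
    · intro T h T' h' x y h1 h2
      rcases Finset.mem_insert.1 h with rfl | h <;> rcases Finset.mem_insert.1 h' with rfl | h'
      · rfl
      · exact absurd h1 (hdisj T' h' x y h2)
      · exact absurd h2 (hdisj T h x y h1)
      · exact hS.tiling.disj T h T' h' x y h1 h2
    · intro T h
      rcases Finset.mem_insert.1 h with rfl | h
      · apply IsExcursion.isDyckTile
        refine ⟨hlowexc.le, by simp [hlowexc.eq], fun j h1 h2 => ?_, fun j h1 h2 => ?_⟩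
        · have := hlowexc.step j h1 h2; omega
        · have := hlowexc.ge j h1 h2; omega
      · exact hS.tiling.tile T h
    · intro T h T' h' x y h1 h2 z w hz
      rcases Finset.mem_insert.1 h with rfl | h <;> rcases Finset.mem_insert.1 h' with rfl | h'
      · exact ⟨w, hz⟩
      · exfalso
        have h3 := (hmemR.1 h2).2.2
        have h4 := (hS.tiling.sub T' h' x y h1).2.1
        omega
      · obtain ⟨h3, h4, rfl⟩ := hmemR.1 h1
        have := hT.above T h x h3 h4 (by convert h2 using 2; ring) z w hz
        exact ⟨_, hmemR.2 ⟨this.1, this.2, rfl⟩⟩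
      · exact hS.tiling.incl T h T' h' x y h1 h2 z w hz
  · rw [lowerPath_out (by omega), lowerPath_in (by omega) (by omega)]; omega
  · rw [lowerPath_out (by omega)]; exact hT.left
  · rw [lowerPath_out (by omega), lowerPath_in (by omega) (by omega)]; omega
  · rw [lowerPath_out (by omega)]; exact hT.right

end

section
variable {n : ℕ} {m t s s' : ℕ → ℤ} {P P' : Finset (Finset (ℕ × ℤ))} {a b : ℕ}

/-- The tile or chord along `(a, b]` can be exchanged. -/
def IsBorder (n : ℕ) (m s : ℕ → ℤ) (P : Finset (Finset (ℕ × ℤ))) (a b : ℕ) : Prop :=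
  IsFreeTile n m s P a b ∨ IsFreeChord n m s P a b

theorem IsFreeTile.not_isFreeChord (hm : IsDyckHeight n m) (h : IsFreeTile n m s P a b) :
    ¬ IsFreeChord n m s P a b := by
  intro h'
  have hab := h.lt
  have hb := h.lt_two_mul
  have := h.left_step
  have := h'.left
  have := h'.inside (a + 1) (by omega) (by omega)
  have := hm.step a (by omega)
  omega

theorem ribbon_congr {f g : ℕ → ℤ} {a b : ℕ} (h : ∀ k, a ≤ k → k ≤ b → f k = g k) :
    ribbon f a b = ribbon g a b := by
  ext ⟨x, y⟩
  simp only [mem_ribbon]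
  constructor
  · rintro ⟨h1, h2, h3⟩; exact ⟨h1, h2, by rw [h3, h x h1 h2]⟩
  · rintro ⟨h1, h2, h3⟩; exact ⟨h1, h2, by rw [h3, h x h1 h2]⟩

theorem IsExcursion.congr {f g : ℕ → ℤ} {a b : ℕ} (h : ∀ k, a ≤ k → k ≤ b → f k = g k)
    (hf : IsExcursion f a b) : IsExcursion g a b := by
  have hle := hf.le
  refine ⟨hle, ?_, fun j h1 h2 => ?_, fun j h1 h2 => ?_⟩
  · rw [← h a le_rfl hle, ← h b hle le_rfl, hf.eq]
  · rw [← h j h1 h2.le, ← h (j + 1) (by omega) (by omega)]; exact hf.step j h1 h2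
  · rw [← h j h1 h2, ← h a le_rfl hle]; exact hf.ge j h1 h2

theorem IsFreeTile.congr {c d : ℕ} (h : ∀ k, c ≤ k → k ≤ d + 1 → s k = s' k)
    (hP : ribbon (fun k => s k + 1) (c + 1) d ∈ P') (hT : IsFreeTile n m s P c d) :
    IsFreeTile n m s' P' c d := by
  have hlt := hT.lt
  have h1 := h c le_rfl (by omega)
  have h2 := h (c + 1) (by omega) (by omega)
  have h3 := h d (by omega) (by omega)
  have h4 := h (d + 1) (by omega) (by omega)
  refine ⟨hlt, hT.lt_two_mul, ?_, hT.exc.congr fun k _ _ => h k (by omega) (by omega), ?_, ?_, ?_, ?_⟩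
  · rwa [ribbon_congr (g := fun k => s k + 1) fun k _ _ => by rw [h k (by omega) (by omega)]]
  · rw [← h1, ← h2, hT.left_step]
  · rw [← h1, hT.left]
  · rw [← h4, ← h3, hT.right_step]
  · rw [← h4, hT.right]

theorem IsFreeChord.congr {c d : ℕ} (h : ∀ k, c ≤ k → k ≤ d + 1 → s k = s' k)
    (hP : ∀ T ∈ P', ∀ x, c < x → x ≤ d → (x, s x + 1) ∈ T → T ∈ P)
    (hT : IsFreeChord n m s P c d) : IsFreeChord n m s' P' c d := by
  have hlt := hT.lt
  refine ⟨⟨hlt, hT.lt_two_mul, ?_, ?_, fun k h1 h2 => ?_⟩, fun T hTP x h1 h2 hx => ?_⟩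
  · rw [← h c le_rfl (by omega), hT.left]
  · rw [← h (d + 1) (by omega) (by omega), hT.right]
  · rw [← h k (by omega) (by omega)]; exact hT.inside k h1 h2
  · rw [← h x (by omega) (by omega)] at hx
    exact hT.above T (hP T hTP x h1 h2 hx) x h1 h2 hx

theorem IsExchange.border_up (hS : IsTilingState n m t s P) (hE : IsExchange n m s P s' P' a b)
    {c d : ℕ} (h : IsBorder n m s P c d) : IsBorder n m s' P' c d ∨ (a ≤ c ∧ d ≤ b) := by
  have hT := hE.tile
  have hab := hT.lt
  have hl := hT.left
  have hr := hT.right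
  have hcd : c < d := h.elim (fun h => h.lt) (fun h => h.lt)
  have hout : d < a ∨ b < c → ∀ k, c ≤ k → k ≤ d + 1 → s k = s' k := by
    intro h k h1 h2
    rw [hE.height_eq, raisePath_out (by omega)]
  rcases h with h | h
  · by_cases hx : ∃ x, (a < x ∧ x ≤ b) ∧ c < x ∧ x ≤ d
    · right
      obtain ⟨x, ⟨h1, h2⟩, h3, h4⟩ := hx
      have heq := hS.tiling.disj _ hT.mem _ h.mem x (s x + 1) (mem_ribbon.2 ⟨h1, h2, rfl⟩)
        (mem_ribbon.2 ⟨h3, h4, rfl⟩)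
      have e1 : (c + 1, s (c + 1) + 1) ∈ ribbon (fun k => s k + 1) (c + 1) d :=
        mem_ribbon.2 ⟨le_rfl, hcd, rfl⟩
      have e2 : (d, s d + 1) ∈ ribbon (fun k => s k + 1) (c + 1) d :=
        mem_ribbon.2 ⟨hcd, le_rfl, rfl⟩
      rw [← heq] at e1 e2
      have := mem_ribbon.1 e1
      have := mem_ribbon.1 e2
      omega
    · left; left
      have hdis : d ≤ a ∨ b ≤ c := by
        by_contra hcon
        push Not at hcon
        exact hx ⟨max a c + 1, ⟨by omega, by omega⟩, by omega, by omega⟩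
      have h5 : d < a ∨ b < c := by
        have e1 := hT.left_step; have e2 := hT.right_step
        have e3 := h.left_step; have e4 := h.right_step
        rcases hdis with hd | hd
        · rcases eq_or_lt_of_le hd with rfl | hd
          · omega
          · exact Or.inl hd
        · rcases eq_or_lt_of_le hd with rfl | hd
          · omega
          · exact Or.inr hd
      refine h.congr (hout h5) ?_
      have hmem := h.mem
      rw [hE.parts_eq] at hmem
      refine (Finset.mem_insert.1 hmem).resolve_left fun heq => ?_
      have e1 : (c + 1, s (c + 1) + 1) ∈ ribbon (fun k => s k + 1) (c + 1) d :=
        mem_ribbon.2 ⟨le_rfl, hcd, rfl⟩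
      rw [heq] at e1
      have := mem_ribbon.1 e1
      omega
  · have ha : ¬ (c < a ∧ a ≤ d) := fun hc => by have := h.inside a hc.1 hc.2; omega
    have hb : ¬ (c < b + 1 ∧ b + 1 ≤ d) := fun hc => by have := h.inside _ hc.1 hc.2; omega
    by_cases hsub : a ≤ c ∧ d ≤ b
    · exact Or.inr hsub
    · left; right
      refine h.congr (hout (by omega)) fun T hTP x _ _ _ => ?_
      rw [hE.parts_eq]; exact Finset.mem_insert_of_mem hTP

theorem IsExchange.border_down (hE : IsExchange n m s P s' P' a b)
    {c d : ℕ} (h : IsBorder n m s' P' c d) : IsBorder n m s P c d ∨ (a ≤ c ∧ d ≤ b) := by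
  have hT := hE.chord
  have hab := hT.lt
  have hl := hT.left
  have hr := hT.right
  have hcd : c < d := h.elim (fun h => h.lt) (fun h => h.lt)
  have hcl : m c = s' c := h.elim (fun h => h.left) (fun h => h.left)
  have hdr : m (d + 1) = s' (d + 1) := h.elim (fun h => h.right) (fun h => h.right)
  have hc : ¬ (a < c ∧ c ≤ b) := fun hc => by have := hT.inside c hc.1 hc.2; omega
  have hd : ¬ (a < d + 1 ∧ d + 1 ≤ b) := fun hc => by have := hT.inside _ hc.1 hc.2; omega
  have hout : d < a ∨ b < c → ∀ k, c ≤ k → k ≤ d + 1 → s' k = s k := by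
    intro h k h1 h2
    rw [hE.height_eq, raisePath_out (by omega)]
  by_cases hsub : a ≤ c ∧ d ≤ b
  · exact Or.inr hsub
  left
  rcases h with h | h
  · by_cases hx : ∃ x, (a < x ∧ x ≤ b) ∧ c < x ∧ x ≤ d
    · exfalso
      obtain ⟨x, ⟨h1, h2⟩, h3, h4⟩ := hx
      have hab' := hT.above _ h.mem x h1 h2 (mem_ribbon.2 ⟨h3, h4, rfl⟩)
      have e1 := hab' (c + 1) _ (mem_ribbon.2 ⟨le_rfl, hcd, rfl⟩)
      have e2 := hab' d _ (mem_ribbon.2 ⟨hcd, le_rfl, rfl⟩)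
      omega
    · left
      have hdis : d ≤ a ∨ b ≤ c := by
        by_contra hcon
        push Not at hcon
        exact hx ⟨max a c + 1, ⟨by omega, by omega⟩, by omega, by omega⟩
      refine h.congr (hout (by omega)) ?_
      rw [hE.parts_eq]; exact Finset.mem_insert_of_mem h.mem
  · right
    have ha' : ¬ (c < a ∧ a ≤ d) := fun hc => by have := h.inside a hc.1 hc.2; omega
    have hb' : ¬ (c < b + 1 ∧ b + 1 ≤ d) := fun hc => by have := h.inside _ hc.1 hc.2; omega
    have hdis : d < a ∨ b < c := by omega
    refine h.congr (hout hdis) fun T hTP x h1 h2 hx => ?_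
    rw [hE.parts_eq] at hTP
    refine (Finset.mem_insert.1 hTP).resolve_left ?_
    rintro rfl
    have := mem_ribbon.1 hx
    omega

theorem exists_isFlipped (hm : IsDyckHeight n m) (hs : IsDyckHeight n s) (hle : ∀ j, m j ≤ s j)
    {y : ℕ} (hy : m y < s y) : ∃ c d, IsFlipped n m s c d ∧ c < y ∧ y ≤ d := by
  classical
  have hyn : y < 2 * n := by
    by_contra h
    rw [hm.eq_zero y (by omega), hs.eq_zero y (by omega)] at hy
    omega
  have hex : ∃ k, y < k ∧ m k = s k :=
    ⟨2 * n, hyn, by rw [hm.eq_zero _ le_rfl, hs.eq_zero _ le_rfl]⟩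
  have h0 : m 0 = s 0 := by rw [hm.zero, hs.zero]
  set c := Nat.findGreatest (fun k => m k = s k) y with hc
  have hc1 : m c = s c := Nat.findGreatest_spec (P := fun k => m k = s k) (Nat.zero_le y) h0
  have hc2 : c ≤ y := Nat.findGreatest_le y
  have hc3 : ∀ k, c < k → k ≤ y → m k ≠ s k := fun k h1 h2 => Nat.findGreatest_is_greatest h1 h2
  have hd := Nat.find_spec hex
  have hdmin := fun k (hk : k < Nat.find hex) => Nat.find_min hex hk
  have hdle : Nat.find hex ≤ 2 * n := Nat.find_min' hex
    ⟨hyn, by rw [hm.eq_zero _ le_rfl, hs.eq_zero _ le_rfl]⟩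
  set d := Nat.find hex
  have hcy : c ≠ y := by rintro h; rw [h] at hc1; omega
  refine ⟨c, d - 1, ⟨by omega, by omega, hc1, ?_, fun k h1 h2 => ?_⟩, by omega, by omega⟩
  · rw [show d - 1 + 1 = d by omega]; exact hd.2
  · refine lt_of_le_of_ne (hle k) ?_
    by_cases hk : k ≤ y
    · exact hc3 k h1 hk
    · intro h
      exact hdmin k (by omega) ⟨by omega, h⟩

theorem IsTilingState.isFreeChord_of_adjacent (hm : IsDyckHeight n m) (ht : IsDyckHeight n t)
    (hS : IsTilingState n m t s P) {c d a b y : ℕ} (hf : IsFlipped n m s c d)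
    (hmem : ribbon (fun k => s k + 1) (a + 1) b ∈ P) (hab : a < b)
    (hy : y = a ∨ y = b + 1) (hcy : c < y) (hyd : y ≤ d) : IsFreeChord n m s P c d := by
  obtain ⟨hexc, ea, eb, low⟩ := hf.shape hm hS.height hS.ref
  have hcd := hf.lt
  have heq := hexc.eq
  refine ⟨hf, fun T hT z hz1 hz2 hz => ?_⟩
  obtain ⟨e, f, h1, h2, h3, rfl, hexc'⟩ := hS.tiling.ribbon_of_mem hS.height ht hT hz
  have heq' := hexc'.eq
  have hge' := hexc'.ge
  suffices c ≤ e ∧ f ≤ d by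
    intro z' w' h'
    have := mem_ribbon.1 h'
    omega
  by_contra hcon
  have hfd : d < f := by
    by_contra hfd
    have hec : e < c := by omega
    have := hge' c (by omega) (by omega)
    have := low f (by omega) (by omega)
    omega
  have hec : e < c := by
    by_contra hec
    have := hge' (d + 1) (by omega) (by omega)
    have := low (e + 1) (by omega) (by omega)
    omega
  rcases hy with rfl | rfl
  · have := hS.tiling.disj _ hT _ hmem (y + 1) (s (y + 1) + 1)
      (mem_ribbon.2 ⟨by omega, by omega, rfl⟩) (mem_ribbon.2 ⟨by omega, by omega, rfl⟩)
    have h4 : (y, s y + 1) ∈ ribbon (fun k => s k + 1) (e + 1) f :=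
      mem_ribbon.2 ⟨by omega, by omega, rfl⟩
    rw [this] at h4
    have := mem_ribbon.1 h4
    omega
  · have := hS.tiling.disj _ hT _ hmem b (s b + 1)
      (mem_ribbon.2 ⟨by omega, by omega, rfl⟩) (mem_ribbon.2 ⟨by omega, by omega, rfl⟩)
    have h4 : (b + 1, s (b + 1) + 1) ∈ ribbon (fun k => s k + 1) (e + 1) f :=
      mem_ribbon.2 ⟨by omega, by omega, rfl⟩
    rw [this] at h4
    have := mem_ribbon.1 h4
    omega

theorem IsTilingState.exists_isBorder (hm : IsDyckHeight n m) (ht : IsDyckHeight n t)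
    (hS : IsTilingState n m t s P) (hmt : m ≠ t) : ∃ a b, IsBorder n m s P a b := by
  classical
  have hs := hS.height
  have hle := hS.ref.le hm hs
  have hcol : ∀ x, s x < t x → x < 2 * n ∧ ∃ T ∈ P, (x, s x + 1) ∈ T := by
    intro x hx
    have hx' : x < 2 * n := by
      by_contra h
      rw [hs.eq_zero x (by omega), ht.eq_zero x (by omega)] at hx
      omega
    obtain ⟨c, hc⟩ := ht.even_sub hs x
    exact ⟨hx', hS.tiling.cover x _ ⟨hx'.le, by omega, by omega, ⟨0, by ring⟩⟩⟩
  by_cases hne : ∃ x, s x < t x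
  · obtain ⟨x0, hx0⟩ := hne
    obtain ⟨x, hx, hmin⟩ := Finset.exists_min_image ((Finset.range (2 * n)).filter fun x => s x < t x) s
      ⟨x0, by simp only [Finset.mem_filter, Finset.mem_range]; exact ⟨(hcol x0 hx0).1, hx0⟩⟩
    simp only [Finset.mem_filter, Finset.mem_range] at hx hmin
    have hmin' : ∀ y, s y < t y → s x ≤ s y := fun y hy => hmin y ⟨(hcol y hy).1, hy⟩
    obtain ⟨T, hT, hxT⟩ := (hcol x hx.2).2
    obtain ⟨a, b, h1, h2, h3, rfl, hexc⟩ := hS.tiling.ribbon_of_mem hs ht hT hxT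
    have heq := hexc.eq
    have hle' := hexc.le
    have ra := (hS.tiling.sub _ hT (a + 1) _ (mem_ribbon.2 ⟨le_rfl, hle', rfl⟩)).2.2.1
    have rb := (hS.tiling.sub _ hT b _ (mem_ribbon.2 ⟨hle', le_rfl, rfl⟩)).2.2.1
    have h4 := hexc.ge x h1 h2
    have h5 := hmin' (a + 1) (by omega)
    have hl : s a = s (a + 1) + 1 := by
      by_contra hcon
      have := hs.step a (by omega)
      have := ht.step a (by omega)
      have := hmin' a (by omega)
      omega
    have hr : s (b + 1) = s b + 1 := by
      by_contra hcon
      have := hs.step b (by omega)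
      have := ht.step b (by omega)
      have := hmin' (b + 1) (by omega)
      omega
    by_cases hma : m a = s a
    · by_cases hmb : m (b + 1) = s (b + 1)
      · exact ⟨a, b, Or.inl ⟨by omega, h3, hT, hexc, hl, hma, hr, hmb⟩⟩
      · obtain ⟨c, d, hf, hc, hd⟩ := exists_isFlipped hm hs hle (lt_of_le_of_ne (hle (b + 1)) hmb)
        exact ⟨c, d, Or.inr (hS.isFreeChord_of_adjacent hm ht hf hT (by omega) (Or.inr rfl) hc hd)⟩
    · obtain ⟨c, d, hf, hc, hd⟩ := exists_isFlipped hm hs hle (lt_of_le_of_ne (hle a) hma)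
      exact ⟨c, d, Or.inr (hS.isFreeChord_of_adjacent hm ht hf hT (by omega) (Or.inl rfl) hc hd)⟩
  · push Not at hne
    have hst : s = t := funext fun j => le_antisymm (hS.le j) (hne j)
    have : ∃ y, m y < s y := by
      by_contra hcon
      push Not at hcon
      exact hmt ((funext fun j => le_antisymm (hle j) (hcon j)).trans hst)
    obtain ⟨y, hy⟩ := this
    obtain ⟨c, d, hf, hc, hd⟩ := exists_isFlipped hm hs hle hy
    refine ⟨c, d, Or.inr ⟨hf, fun T hT x _ _ hx => ?_⟩⟩
    have := (hS.tiling.sub T hT x _ hx).2.2.1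
    rw [← hst] at this
    omega

/-- The sign of the number of flipped chords. -/
def flipSign (n : ℕ) (m s : ℕ → ℤ) : ℤ :=
  ∏ i ∈ Finset.range (2 * n), if s (i + 1) = s i + 1 ∧ m (i + 1) = m i - 1 then -1 else 1

theorem IsExchange.flipSign_eq (hm : IsDyckHeight n m) (hS : IsTilingState n m t s P)
    (hE : IsExchange n m s P s' P' a b) : flipSign n m s' = - flipSign n m s := by
  have hT := hE.tile
  have hab := hT.lt
  have hb := hT.lt_two_mul
  have hle := hS.ref.le hm hS.height
  have hmema : a ∈ Finset.range (2 * n) := Finset.mem_range.2 (by omega)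
  unfold flipSign
  rw [hE.height_eq, ← Finset.mul_prod_erase _ _ hmema, ← Finset.mul_prod_erase _ _ hmema, ← neg_mul]
  congr 1
  · have h1 := hT.left_step
    have h2 := hT.left
    have h3 := hm.step a (by omega)
    have h4 := hle (a + 1)
    rw [raisePath_in (by omega) (by omega), raisePath_out (by omega), if_pos (by omega),
      if_neg (by omega)]
  · apply Finset.prod_congr rfl
    intro i hi
    rw [Finset.mem_erase, Finset.mem_range] at hi
    by_cases hib : i = b
    · subst hib
      have h1 := hT.right_step
      have h2 := hT.right
      have h3 := hle i
      rw [raisePath_out (by omega), raisePath_in (by omega) (by omega), if_neg (by omega),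
        if_neg (by omega)]
    · by_cases h : a < i ∧ i < b
      · rw [raisePath_in (k := i + 1) (by omega) (by omega), raisePath_in (k := i) (by omega) (by omega)]
        congr 1
        rw [eq_iff_iff]
        constructor <;> rintro ⟨h1, h2⟩ <;> exact ⟨by omega, h2⟩
      · rw [raisePath_out (k := i + 1) (by omega), raisePath_out (k := i) (by omega)]

end

section
variable {n : ℕ} {m t s s' : ℕ → ℤ} {P P' : Finset (Finset (ℕ × ℤ))} {a b : ℕ}

/-- The states over the paths starting with the label `l`. -/
def tilingStates (n : ℕ) (m t : ℕ → ℤ) (l : Fin (2 * n)) :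
    Set (CyclicDyckPath n × Finset (Finset (ℕ × ℤ))) :=
  {x | x.1.first = l ∧ IsTilingState n m t x.1.height x.2}

theorem IsTilingState.mem_powerset (ht : IsDyckHeight n t) (hS : IsTilingState n m t s P) :
    P ∈ (Finset.range (2 * n + 1) ×ˢ Finset.Icc (0 : ℤ) n).powerset.powerset := by
  rw [Finset.mem_powerset]
  intro T hT
  rw [Finset.mem_powerset]
  rintro ⟨x, y⟩ hxy
  obtain ⟨h1, h2, h3, -⟩ := hS.tiling.sub T hT x y hxy
  have := hS.height.nonneg x
  have := ht.le_half x
  simp only [Finset.mem_product, Finset.mem_range, Finset.mem_Icc]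
  omega

theorem finite_tilingStates (ht : IsDyckHeight n t) (l : Fin (2 * n)) :
    (tilingStates n m t l).Finite := by
  classical
  refine Set.Finite.subset (Finset.finite_toSet ((Finset.univ : Finset (CyclicDyckPath n)) ×ˢ
    (Finset.range (2 * n + 1) ×ˢ Finset.Icc (0 : ℤ) n).powerset.powerset)) ?_
  rintro ⟨σ, P⟩ ⟨-, h⟩
  rw [Finset.mem_coe, Finset.mem_product]
  exact ⟨Finset.mem_univ _, h.mem_powerset ht⟩

/-- A total order on the intervals that refines inclusion. -/
def intervalKey (n a b : ℕ) : ℕ := (b - a) * (2 * n + 1) + a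

theorem intervalKey_le {c d : ℕ} (hac : a ≤ c) (hdb : d ≤ b) (hcd : c < d) (hb : b < 2 * n) :
    intervalKey n c d ≤ intervalKey n a b := by
  unfold intervalKey
  by_cases h : d - c = b - a
  · rw [h]; omega
  · have : (d - c) + 1 ≤ b - a := by omega
    have := Nat.mul_le_mul_right (2 * n + 1) this
    rw [Nat.add_mul] at this
    omega

theorem intervalKey_inj {c d : ℕ} (hab : a < b) (hb : b < 2 * n) (hcd : c < d) (hd : d < 2 * n)
    (h : intervalKey n a b = intervalKey n c d) : a = c ∧ b = d := by
  unfold intervalKey at h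
  have h1 : b - a = d - c := by
    have e1 : ((b - a) * (2 * n + 1) + a) / (2 * n + 1) = b - a := by
      rw [mul_comm, Nat.mul_add_div (by omega), Nat.div_eq_of_lt (by omega), add_zero]
    have e2 : ((d - c) * (2 * n + 1) + c) / (2 * n + 1) = d - c := by
      rw [mul_comm, Nat.mul_add_div (by omega), Nat.div_eq_of_lt (by omega), add_zero]
    rw [← e1, ← e2, h]
  rw [h1] at h
  omega

/-- Two states are partners when they are exchanged along the largest border interval. -/
def IsPartner (n : ℕ) (m : ℕ → ℤ) (x y : CyclicDyckPath n × Finset (Finset (ℕ × ℤ))) : Prop :=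
  ∃ a b, (IsExchange n m x.1.height x.2 y.1.height y.2 a b ∨
      IsExchange n m y.1.height y.2 x.1.height x.2 a b) ∧
    ∀ c d, IsBorder n m x.1.height x.2 c d → intervalKey n c d ≤ intervalKey n a b

theorem IsBorder.lt (h : IsBorder n m s P a b) : a < b := h.elim (fun h => h.lt) (fun h => h.lt)

theorem IsBorder.lt_two_mul (h : IsBorder n m s P a b) : b < 2 * n :=
  h.elim (fun h => h.lt_two_mul) (fun h => h.lt_two_mul)

theorem IsPartner.symm {l : Fin (2 * n)} {x y}
    (hy : y ∈ tilingStates n m t l) (h : IsPartner n m x y) : IsPartner n m y x := by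
  obtain ⟨a, b, hE, hmax⟩ := h
  refine ⟨a, b, hE.symm, fun c d hcd => ?_⟩
  have hlt := hcd.lt
  rcases hE with hE | hE
  · rcases hE.border_down hcd with h | ⟨h1, h2⟩
    · exact hmax c d h
    · exact intervalKey_le h1 h2 hlt hE.tile.lt_two_mul
  · rcases hE.border_up hy.2 hcd with h | ⟨h1, h2⟩
    · exact hmax c d h
    · exact intervalKey_le h1 h2 hlt hE.tile.lt_two_mul

theorem exists_isPartner (hm : IsDyckHeight n m) (ht : IsDyckHeight n t) (hmt : m ≠ t)
    {l : Fin (2 * n)} {x} (hx : x ∈ tilingStates n m t l) :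
    ∃ y ∈ tilingStates n m t l, IsPartner n m x y := by
  classical
  obtain ⟨a0, b0, h0⟩ := hx.2.exists_isBorder hm ht hmt
  obtain ⟨p, hp, hmax⟩ := Finset.exists_max_image
    ((Finset.range (2 * n) ×ˢ Finset.range (2 * n)).filter
      fun p : ℕ × ℕ => IsBorder n m x.1.height x.2 p.1 p.2) (fun p => intervalKey n p.1 p.2)
    ⟨(a0, b0), by
      have := h0.lt; have := h0.lt_two_mul
      simp only [Finset.mem_filter, Finset.mem_product, Finset.mem_range]
      exact ⟨by omega, h0⟩⟩
  obtain ⟨a, b⟩ := p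
  simp only [Finset.mem_filter, Finset.mem_product, Finset.mem_range] at hp hmax
  have hmax' : ∀ c d, IsBorder n m x.1.height x.2 c d → intervalKey n c d ≤ intervalKey n a b := by
    intro c d h
    have := h.lt; have := h.lt_two_mul
    exact hmax (c, d) ⟨by simp only; omega, h⟩
  rcases hp.2 with h | h
  · obtain ⟨h1, h2⟩ := hx.2.raise hm h
    obtain ⟨σ, hσ, hσ'⟩ := CyclicDyckPath.exists_of_isDyckHeight h1.height l
    rw [← hσ'] at h1 h2
    exact ⟨(σ, _), ⟨hσ, h1⟩, a, b, Or.inl h2, hmax'⟩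
  · obtain ⟨h1, h2⟩ := hx.2.lower hm h
    obtain ⟨σ, hσ, hσ'⟩ := CyclicDyckPath.exists_of_isDyckHeight h1.height l
    rw [← hσ'] at h1 h2
    exact ⟨(σ, _), ⟨hσ, h1⟩, a, b, Or.inr h2, hmax'⟩

theorem IsPartner.unique (hm : IsDyckHeight n m) {l : Fin (2 * n)} {x y z}
    (hy : y ∈ tilingStates n m t l) (hz : z ∈ tilingStates n m t l)
    (h : IsPartner n m x y) (h' : IsPartner n m x z) : y = z := by
  obtain ⟨a, b, hE, hmax⟩ := h
  obtain ⟨c, d, hE', hmax'⟩ := h'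
  have hb : IsBorder n m x.1.height x.2 a b :=
    hE.elim (fun h => Or.inl h.tile) (fun h => Or.inr h.chord)
  have hb' : IsBorder n m x.1.height x.2 c d :=
    hE'.elim (fun h => Or.inl h.tile) (fun h => Or.inr h.chord)
  obtain ⟨rfl, rfl⟩ := intervalKey_inj hb.lt hb.lt_two_mul hb'.lt hb'.lt_two_mul
    (le_antisymm (hmax' _ _ hb) (hmax _ _ hb'))
  have hext : y.1.height = z.1.height → y.2 = z.2 → y = z := fun h1 h2 =>
    Prod.ext (CyclicDyckPath.ext_of_height (hy.1.trans hz.1.symm) fun j _ => by rw [h1]) h2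
  rcases hE with hE | hE <;> rcases hE' with hE' | hE'
  · apply hext
    · rw [hE.height_eq, hE'.height_eq]
    · rw [← Finset.erase_insert hE.notMem, ← Finset.erase_insert hE'.notMem, ← hE.parts_eq,
        ← hE'.parts_eq]
  · exact absurd hE'.chord (hE.tile.not_isFreeChord hm)
  · exact absurd hE.chord (hE'.tile.not_isFreeChord hm)
  · have e : y.1.height = z.1.height := by
      rw [← lowerPath_raisePath y.1.height a b, ← hE.height_eq, hE'.height_eq, lowerPath_raisePath]
    apply hext e
    rw [hE.parts_eq, hE'.parts_eq, e]

theorem sum_tilingStates (hm : IsDyckHeight n m) (ht : IsDyckHeight n t) (hmt : m ≠ t)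
    (l : Fin (2 * n)) :
    ∑ x ∈ (finite_tilingStates (m := m) ht l).toFinset, flipSign n m x.1.height = 0 := by
  have hex : ∀ x ∈ (finite_tilingStates (m := m) ht l).toFinset,
      ∃ y ∈ tilingStates n m t l, IsPartner n m x y := fun x hx =>
    exists_isPartner hm ht hmt ((Set.Finite.mem_toFinset _).1 hx)
  choose g hg hg' using hex
  have hneg : ∀ x (hx : x ∈ (finite_tilingStates (m := m) ht l).toFinset),
      flipSign n m (g x hx).1.height = - flipSign n m x.1.height := by
    intro x hx
    obtain ⟨a, b, hE | hE, -⟩ := hg' x hx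
    · exact hE.flipSign_eq hm ((Set.Finite.mem_toFinset _).1 hx).2
    · rw [hE.flipSign_eq hm (hg x hx).2, neg_neg]
  refine Finset.sum_involution g (fun x hx => ?_) (fun x hx h0 heq => ?_)
    (fun x hx => (Set.Finite.mem_toFinset _).2 (hg x hx)) (fun x hx => ?_)
  · rw [hneg]; ring
  · have := hneg x hx
    rw [heq] at this
    omega
  · have hmem := (Set.Finite.mem_toFinset _).1 hx
    exact IsPartner.unique hm (hg _ _) hmem (hg' _ _) ((hg' x hx).symm (hg x hx))

namespace CyclicDyckPath

theorem mem_shape {σ μ : CyclicDyckPath n} {x : ℕ} {y : ℤ} :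
    (x, y) ∈ shape σ μ ↔ InRegion n σ.height μ.height x y := by
  have h1 := σ.isDyckHeight.nonneg x
  have h2 := μ.isDyckHeight.le_half x
  simp only [shape, InRegion, Finset.mem_filter, Finset.mem_product, Finset.mem_range,
    Finset.mem_Icc]
  constructor
  · rintro ⟨⟨h3, -⟩, h⟩; exact ⟨by omega, h⟩
  · rintro ⟨h3, h⟩; exact ⟨⟨by omega, by omega, by omega⟩, h⟩

theorem IsDyckTile.nonempty {T : Finset (ℕ × ℤ)} (h : IsDyckTile T) : T.Nonempty := by
  obtain ⟨p, a, b, rfl⟩ := h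
  simp

theorem isCITiling_parts {σ μ : CyclicDyckPath n} (P : Finpartition (shape σ μ))
    (h1 : IsDyckTiling P) (h2 : IsCoverInclusive P) :
    IsCITiling n σ.height μ.height P.parts := by
  refine ⟨fun T hT x y hxy => ?_, fun x y hxy => ?_, fun T hT T' hT' x y h h' => ?_, h1,
    fun T hT T' hT' x y h h' z w hz => ?_⟩
  · exact mem_shape.1 (P.le hT hxy)
  · exact (P.exists_mem (mem_shape.2 hxy))
  · exact P.eq_of_mem_parts hT hT' h h'
  · have := h2 T hT T' hT' ⟨x, y, h, h'⟩ (Finset.mem_image_of_mem Prod.fst hz)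
    obtain ⟨⟨u, v⟩, huv, rfl⟩ := Finset.mem_image.1 this
    exact ⟨v, huv⟩

theorem exists_finpartition {σ μ : CyclicDyckPath n} {P : Finset (Finset (ℕ × ℤ))}
    (h : IsCITiling n σ.height μ.height P) : ∃ Q : Finpartition (shape σ μ),
      (IsDyckTiling Q ∧ IsCoverInclusive Q) ∧ Q.parts = P := by
  refine ⟨⟨P, ?_, ?_, ?_⟩, ⟨h.tile, ?_⟩, rfl⟩
  · rw [Finset.supIndep_iff_pairwiseDisjoint]
    intro T hT T' hT' hne
    rw [Function.onFun, id, id, Finset.disjoint_left]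
    rintro ⟨x, y⟩ h1 h2
    exact hne (h.disj T hT T' hT' x y h1 h2)
  · ext ⟨x, y⟩
    rw [Finset.mem_sup, mem_shape]
    constructor
    · rintro ⟨T, hT, hxy⟩; exact h.sub T hT x y hxy
    · intro hxy; exact h.cover x y hxy
  · intro hb
    obtain ⟨x, hx⟩ := IsDyckTile.nonempty (h.tile _ hb)
    simp at hx
  · rintro T hT T' hT' ⟨x, y, h1, h2⟩ z hz
    obtain ⟨⟨u, v⟩, huv, rfl⟩ := Finset.mem_image.1 hz
    obtain ⟨w', hw'⟩ := h.incl T hT T' hT' x y h1 h2 u v huv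
    exact Finset.mem_image.2 ⟨(u, w'), hw', rfl⟩

theorem ci_eq (σ μ : CyclicDyckPath n) :
    ci σ μ = Nat.card {P // IsCITiling n σ.height μ.height P} := by
  unfold ci
  refine Nat.card_congr (Equiv.ofBijective
    (fun P => ⟨P.1.parts, isCITiling_parts P.1 P.2.1 P.2.2⟩) ⟨fun P Q h => ?_, fun P => ?_⟩)
  · exact Subtype.ext (Finpartition.ext (congrArg Subtype.val h))
  · obtain ⟨Q, hQ, hQ'⟩ := exists_finpartition P.2
    exact ⟨⟨Q, hQ⟩, Subtype.ext hQ'⟩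

theorem ci_self (σ : CyclicDyckPath n) : ci σ σ = 1 := by
  rw [ci_eq, Nat.card_eq_one_iff_unique]
  refine ⟨⟨fun P Q => ?_⟩, ⟨⟨∅, ?_⟩⟩⟩
  · have key : ∀ P : {P // IsCITiling n σ.height σ.height P}, P.1 = ∅ := by
      intro P
      refine Finset.eq_empty_of_forall_notMem fun T hT => ?_
      obtain ⟨⟨x, y⟩, hxy⟩ := IsDyckTile.nonempty (P.2.tile T hT)
      obtain ⟨-, h1, h2, -⟩ := P.2.sub T hT x y hxy
      omega
    exact Subtype.ext ((key P).trans (key Q).symm)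
  · exact ⟨by simp, fun x y ⟨_, h1, h2, _⟩ => by omega, by simp, by simp, by simp⟩

open Classical in
theorem sum_flipSign_ci (μ τ : CyclicDyckPath n) (hfirst : μ.first = τ.first) :
    ∑ σ : CyclicDyckPath n, (if τ.Dominates σ ∧ Refines n μ.height σ.height then
      flipSign n μ.height σ.height * (ci σ τ : ℤ) else 0) = if μ = τ then 1 else 0 := by
  have hm := μ.isDyckHeight
  have ht := τ.isDyckHeight
  have hle : ∀ σ : CyclicDyckPath n, τ.Dominates σ ↔
      (σ.first = τ.first ∧ ∀ j, σ.height j ≤ τ.height j) := by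
    intro σ
    refine ⟨fun h => ⟨h.1.symm, fun j => ?_⟩, fun h => ⟨h.1.symm, fun j _ => h.2 j⟩⟩
    by_cases hj : j ≤ 2 * n
    · exact h.2 j hj
    · rw [σ.isDyckHeight.eq_zero j (by omega), ht.eq_zero j (by omega)]
  by_cases hmt : μ = τ
  · subst hmt
    rw [if_pos rfl, Finset.sum_eq_single μ]
    · rw [if_pos ⟨⟨rfl, fun _ _ => le_rfl⟩, Refines.refl _ _⟩, ci_self]
      unfold flipSign
      rw [Finset.prod_congr rfl fun i _ => if_neg (by omega)]
      simp
    · intro σ _ hne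
      rw [if_neg]
      rintro ⟨h1, h2⟩
      rw [hle] at h1
      exact hne (ext_of_height h1.1 fun j _ => le_antisymm (h1.2 j) (h2.le hm σ.isDyckHeight j))
    · simp
  · rw [if_neg hmt]
    have hmt' : μ.height ≠ τ.height := fun h => hmt (ext_of_height hfirst fun j _ => by rw [h])
    refine Eq.trans ?_ (sum_tilingStates hm ht hmt' τ.first)
    have hset : (finite_tilingStates (m := μ.height) ht τ.first).toFinset =
        (Finset.univ ×ˢ (Finset.range (2 * n + 1) ×ˢ Finset.Icc (0 : ℤ) n).powerset.powerset).filter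
          (fun x => x ∈ tilingStates n μ.height τ.height τ.first) := by
      ext x
      rw [Set.Finite.mem_toFinset, Finset.mem_filter, Finset.mem_product]
      exact ⟨fun h => ⟨⟨Finset.mem_univ _, h.2.mem_powerset ht⟩, h⟩, fun h => h.2⟩
    rw [hset, Finset.sum_filter, Finset.sum_product]
    refine Finset.sum_congr rfl fun σ _ => ?_
    dsimp only
    by_cases h : τ.Dominates σ ∧ Refines n μ.height σ.height
    · rw [if_pos h]
      have h' := (hle σ).1 h.1
      rw [← Finset.sum_filter, Finset.sum_const, nsmul_eq_mul, mul_comm]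
      congr 2
      rw [ci_eq, Nat.card_congr (Equiv.subtypeEquivRight (q := fun P => P ∈
        ((Finset.range (2 * n + 1) ×ˢ Finset.Icc (0 : ℤ) n).powerset.powerset).filter
          (fun P => (σ, P) ∈ tilingStates n μ.height τ.height τ.first)) fun P => ?_),
        Nat.card_eq_fintype_card, Fintype.card_coe]
      rw [Finset.mem_filter]
      constructor
      · intro hP
        have hS : IsTilingState n μ.height τ.height σ.height P := ⟨σ.isDyckHeight, h.2, h'.2, hP⟩
        exact ⟨hS.mem_powerset ht, h'.1, hS⟩
      · rintro ⟨-, -, hS⟩; exact hS.tiling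
    · rw [if_neg h]
      symm
      apply Finset.sum_eq_zero
      intro P _
      rw [if_neg]
      rintro ⟨h1, h2⟩
      exact h ⟨(hle σ).2 ⟨h1, h2.le⟩, h2.ref⟩

open Classical in
/-- The matrices of flip signs and of numbers of cover-inclusive tilings are inverse. -/
theorem sum_ci_flipSign (σ τ : CyclicDyckPath n) (hfirst : σ.first = τ.first) :
    ∑ μ : CyclicDyckPath n, (if μ.Dominates σ ∧ Refines n μ.height τ.height then
      (ci σ μ : ℤ) * flipSign n μ.height τ.height else 0) = if σ = τ then 1 else 0 := by
  have hsub : ∀ f : CyclicDyckPath n → ℤ, (∀ μ, μ.first ≠ τ.first → f μ = 0) →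
      ∑ μ : {μ : CyclicDyckPath n // μ.first = τ.first}, f μ.1 = ∑ μ, f μ := by
    intro f hf
    rw [← Finset.sum_subtype (Finset.univ.filter fun μ : CyclicDyckPath n => μ.first = τ.first)
      (by simp) f, Finset.sum_filter_of_ne]
    intro x _ hx
    by_contra h
    exact hx (hf x h)
  let F : Matrix {μ : CyclicDyckPath n // μ.first = τ.first}
      {μ : CyclicDyckPath n // μ.first = τ.first} ℤ := Matrix.of fun μ σ =>
    if Refines n μ.1.height σ.1.height then flipSign n μ.1.height σ.1.height else 0
  let C : Matrix {μ : CyclicDyckPath n // μ.first = τ.first}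
      {μ : CyclicDyckPath n // μ.first = τ.first} ℤ := Matrix.of fun σ τ =>
    if τ.1.Dominates σ.1 then (ci σ.1 τ.1 : ℤ) else 0
  have hFC : F * C = 1 := by
    ext μ ρ
    have := sum_flipSign_ci μ.1 ρ.1 (μ.2.trans ρ.2.symm)
    rw [Matrix.mul_apply, Matrix.one_apply]
    simp only [Subtype.ext_iff]
    rw [← this, ← hsub]
    · refine Finset.sum_congr rfl fun σ _ => ?_
      simp only [F, C, Matrix.of_apply]
      by_cases h1 : ρ.1.Dominates σ.1 <;> by_cases h2 : Refines n μ.1.height σ.1.height <;>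
        simp [h1, h2]
    · intro σ hσ
      rw [if_neg]
      rintro ⟨h, -⟩
      exact hσ (h.1.symm.trans ρ.2)
  have hCF : C * F = 1 := mul_eq_one_comm.1 hFC
  have := congrFun (congrFun hCF ⟨σ, hfirst⟩) ⟨τ, rfl⟩
  rw [Matrix.mul_apply, Matrix.one_apply] at this
  simp only [Subtype.mk.injEq] at this
  rw [← this, ← hsub]
  · refine Finset.sum_congr rfl fun μ _ => ?_
    simp only [F, C, Matrix.of_apply]
    by_cases h1 : μ.1.Dominates σ <;> by_cases h2 : Refines n μ.1.height τ.height <;>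
        simp [h1, h2]
  · intro μ hμ
    rw [if_neg]
    rintro ⟨h, -⟩
    exact hμ (h.1.trans hfirst)

end CyclicDyckPath

end

section
/-! ## Up labels and chords -/

/-- The step (`1` or `-1`) with label `j`, modulo `2 * n`, when the labels in `U` are up steps. -/
def labelStep {n : ℕ} (U : Finset (Fin (2 * n))) (j : ℕ) : ℤ :=
  open Classical in if ∃ x ∈ U, x.val = j % (2 * n) then 1 else -1

/-- The periodic height function whose steps are given by `U`. -/
def labelHeight {n : ℕ} (U : Finset (Fin (2 * n))) (j : ℕ) : ℤ :=
  ∑ i ∈ Finset.range j, labelStep U i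

/-- `i` is an up step, and `j` is the closest step to its right at the same height. -/
structure IsArc (g : ℕ → ℤ) (i j : ℕ) : Prop where
  lt : i < j
  gt : ∀ k, i < k → k ≤ j → g i < g k
  eq : g (j + 1) = g i

theorem IsArc.right_unique {g : ℕ → ℤ} {i j j' : ℕ} (h : IsArc g i j) (h' : IsArc g i j') :
    j = j' := by
  have h1 := h.lt; have h2 := h'.lt; have h3 := h.eq; have h4 := h'.eq
  by_contra hne
  rcases Nat.lt_or_gt_of_ne hne with hlt | hlt
  · have := h'.gt (j + 1) (by omega) (by omega); omega
  · have := h.gt (j' + 1) (by omega) (by omega); omega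

theorem IsArc.left_unique {g : ℕ → ℤ} {i i' j : ℕ} (h : IsArc g i j) (h' : IsArc g i' j) :
    i = i' := by
  have h1 := h.lt; have h2 := h'.lt; have h3 := h.eq; have h4 := h'.eq
  by_contra hne
  rcases Nat.lt_or_gt_of_ne hne with hlt | hlt
  · have := h.gt i' (by omega) (by omega); omega
  · have := h'.gt i (by omega) (by omega); omega

variable {n : ℕ}

theorem labelStep_of_mem {U : Finset (Fin (2 * n))} {x : Fin (2 * n)} {j : ℕ}
    (hj : j % (2 * n) = x) (hx : x ∈ U) : labelStep U j = 1 := by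
  unfold labelStep
  rw [if_pos ⟨x, hx, hj.symm⟩]

theorem labelStep_of_notMem {U : Finset (Fin (2 * n))} {x : Fin (2 * n)} {j : ℕ}
    (hj : j % (2 * n) = x) (hx : x ∉ U) : labelStep U j = -1 := by
  unfold labelStep
  rw [if_neg]
  rintro ⟨y, hy, hy'⟩
  have : y = x := Fin.ext (by omega)
  exact hx (this ▸ hy)

theorem labelStep_cases (U : Finset (Fin (2 * n))) (j : ℕ) :
    labelStep U j = 1 ∨ labelStep U j = -1 := by
  unfold labelStep; split_ifs <;> simp

theorem labelStep_congr (U : Finset (Fin (2 * n))) {i j : ℕ} (h : i % (2 * n) = j % (2 * n)) :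
    labelStep U i = labelStep U j := by
  unfold labelStep; rw [h]

theorem labelHeight_succ (U : Finset (Fin (2 * n))) (j : ℕ) :
    labelHeight U (j + 1) = labelHeight U j + labelStep U j := Finset.sum_range_succ _ _

theorem labelHeight_step (U : Finset (Fin (2 * n))) (j : ℕ) :
    labelHeight U (j + 1) = labelHeight U j + 1 ∨ labelHeight U (j + 1) = labelHeight U j - 1 := by
  rw [labelHeight_succ]
  rcases labelStep_cases U j with h | h <;> rw [h]
  · exact Or.inl rfl
  · exact Or.inr rfl

theorem labelHeight_sub_congr (U : Finset (Fin (2 * n))) {i j : ℕ} (h : i % (2 * n) = j % (2 * n))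
    (k : ℕ) : labelHeight U (i + k) - labelHeight U i = labelHeight U (j + k) - labelHeight U j := by
  induction k with
  | zero => simp
  | succ k ih =>
    rw [← add_assoc, ← add_assoc, labelHeight_succ, labelHeight_succ,
      labelStep_congr U (i := i + k) (j := j + k) (Nat.ModEq.add_right k h)]
    linarith

theorem isArc_labelHeight_congr {U : Finset (Fin (2 * n))} {i j m : ℕ}
    (h : i % (2 * n) = j % (2 * n)) (hi : IsArc (labelHeight U) i (i + m)) :
    IsArc (labelHeight U) j (j + m) := by
  have hlt := hi.lt
  refine ⟨by omega, fun k h1 h2 => ?_, ?_⟩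
  · have e1 := hi.gt (i + (k - j)) (by omega) (by omega)
    have e2 := labelHeight_sub_congr U h (k - j)
    rw [show j + (k - j) = k by omega] at e2
    omega
  · have e1 := hi.eq
    have e2 := labelHeight_sub_congr U h (m + 1)
    rw [← add_assoc, ← add_assoc] at e2
    omega

theorem sum_labelStep (U : Finset (Fin (2 * n))) (f : ℕ → ℤ) :
    ∑ i ∈ Finset.range (2 * n), f i * labelStep U i =
      ∑ x ∈ U, f x - ∑ x ∈ Uᶜ, f x := by
  classical
  rw [Finset.sum_range, sub_eq_add_neg, ← Finset.sum_neg_distrib, ← Finset.sum_add_sum_compl U]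
  congr 1 <;> refine Finset.sum_congr rfl fun x hx => ?_
  · rw [labelStep_of_mem (Nat.mod_eq_of_lt x.2) hx, mul_one]
  · rw [labelStep_of_notMem (Nat.mod_eq_of_lt x.2) (Finset.mem_compl.1 hx), mul_neg_one]

theorem labelHeight_two_mul (U : Finset (Fin (2 * n))) :
    labelHeight U (2 * n) = 2 * U.card - 2 * n := by
  classical
  have := sum_labelStep U fun _ => 1
  simp only [one_mul, Finset.sum_const, nsmul_eq_mul, mul_one] at this
  unfold labelHeight
  rw [this, Finset.card_compl, Fintype.card_fin]
  have : U.card ≤ 2 * n := by simpa using Finset.card_le_univ U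
  omega

theorem labelHeight_add_period {U : Finset (Fin (2 * n))} (hU : U.card = n) (j : ℕ) :
    labelHeight U (j + 2 * n) = labelHeight U j := by
  have h0 : labelHeight U 0 = 0 := by simp [labelHeight]
  have h1 := labelHeight_two_mul U
  induction j with
  | zero => rw [zero_add, h1, h0, hU]; ring
  | succ j ih =>
    rw [show j + 1 + 2 * n = j + 2 * n + 1 by ring, labelHeight_succ, labelHeight_succ, ih,
      labelStep_congr U (i := j + 2 * n) (j := j) (by simp)]

namespace CyclicDyckPath

theorem two_mul_pos (σ : CyclicDyckPath n) : 0 < 2 * n := by have := σ.first.2; omega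

theorem label_val (σ : CyclicDyckPath n) (j : Fin (2 * n)) :
    (σ.label j : ℕ) = (σ.first + j) % (2 * n) := by
  unfold label; rw [Fin.val_add]

theorem label_val_ite (σ : CyclicDyckPath n) (j : Fin (2 * n)) :
    (σ.label j : ℕ) = if σ.first.val + j < 2 * n then σ.first.val + j else σ.first + j - 2 * n := by
  rw [label_val]
  have := σ.first.2; have := j.2
  split_ifs with h
  · exact Nat.mod_eq_of_lt h
  · rw [Nat.mod_eq_sub_mod (by omega), Nat.mod_eq_of_lt (by omega)]

theorem label_injective (σ : CyclicDyckPath n) : Function.Injective σ.label := by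
  intro i j h
  have h1 := congrArg Fin.val h
  rw [label_val_ite, label_val_ite] at h1
  have := σ.first.2; have := i.2; have := j.2
  apply Fin.ext
  split_ifs at h1 <;> omega

/-- The labelling of the steps as a permutation. -/
def labelEquiv (σ : CyclicDyckPath n) : Fin (2 * n) ≃ Fin (2 * n) :=
  Equiv.ofBijective σ.label (Finite.injective_iff_bijective.1 σ.label_injective)

/-- The position of a label. -/
def pos (σ : CyclicDyckPath n) (x : Fin (2 * n)) : Fin (2 * n) := σ.labelEquiv.symm x

theorem label_pos (σ : CyclicDyckPath n) (x : Fin (2 * n)) : σ.label (σ.pos x) = x :=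
  σ.labelEquiv.apply_symm_apply x

theorem pos_label (σ : CyclicDyckPath n) (j : Fin (2 * n)) : σ.pos (σ.label j) = j :=
  σ.labelEquiv.symm_apply_apply j

theorem pos_val_ite (σ : CyclicDyckPath n) (x : Fin (2 * n)) :
    (σ.pos x : ℕ) = if σ.first ≤ x then x.val - σ.first else x + 2 * n - σ.first := by
  have h := congrArg Fin.val (σ.label_pos x)
  rw [label_val_ite] at h
  have := σ.first.2; have := (σ.pos x).2; have := x.2
  simp only [Fin.le_def]
  split_ifs at h ⊢ <;> omega

theorem first_add_pos_mod (σ : CyclicDyckPath n) (x : Fin (2 * n)) :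
    (σ.first + σ.pos x : ℕ) % (2 * n) = x := by
  rw [← label_val, label_pos]

theorem posOne_ite (σ : CyclicDyckPath n) :
    σ.posOne = if σ.first.val = 0 then 0 else 2 * n - σ.first := by
  have := σ.first.2
  unfold posOne
  split_ifs with h
  · rw [h]; simp
  · exact Nat.mod_eq_of_lt (by omega)

/-- The labels of the up steps. -/
def upLabels (σ : CyclicDyckPath n) : Finset (Fin (2 * n)) :=
  open Classical in Finset.univ.filter fun x => σ.IsUp (σ.pos x)

theorem mem_upLabels (σ : CyclicDyckPath n) (x : Fin (2 * n)) :
    x ∈ σ.upLabels ↔ σ.height (σ.pos x + 1) = σ.height (σ.pos x) + 1 := by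
  simp only [upLabels, Finset.mem_filter, Finset.mem_univ, true_and, isUp_iff, (σ.pos x).2]

theorem height_succ (σ : CyclicDyckPath n) {j : ℕ} (hj : j < 2 * n) :
    σ.height (j + 1) = σ.height j + labelStep σ.upLabels (σ.first + j) := by
  have h1 : (σ.first + j : ℕ) % (2 * n) = σ.label ⟨j, hj⟩ := by rw [label_val]
  have h2 := σ.mem_upLabels (σ.label ⟨j, hj⟩)
  rw [pos_label] at h2
  by_cases h : σ.label ⟨j, hj⟩ ∈ σ.upLabels
  · rw [labelStep_of_mem h1 h, h2.1 h]
  · rw [labelStep_of_notMem h1 h]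
    rcases σ.isDyckHeight.step j hj with h3 | h3
    · exact absurd (h2.2 h3) h
    · rw [h3]; ring

theorem height_eq (σ : CyclicDyckPath n) {j : ℕ} (hj : j ≤ 2 * n) :
    σ.height j = labelHeight σ.upLabels (σ.first + j) - labelHeight σ.upLabels σ.first := by
  induction j with
  | zero => simp [σ.isDyckHeight.zero]
  | succ j ih =>
    rw [σ.height_succ (by omega), ih (by omega), ← add_assoc, labelHeight_succ]; ring

theorem card_upLabels (σ : CyclicDyckPath n) : σ.upLabels.card = n := by
  have h1 := σ.height_eq (j := 2 * n) le_rfl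
  rw [σ.isDyckHeight.eq_zero _ le_rfl] at h1
  have h2 := labelHeight_sub_congr σ.upLabels (i := 0 + 0) (j := 2 * n) (by simp) σ.first
  have h3 := labelHeight_two_mul σ.upLabels
  simp only [zero_add, labelHeight, Finset.range_zero, Finset.sum_empty, sub_zero] at h2 h3 h1
  rw [add_comm (2 * n)] at h2
  omega

theorem isArc_height_iff (σ : CyclicDyckPath n) {i j : ℕ} (hj : j < 2 * n) :
    IsArc σ.height i j ↔ IsArc (labelHeight σ.upLabels) (σ.first + i) (σ.first + j) := by
  constructor
  · intro h
    have hlt := h.lt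
    refine ⟨by omega, fun k h1 h2 => ?_, ?_⟩
    · have h3 := h.gt (k - σ.first) (by omega) (by omega)
      rw [σ.height_eq (by omega), σ.height_eq (by omega),
        show σ.first.val + (k - σ.first.val) = k by omega] at h3
      omega
    · have h3 := h.eq
      rw [σ.height_eq (by omega), σ.height_eq (by omega), ← add_assoc] at h3
      omega
  · intro h
    have hlt := h.lt
    refine ⟨by omega, fun k h1 h2 => ?_, ?_⟩
    · have h3 := h.gt (σ.first + k) (by omega) (by omega)
      rw [σ.height_eq (by omega), σ.height_eq (by omega)]
      omega
    · have h3 := h.eq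
      rw [σ.height_eq (by omega), σ.height_eq (by omega), ← add_assoc]
      omega

theorem isChord_iff (σ : CyclicDyckPath n) (i j : Fin (2 * n)) :
    σ.IsChord i j ↔ IsArc σ.height i j := by
  unfold IsChord
  rw [isUp_iff]
  constructor
  · rintro ⟨h1, -, h3, h4⟩; exact ⟨h1, h4, h3⟩
  · intro h
    refine ⟨h.lt, ⟨i.2, ?_⟩, h.eq, h.gt⟩
    have := h.gt (i + 1) (by omega) (by have := h.lt; omega)
    have := σ.isDyckHeight.step i i.2
    omega

theorem mem_chords_iff_pos (σ : CyclicDyckPath n) (x y : Fin (2 * n)) :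
    (x, y) ∈ σ.chords ↔ IsArc σ.height (σ.pos x) (σ.pos y) := by
  simp only [chords, Finset.mem_image, Finset.mem_filter, Finset.mem_univ, true_and, Prod.exists,
    Prod.mk.injEq]
  constructor
  · rintro ⟨i, j, h, rfl, rfl⟩
    rwa [pos_label, pos_label, ← isChord_iff]
  · intro h
    exact ⟨σ.pos x, σ.pos y, (σ.isChord_iff _ _).2 h, σ.label_pos x, σ.label_pos y⟩

theorem mem_chords_iff (σ : CyclicDyckPath n) (x y : Fin (2 * n)) :
    (x, y) ∈ σ.chords ↔ ∃ p q : ℕ, p % (2 * n) = x ∧ q % (2 * n) = y ∧ q < p + 2 * n ∧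
      IsArc (labelHeight σ.upLabels) p q := by
  rw [mem_chords_iff_pos]
  constructor
  · intro h
    refine ⟨σ.first + σ.pos x, σ.first + σ.pos y, σ.first_add_pos_mod x, σ.first_add_pos_mod y,
      ?_, (σ.isArc_height_iff (σ.pos y).2).1 h⟩
    have := (σ.pos y).2; omega
  · rintro ⟨p, q, hp, hq, hlt, h⟩
    have hpq := h.lt
    obtain ⟨m, rfl⟩ : ∃ m, q = p + m := ⟨q - p, by omega⟩
    have h' := isArc_labelHeight_congr (j := σ.first + σ.pos x)
      (by rw [hp, σ.first_add_pos_mod]) h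
    have hm : (σ.pos x : ℕ) + m < 2 * n := by
      by_contra hcon
      have h1 := h'.gt (σ.first + 2 * n) (by have := (σ.pos x).2; omega) (by omega)
      have h2 := σ.height_eq (j := 2 * n) le_rfl
      have h3 := σ.height_eq (j := σ.pos x) (σ.pos x).2.le
      rw [σ.isDyckHeight.eq_zero _ le_rfl] at h2
      have h4 := σ.isDyckHeight.nonneg (σ.pos x)
      omega
    have hy : (σ.pos y : ℕ) = σ.pos x + m := by
      have e1 : σ.label ⟨σ.pos x + m, hm⟩ = y := by
        apply Fin.ext
        rw [label_val, ← hq]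
        rw [← add_assoc]
        exact Nat.ModEq.add_right m ((σ.first_add_pos_mod x).trans hp.symm)
      rw [← e1, pos_label]
    rw [hy, σ.isArc_height_iff hm]
    rwa [add_assoc] at h'

theorem upLabels_of_mem_chords {σ : CyclicDyckPath n} {c : Fin (2 * n) × Fin (2 * n)}
    (hc : c ∈ σ.chords) : c.1 ∈ σ.upLabels ∧ c.2 ∉ σ.upLabels := by
  have h := (σ.mem_chords_iff_pos c.1 c.2).1 hc
  have hlt := h.lt
  rw [mem_upLabels, mem_upLabels]
  have h1 := h.gt (σ.pos c.1 + 1) (by omega) (by omega)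
  have h2 := h.gt (σ.pos c.2) (by omega) (by omega)
  have h3 := h.eq
  have h4 := σ.isDyckHeight.step _ (σ.pos c.1).2
  constructor <;> omega

theorem exists_chord_of_mem {σ : CyclicDyckPath n} {x : Fin (2 * n)} (hx : x ∈ σ.upLabels) :
    ∃ y, (x, y) ∈ σ.chords := by
  rw [mem_upLabels] at hx
  have hlt := (σ.pos x).2
  obtain ⟨k, h1, h2, h3, h4⟩ := exists_first_visit (s := σ.height) (i := σ.pos x + 1)
    (2 * n - (σ.pos x + 1)) (fun j _ hj => σ.isDyckHeight.step j (by omega))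
    (c := σ.height (σ.pos x)) (by omega)
    (by rw [show (σ.pos x + 1 + (2 * n - (σ.pos x + 1)) : ℕ) = 2 * n by omega,
      σ.isDyckHeight.eq_zero _ le_rfl]; exact σ.isDyckHeight.nonneg _)
  refine ⟨σ.label ⟨k - 1, by omega⟩, ?_⟩
  rw [mem_chords_iff_pos, pos_label]
  refine ⟨by dsimp only; omega, fun j hj1 hj2 => h4 j (by omega) (by dsimp only at hj2; omega), ?_⟩
  dsimp only
  rw [show k - 1 + 1 = k by omega, h3]

theorem exists_chord_of_notMem {σ : CyclicDyckPath n} {y : Fin (2 * n)} (hy : y ∉ σ.upLabels) :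
    ∃ x, (x, y) ∈ σ.chords := by
  rw [mem_upLabels] at hy
  have hlt := (σ.pos y).2
  have hst := σ.isDyckHeight.step _ hlt
  obtain ⟨k, h1, h2, h3, h4⟩ := exists_last_visit (s := σ.height) (i := 0)
    (σ.pos y) (fun j _ hj => σ.isDyckHeight.step j (by omega))
    (c := σ.height (σ.pos y + 1)) (by rw [σ.isDyckHeight.zero]; exact σ.isDyckHeight.nonneg _)
    (by rw [zero_add]; omega)
  refine ⟨σ.label ⟨k, by omega⟩, ?_⟩
  rw [mem_chords_iff_pos, pos_label]
  refine ⟨by dsimp only; omega, fun j hj1 hj2 => ?_, h3.symm⟩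
  rw [h3]
  exact h4 j hj1 (by omega)

theorem chords_right_unique {σ : CyclicDyckPath n} {x y y' : Fin (2 * n)} (h : (x, y) ∈ σ.chords)
    (h' : (x, y') ∈ σ.chords) : y = y' := by
  rw [mem_chords_iff_pos] at h h'
  exact σ.labelEquiv.symm.injective (Fin.ext (h.right_unique h'))

theorem chords_left_unique {σ : CyclicDyckPath n} {x x' y : Fin (2 * n)} (h : (x, y) ∈ σ.chords)
    (h' : (x', y) ∈ σ.chords) : x = x' := by
  rw [mem_chords_iff_pos] at h h'
  exact σ.labelEquiv.symm.injective (Fin.ext (h.left_unique h'))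

theorem chords_fst_injOn (σ : CyclicDyckPath n) :
    Set.InjOn (Prod.fst : Fin (2 * n) × Fin (2 * n) → _) σ.chords := by
  rintro ⟨x, y⟩ h ⟨x', y'⟩ h' rfl
  exact Prod.ext rfl (chords_right_unique h h')

theorem chords_snd_injOn (σ : CyclicDyckPath n) :
    Set.InjOn (Prod.snd : Fin (2 * n) × Fin (2 * n) → _) σ.chords := by
  rintro ⟨x, y⟩ h ⟨x', y'⟩ h' rfl
  exact Prod.ext (chords_left_unique h h') rfl

open Classical in
theorem image_fst_chords (σ : CyclicDyckPath n) : σ.chords.image Prod.fst = σ.upLabels := by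
  ext x
  rw [Finset.mem_image]
  constructor
  · rintro ⟨c, hc, rfl⟩; exact (upLabels_of_mem_chords hc).1
  · intro h
    obtain ⟨y, hy⟩ := exists_chord_of_mem h
    exact ⟨_, hy, rfl⟩

open Classical in
theorem image_snd_chords (σ : CyclicDyckPath n) : σ.chords.image Prod.snd = σ.upLabelsᶜ := by
  ext x
  rw [Finset.mem_image, Finset.mem_compl]
  constructor
  · rintro ⟨c, hc, rfl⟩; exact (upLabels_of_mem_chords hc).2
  · intro h
    obtain ⟨y, hy⟩ := exists_chord_of_notMem h
    exact ⟨_, hy, rfl⟩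

theorem prod_chords_fst {M : Type*} [CommMonoid M] (σ : CyclicDyckPath n) (f : Fin (2 * n) → M) :
    ∏ c ∈ σ.chords, f c.1 = ∏ x ∈ σ.upLabels, f x := by
  classical
  rw [← image_fst_chords, Finset.prod_image σ.chords_fst_injOn]

theorem sum_chords_fst {M : Type*} [AddCommMonoid M] (σ : CyclicDyckPath n) (f : Fin (2 * n) → M) :
    ∑ c ∈ σ.chords, f c.1 = ∑ x ∈ σ.upLabels, f x := by
  classical
  rw [← image_fst_chords, Finset.sum_image σ.chords_fst_injOn]

theorem sum_chords_snd {M : Type*} [AddCommMonoid M] (σ : CyclicDyckPath n) (f : Fin (2 * n) → M) :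
    ∑ c ∈ σ.chords, f c.2 = ∑ x ∈ σ.upLabelsᶜ, f x := by
  classical
  rw [← image_snd_chords, Finset.sum_image σ.chords_snd_injOn]

theorem card_chords (σ : CyclicDyckPath n) : σ.chords.card = n := by
  refine Eq.trans ?_ σ.card_upLabels
  classical
  rw [← image_fst_chords, Finset.card_image_of_injOn σ.chords_fst_injOn]

theorem chords_eq_iff {σ τ : CyclicDyckPath n} : σ.chords = τ.chords ↔ σ.upLabels = τ.upLabels := by
  constructor
  · intro h
    rw [← image_fst_chords, ← image_fst_chords, h]
  · intro h
    ext ⟨x, y⟩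
    rw [mem_chords_iff, mem_chords_iff, h]

theorem equiv_iff {σ τ : CyclicDyckPath n} : σ ≈ τ ↔ σ.upLabels = τ.upLabels := chords_eq_iff

theorem eq_of_upLabels_eq {σ τ : CyclicDyckPath n} (h : σ.first = τ.first)
    (h' : σ.upLabels = τ.upLabels) : σ = τ :=
  ext_of_height h fun j hj => by rw [σ.height_eq hj, τ.height_eq hj, h, h']

/-- A cyclic Dyck path is given by its up labels and a first step from which heights are
nonnegative. -/
theorem exists_of_upLabels {U : Finset (Fin (2 * n))} (hU : U.card = n) (l : Fin (2 * n))
    (h : ∀ k ≤ 2 * n, labelHeight U l ≤ labelHeight U (l + k)) :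
    ∃ σ : CyclicDyckPath n, σ.first = l ∧ σ.upLabels = U := by
  have hh : IsDyckHeight n fun k => if k ≤ 2 * n then labelHeight U (l + k) - labelHeight U l
      else 0 := by
    refine ⟨by simp, fun j hj => ?_, fun j => ?_, fun j hj => ?_⟩
    · have := labelHeight_step U (l + j)
      simp only [show j + 1 ≤ 2 * n by omega, show j ≤ 2 * n by omega, if_true, ← add_assoc]
      omega
    · split_ifs with hj
      · have := h j hj; omega
      · exact le_rfl
    · split_ifs with hj'
      · obtain rfl : j = 2 * n := by omega
        rw [labelHeight_add_period hU]; ring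
      · rfl
  obtain ⟨σ, hσ, hσ'⟩ := exists_of_isDyckHeight hh l
  refine ⟨σ, hσ, ?_⟩
  ext x
  have hx := (σ.pos x).2
  have hmod := σ.first_add_pos_mod x
  rw [mem_upLabels, hσ', hσ] at *
  simp only [show (σ.pos x : ℕ) + 1 ≤ 2 * n by omega, show (σ.pos x : ℕ) ≤ 2 * n by omega, if_true,
    ← add_assoc, labelHeight_succ]
  by_cases hxU : x ∈ U
  · simp only [labelStep_of_mem hmod hxU, hxU, iff_true]; ring
  · simp only [labelStep_of_notMem hmod hxU, hxU, iff_false]; omega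

theorem exists_upLabels_eq {U : Finset (Fin (2 * n))} (hU : U.card = n) (hn : 1 ≤ n) :
    ∃ σ : CyclicDyckPath n, σ.upLabels = U := by
  have : Nonempty (Fin (2 * n)) := ⟨⟨0, by omega⟩⟩
  obtain ⟨l, -, hl⟩ := Finset.exists_min_image Finset.univ
    (fun l : Fin (2 * n) => labelHeight U l) Finset.univ_nonempty
  obtain ⟨σ, -, hσ⟩ := exists_of_upLabels hU l fun k hk => by
    by_cases hlt : l.val + k < 2 * n
    · exact hl ⟨l + k, hlt⟩ (Finset.mem_univ _)
    · by_cases hlt' : l.val + k - 2 * n < 2 * n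
      · have := hl ⟨l + k - 2 * n, hlt'⟩ (Finset.mem_univ _)
        have h2 := labelHeight_add_period hU (l + k - 2 * n)
        rw [show l.val + k - 2 * n + 2 * n = l + k by omega] at h2
        rw [h2]; exact this
      · have := l.2; omega
  exact ⟨σ, hσ⟩

end CyclicDyckPath

end

section
variable {n : ℕ}

theorem neg_one_zpow_congr {a b : ℤ} (h : Even (a - b)) : (-1 : ℂ) ^ a = (-1) ^ b := by
  rw [show a = (a - b) + b by ring, zpow_add₀ (by norm_num), h.neg_one_zpow, one_mul]

theorem zpow_sum_eq_prod {ι : Type*} {w : ℂ} (hw : w ≠ 0) (s : Finset ι) (f : ι → ℤ) :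
    w ^ (∑ i ∈ s, f i) = ∏ i ∈ s, w ^ f i := by
  classical
  induction s using Finset.induction_on with
  | empty => simp
  | insert a s ha ih => rw [Finset.sum_insert ha, Finset.prod_insert ha, zpow_add₀ hw, ih]

namespace CyclicDyckPath

theorem pos_lt_pos_of_mem_chords {σ : CyclicDyckPath n} {c : Fin (2 * n) × Fin (2 * n)}
    (hc : c ∈ σ.chords) : (σ.pos c.1 : ℕ) < σ.pos c.2 :=
  ((σ.mem_chords_iff_pos c.1 c.2).1 hc).lt

open Classical in
theorem height_eq_sum_chords (σ : CyclicDyckPath n) {p : ℕ} (hp : p ≤ 2 * n) :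
    σ.height p = ∑ c ∈ σ.chords,
      ((if (σ.pos c.1 : ℕ) < p then 1 else 0) - (if (σ.pos c.2 : ℕ) < p then 1 else 0) : ℤ) := by
  have h1 : σ.height p = ∑ j ∈ Finset.range p, labelStep σ.upLabels (σ.first + j) := by
    induction p with
    | zero => simp [σ.isDyckHeight.zero]
    | succ p ih => rw [σ.height_succ (by omega), Finset.sum_range_succ, ih (by omega)]
  have h2 : ∑ j ∈ Finset.range p, labelStep σ.upLabels (σ.first + j) =
      ∑ j ∈ Finset.range (2 * n), if j < p then labelStep σ.upLabels (σ.first + j) else 0 := by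
    rw [← Finset.sum_filter]
    congr 1
    ext j
    simp only [Finset.mem_range, Finset.mem_filter]
    omega
  rw [h1, h2, Finset.sum_range, ← σ.labelEquiv.symm.sum_comp]
  rw [Finset.sum_sub_distrib, σ.sum_chords_fst (fun x => if (σ.pos x : ℕ) < p then (1 : ℤ) else 0),
    σ.sum_chords_snd (fun x => if (σ.pos x : ℕ) < p then (1 : ℤ) else 0), sub_eq_add_neg,
    ← Finset.sum_neg_distrib, ← Finset.sum_add_sum_compl σ.upLabels]
  congr 1 <;> refine Finset.sum_congr rfl fun x hx => ?_
  · rw [show σ.labelEquiv.symm x = σ.pos x from rfl, labelStep_of_mem (σ.first_add_pos_mod x) hx]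
  · rw [show σ.labelEquiv.symm x = σ.pos x from rfl,
      labelStep_of_notMem (σ.first_add_pos_mod x) (Finset.mem_compl.1 hx)]
    split_ifs <;> rfl

theorem pos_sub_pos {σ : CyclicDyckPath n} {c : Fin (2 * n) × Fin (2 * n)} (hc : c ∈ σ.chords) :
    (σ.pos c.2 : ℤ) - σ.pos c.1 = c.2 - c.1 + 2 * n * if c.2 < c.1 then 1 else 0 := by
  have h := pos_lt_pos_of_mem_chords hc
  have h1 := σ.pos_val_ite c.1
  have h2 := σ.pos_val_ite c.2
  have := σ.first.2; have := c.1.2; have := c.2.2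
  simp only [Fin.le_def, Fin.lt_def] at *
  split_ifs at * <;> omega

theorem left_sub_left (σ : CyclicDyckPath n) {x y : Fin (2 * n)} (hne : x ≠ y) :
    ((if (σ.pos x : ℕ) < σ.posOne then 1 else 0) - (if y < x then 1 else 0) : ℤ) =
      (if (σ.pos y : ℕ) < σ.posOne then 1 else 0) - if σ.pos y < σ.pos x then 1 else 0 := by
  have h1 := σ.pos_val_ite x
  have h2 := σ.pos_val_ite y
  have h3 := σ.posOne_ite
  have hne' : x.val ≠ y.val := fun h => hne (Fin.ext h)
  have := σ.first.2; have := x.2; have := y.2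
  simp only [Fin.le_def, Fin.lt_def] at *
  by_cases e0 : σ.first.val = 0 <;> by_cases e1 : σ.first.val ≤ x.val <;>
    by_cases e2 : σ.first.val ≤ y.val <;> simp only [e0, e1, e2, if_true, if_false] at h1 h2 h3 <;>
    rw [h1, h2, h3] <;> split_ifs <;> omega

open Classical in
theorem winding_eq (σ : CyclicDyckPath n) :
    σ.winding = ∑ c ∈ σ.chords, if c.2 < c.1 then (1 : ℤ) else 0 := by
  unfold winding
  rw [σ.height_eq_sum_chords (by rw [posOne_ite]; split_ifs <;> omega)]
  refine Finset.sum_congr rfl fun c hc => ?_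
  have h := pos_lt_pos_of_mem_chords hc
  have hne : c.1 ≠ c.2 := fun hh => by rw [hh] at h; omega
  have h2 := σ.left_sub_left hne
  rw [if_neg (c := σ.pos c.2 < σ.pos c.1) (by rw [Fin.lt_def]; omega)] at h2
  omega

theorem sum_indicator_lt {a N : ℕ} (ha : a < N) :
    ∑ p ∈ Finset.range (N + 1), (if a < p then 1 else 0 : ℤ) = N - a := by
  rw [Finset.sum_boole]
  have : (Finset.range (N + 1)).filter (fun p => a < p) = Finset.Ioc a N := by
    ext p; simp only [Finset.mem_filter, Finset.mem_range, Finset.mem_Ioc]; omega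
  rw [this, Nat.card_Ioc]
  omega

theorem area_eq (σ : CyclicDyckPath n) :
    σ.area = n * (2 * n - 1) - 2 * ∑ x ∈ σ.upLabels, (x : ℤ) + 2 * n * σ.winding := by
  classical
  have h1 : σ.area = ∑ c ∈ σ.chords, ((σ.pos c.2 : ℤ) - σ.pos c.1) := by
    unfold area
    rw [Finset.sum_congr rfl fun j hj => σ.height_eq_sum_chords
      (by have := Finset.mem_range.1 hj; omega), Finset.sum_comm]
    refine Finset.sum_congr rfl fun c _ => ?_
    rw [Finset.sum_sub_distrib, sum_indicator_lt (σ.pos c.1).2, sum_indicator_lt (σ.pos c.2).2]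
    ring
  rw [h1, Finset.sum_congr rfl fun c hc => pos_sub_pos hc, Finset.sum_add_distrib,
    Finset.sum_sub_distrib, ← Finset.mul_sum, ← winding_eq,
    σ.sum_chords_fst (fun x => ((x : ℕ) : ℤ)), σ.sum_chords_snd (fun x => ((x : ℕ) : ℤ))]
  have h2 : ∑ x ∈ σ.upLabels, ((x : ℕ) : ℤ) + ∑ x ∈ σ.upLabelsᶜ, ((x : ℕ) : ℤ) = n * (2 * n - 1) := by
    rw [Finset.sum_add_sum_compl, Fin.sum_univ_eq_sum_range (fun i => (i : ℤ))]
    have h3 := Finset.sum_range_id_mul_two (2 * n)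
    have hn := σ.two_mul_pos
    zify at h3
    rw [Nat.cast_sub (by omega)] at h3
    push_cast at h3
    linarith
  linarith

/-- The number of wrapped chords and the up labels determine the sign of `entryA`. -/
theorem neg_one_zpow_area (σ : CyclicDyckPath n) :
    (-1 : ℂ) ^ ((σ.area - n) / 2 + (n + 1) * σ.winding) =
      (-1) ^ (∑ x ∈ σ.upLabels, (x : ℤ) + σ.winding) := by
  apply neg_one_zpow_congr
  have : (σ.area - n) / 2 = n * (n - 1) - ∑ x ∈ σ.upLabels, (x : ℤ) + n * σ.winding := by
    rw [area_eq]
    apply Int.ediv_eq_of_eq_mul_left (by norm_num)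
    ring
  rw [this]
  obtain ⟨c, hc⟩ := Int.even_mul_pred_self (n : ℤ)
  exact ⟨c - ∑ x ∈ σ.upLabels, (x : ℤ) + n * σ.winding, by linarith⟩

open Classical in
theorem entryA_eq (w : ℂ) (R : HalfSubset n) (σ : CyclicDyckPath n) :
    entryA w R σ = if MeetsEachChordOnce R.1 σ then
      (-1) ^ (∑ x ∈ σ.upLabels, (x : ℤ) + σ.winding) * w ^ (σ.winding - wrappedCount R.1 σ)
    else 0 := by
  unfold entryA
  rw [neg_one_zpow_area]

theorem winding_congr {σ τ : CyclicDyckPath n} (h : σ ≈ τ) : σ.winding = τ.winding := by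
  classical
  rw [winding_eq, winding_eq, show σ.chords = τ.chords from h]

theorem entryA_congr (w : ℂ) (R : HalfSubset n) {σ τ : CyclicDyckPath n} (h : σ ≈ τ) :
    entryA w R σ = entryA w R τ := by
  classical
  have hc : σ.chords = τ.chords := h
  rw [entryA_eq, entryA_eq, winding_congr h, equiv_iff.1 h]
  unfold MeetsEachChordOnce wrappedCount
  rw [hc]

/-! ## Sums over the subsets meeting each chord once -/

open Classical in
theorem sum_meetsEachChordOnce (τ : CyclicDyckPath n) (f : Fin (2 * n) → ℂ) :
    ∑ R : HalfSubset n, (if MeetsEachChordOnce R.1 τ then ∏ r ∈ R.1, f r else 0) =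
      ∏ c ∈ τ.chords, (f c.1 + f c.2) := by
  rw [Finset.prod_add, ← Finset.sum_filter]
  have hfst : ∀ T ⊆ τ.chords, ∀ c ∈ τ.chords, c.1 ∈ T.image Prod.fst ↔ c ∈ T := by
    intro T hT c hc
    rw [Finset.mem_image]
    exact ⟨fun ⟨c', h1, h2⟩ => τ.chords_fst_injOn (hT h1) hc h2 ▸ h1, fun h => ⟨c, h, rfl⟩⟩
  have hsnd : ∀ T ⊆ τ.chords, ∀ c ∈ τ.chords, c.2 ∈ T.image Prod.snd ↔ c ∈ T := by
    intro T hT c hc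
    rw [Finset.mem_image]
    exact ⟨fun ⟨c', h1, h2⟩ => τ.chords_snd_injOn (hT h1) hc h2 ▸ h1, fun h => ⟨c, h, rfl⟩⟩
  have hfs : ∀ T ⊆ τ.chords, ∀ c ∈ τ.chords, c.1 ∉ T.image Prod.snd := by
    intro T hT c hc h
    obtain ⟨c', h1, h2⟩ := Finset.mem_image.1 h
    exact (upLabels_of_mem_chords (hT h1)).2 (h2 ▸ (upLabels_of_mem_chords hc).1)
  have hsf : ∀ T ⊆ τ.chords, ∀ c ∈ τ.chords, c.2 ∉ T.image Prod.fst := by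
    intro T hT c hc h
    obtain ⟨c', h1, h2⟩ := Finset.mem_image.1 h
    exact (upLabels_of_mem_chords hc).2 (h2 ▸ (upLabels_of_mem_chords (hT h1)).1)
  have hdis : ∀ T ⊆ τ.chords, Disjoint (T.image Prod.fst) ((τ.chords \ T).image Prod.snd) := by
    intro T hT
    rw [Finset.disjoint_left]
    intro x h1 h2
    obtain ⟨c, hc, rfl⟩ := Finset.mem_image.1 h1
    exact hfs _ Finset.sdiff_subset c (hT hc) h2
  have hcard : ∀ T ⊆ τ.chords, (T.image Prod.fst ∪ (τ.chords \ T).image Prod.snd).card = n := by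
    intro T hT
    rw [Finset.card_union_of_disjoint (hdis T hT),
      Finset.card_image_of_injOn (τ.chords_fst_injOn.mono (by exact_mod_cast hT)),
      Finset.card_image_of_injOn (τ.chords_snd_injOn.mono (by exact_mod_cast Finset.sdiff_subset)),
      add_comm, Finset.card_sdiff_add_card_eq_card hT, card_chords]
  have hright : ∀ R : HalfSubset n, MeetsEachChordOnce R.1 τ →
      (τ.chords.filter fun c => c.1 ∈ R.1).image Prod.fst ∪
        (τ.chords \ τ.chords.filter fun c => c.1 ∈ R.1).image Prod.snd = R.1 := by
    intro R hR
    ext x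
    rw [Finset.mem_union]
    by_cases hx : x ∈ τ.upLabels
    · obtain ⟨y, hy⟩ := exists_chord_of_mem hx
      rw [hfst _ (Finset.filter_subset _ _) (x, y) hy, Finset.mem_filter,
        or_iff_left (hfs _ Finset.sdiff_subset (x, y) hy)]
      exact and_iff_right hy
    · obtain ⟨y, hy⟩ := exists_chord_of_notMem hx
      rw [hsnd _ Finset.sdiff_subset (y, x) hy, or_iff_right (hsf _ (Finset.filter_subset _ _) (y, x) hy),
        Finset.mem_sdiff, Finset.mem_filter]
      have := hR (y, x) hy
      simp only [Xor] at this
      tauto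
  refine Finset.sum_bij' (fun R _ => τ.chords.filter fun c => c.1 ∈ R.1)
    (fun T hT => ⟨T.image Prod.fst ∪ (τ.chords \ T).image Prod.snd, hcard T (Finset.mem_powerset.1 hT)⟩)
    ?_ ?_ ?_ ?_ ?_
  · intro R _
    exact Finset.mem_powerset.2 (Finset.filter_subset _ _)
  · intro T hT
    have hT := Finset.mem_powerset.1 hT
    rw [Finset.mem_filter]
    refine ⟨Finset.mem_univ _, fun c hc => ?_⟩
    dsimp only
    rw [Finset.mem_union, Finset.mem_union, hfst T hT c hc, hsnd _ Finset.sdiff_subset c hc,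
      or_iff_left (hfs _ Finset.sdiff_subset c hc), or_iff_right (hsf T hT c hc), Finset.mem_sdiff]
    simp only [Xor]
    tauto
  · intro R hR
    exact Subtype.ext (hright R (Finset.mem_filter.1 hR).2)
  · intro T hT
    have hT := Finset.mem_powerset.1 hT
    ext c
    rw [Finset.mem_filter]
    dsimp only
    constructor
    · rintro ⟨hc, h⟩
      rwa [Finset.mem_union, hfst T hT c hc, or_iff_left (hfs _ Finset.sdiff_subset c hc)] at h
    · intro h
      exact ⟨hT h, Finset.mem_union_left _ (Finset.mem_image_of_mem _ h)⟩
  · intro R hR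
    conv_lhs => rw [← hright R (Finset.mem_filter.1 hR).2]
    rw [Finset.prod_union (hdis _ (Finset.filter_subset _ _)),
      Finset.prod_image (τ.chords_fst_injOn.mono (by exact_mod_cast Finset.filter_subset _ _)),
      Finset.prod_image (τ.chords_snd_injOn.mono (by exact_mod_cast Finset.sdiff_subset))]

/-! ## Counting steps by their labels -/

open Classical in
theorem card_filter_label (σ : CyclicDyckPath n) (p : Fin (2 * n) → Prop) (R : Finset (Fin (2 * n))) :
    (Finset.univ.filter fun j => p j ∧ σ.label j ∈ R).card = (R.filter fun x => p (σ.pos x)).card := by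
  refine Finset.card_nbij' σ.label σ.pos ?_ ?_ ?_ ?_
  · intro j hj
    simp only [Finset.coe_filter, Finset.mem_univ, true_and, Set.mem_ofPred_eq] at hj ⊢
    rw [pos_label]; exact ⟨hj.2, hj.1⟩
  · intro x hx
    simp only [Finset.coe_filter, Finset.mem_univ, true_and, Set.mem_ofPred_eq] at hx ⊢
    rw [label_pos]; exact ⟨hx.2, hx.1⟩
  · intro j _; exact σ.pos_label j
  · intro x _; exact σ.label_pos x

open Classical in
theorem upCount_eq (R : Finset (Fin (2 * n))) (σ : CyclicDyckPath n) :
    (upCount R σ : ℤ) = ∑ x ∈ R, if x ∈ σ.upLabels then 1 else 0 := by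
  rw [Finset.sum_boole]
  unfold upCount
  rw [σ.card_filter_label (fun j => σ.IsUp j)]
  simp [upLabels]

open Classical in
theorem leftCount_eq (R : Finset (Fin (2 * n))) (σ : CyclicDyckPath n) :
    (leftCount R σ : ℤ) = ∑ x ∈ R, if (σ.pos x : ℕ) < σ.posOne then 1 else 0 := by
  rw [Finset.sum_boole]
  unfold leftCount
  refine congrArg Nat.cast (Eq.trans ?_ ((σ.card_filter_label (fun j => (j : ℕ) < σ.posOne) R).trans ?_))
    <;> congr

open Classical in
theorem leftDownCount_eq (σ : CyclicDyckPath n) :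
    (leftDownCount σ : ℤ) = ∑ c ∈ σ.chords, if (σ.pos c.2 : ℕ) < σ.posOne then 1 else 0 := by
  rw [σ.sum_chords_snd fun x => if (σ.pos x : ℕ) < σ.posOne then (1 : ℤ) else 0, ← leftCount_eq]
  unfold leftDownCount leftCount
  congr 2
  ext j
  simp [upLabels, pos_label]

open Classical in
theorem wrappedCount_eq (R : Finset (Fin (2 * n))) (σ : CyclicDyckPath n) :
    (wrappedCount R σ : ℤ) = ∑ x ∈ R, if ∃ y, (x, y) ∈ σ.chords ∧ y < x then 1 else 0 := by
  rw [Finset.sum_boole]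
  unfold wrappedCount
  congr 1
  refine Finset.card_bij (fun c _ => c.1) ?_ ?_ ?_
  · intro c hc
    rw [Finset.mem_filter] at hc ⊢
    exact ⟨hc.2.2, c.2, hc.1, hc.2.1⟩
  · intro c hc c' hc' h
    exact σ.chords_fst_injOn (Finset.mem_filter.1 hc).1 (Finset.mem_filter.1 hc').1 h
  · intro x hx
    obtain ⟨hx, y, hy, hlt⟩ := Finset.mem_filter.1 hx
    exact ⟨(x, y), Finset.mem_filter.2 ⟨hy, hlt, hx⟩, rfl⟩

end CyclicDyckPath

end

section
variable {n : ℕ}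

theorem eq_of_arcs_opposite {g m : ℕ → ℤ} {N : ℕ}
    (hg : ∀ j < N, g (j + 1) = g j + 1 ∨ g (j + 1) = g j - 1)
    (hm : ∀ j < N, m (j + 1) = m j + 1 ∨ m (j + 1) = m j - 1)
    (harc : ∀ i j, IsArc g i j → j < N → (m (i + 1) = m i + 1 ↔ ¬ m (j + 1) = m j + 1))
    (i k : ℕ) (hik : i ≤ k) (hk : k ≤ N) (h : g i = g k) (hge : ∀ j, i ≤ j → j ≤ k → g i ≤ g j) :
    m i = m k := by
  obtain ⟨d, hd⟩ : ∃ d, k - i = d := ⟨_, rfl⟩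
  induction d using Nat.strong_induction_on generalizing i k with
  | _ d ih =>
    rcases eq_or_lt_of_le hik with rfl | hlt
    · rfl
    have hup : g (i + 1) = g i + 1 := by
      have := hg i (by omega); have := hge (i + 1) (by omega) (by omega); omega
    obtain ⟨q, h1, h2, h3, h4⟩ := exists_first_visit (s := g) (i := i + 1) (k - (i + 1))
      (fun j _ hj => hg j (by omega)) (c := g i) (by omega)
      (by rw [show i + 1 + (k - (i + 1)) = k by omega, h])
    have hq := hg (q - 1) (by omega)
    have hq' := hm (q - 1) (by omega)
    have hi' := hm i (by omega)
    rw [show q - 1 + 1 = q by omega] at hq hq'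
    have h5 := h4 (q - 1) (by omega) (by omega)
    have harc' := harc i (q - 1) ⟨by omega, fun j hj1 hj2 => h4 j (by omega) (by omega),
      by rw [show q - 1 + 1 = q by omega, h3]⟩ (by omega)
    rw [show q - 1 + 1 = q by omega] at harc'
    have e1 := ih (q - 1 - (i + 1)) (by omega) (i + 1) (q - 1) (by omega) (by omega) (by omega)
      (fun j hj1 hj2 => by have := h4 j hj1 (by omega); omega) rfl
    have e2 := ih (k - q) (by omega) q k (by omega) hk (by omega)
      (fun j hj1 hj2 => by have := hge j (by omega) hj2; omega) rfl
    omega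

theorem Refines.opposite {m s : ℕ → ℤ} (hm : IsDyckHeight n m) (hs : IsDyckHeight n s)
    (h : Refines n m s) {i j : ℕ} (harc : IsArc s i j) (hj : j < 2 * n) :
    m (i + 1) = m i + 1 ↔ ¬ m (j + 1) = m j + 1 := by
  have hlt := harc.lt
  have h1 := harc.gt (i + 1) (by omega) (by omega)
  have h2 := harc.gt j (by omega) (by omega)
  have h3 := harc.eq
  have h4 := hs.step i (by omega)
  have h5 := hs.step j hj
  have e1 := h i (j + 1) (by omega) (by omega) h3.symm fun k hk1 hk2 => by
    by_cases e : k = i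
    · rw [e]
    by_cases e' : k = j + 1
    · rw [e', h3]
    exact (harc.gt k (by omega) (by omega)).le
  have e2 := h (i + 1) j (by omega) (by omega) (by omega) fun k hk1 hk2 => by
    have := harc.gt k (by omega) hk2; omega
  have h6 := hm.step i (by omega)
  have h7 := hm.step j hj
  omega

namespace CyclicDyckPath

theorem pos_congr {σ τ : CyclicDyckPath n} (h : σ.first = τ.first) (x : Fin (2 * n)) :
    σ.pos x = τ.pos x := by
  apply Fin.ext
  rw [pos_val_ite, pos_val_ite, h]

theorem isArc_of_mem_chords {σ : CyclicDyckPath n} {c : Fin (2 * n) × Fin (2 * n)}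
    (h : c ∈ σ.chords) : IsArc σ.height (σ.pos c.1) (σ.pos c.2) :=
  (σ.mem_chords_iff_pos c.1 c.2).1 h

theorem odd_snd_sub_fst {σ : CyclicDyckPath n} {c : Fin (2 * n) × Fin (2 * n)}
    (h : c ∈ σ.chords) : Odd ((c.2 : ℤ) - c.1) := by
  have harc := isArc_of_mem_chords h
  have hpar : ∀ k, σ.pos c.1 + k ≤ 2 * n → Even (σ.height (σ.pos c.1 + k) - σ.height (σ.pos c.1) - k) := by
    intro k
    induction k with
    | zero => intro _; simp
    | succ k ih =>
      intro hk
      obtain ⟨a, ha⟩ := ih (by omega)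
      rcases σ.isDyckHeight.step (σ.pos c.1 + k) (by omega) with h | h
      · exact ⟨a, by rw [← add_assoc, h]; push_cast; linarith⟩
      · exact ⟨a - 1, by rw [← add_assoc, h]; push_cast; linarith⟩
  have hlt := harc.lt
  have h1 := hpar (σ.pos c.2 + 1 - σ.pos c.1) (by have := (σ.pos c.2).2; omega)
  rw [show (σ.pos c.1 + (σ.pos c.2 + 1 - σ.pos c.1) : ℕ) = σ.pos c.2 + 1 by omega, harc.eq] at h1
  obtain ⟨a, ha⟩ := h1
  have h2 := pos_sub_pos h
  rw [Nat.cast_sub (by omega)] at ha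
  push_cast at ha
  split_ifs at h2
  · exact ⟨-a - n - 1, by linarith⟩
  · exact ⟨-a - 1, by linarith⟩

open Classical in
/-- The contribution of a chord to a coefficient of `B A`, up to a monomial. -/
def chordFactor (w : ℂ) (σ μ : CyclicDyckPath n) (c : Fin (2 * n) × Fin (2 * n)) : ℂ :=
  w ^ (-(if c.1 ∈ μ.upLabels then 1 else 0) - (if σ.pos c.2 < σ.pos c.1 then 1 else 0) : ℤ) -
    w ^ (-(if c.2 ∈ μ.upLabels then 1 else 0) : ℤ)

open Classical in
theorem sum_entryB_mul_entryA (w : ℂ) (hw : w ≠ 0) (σ τ : CyclicDyckPath n) :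
    ∑ R : HalfSubset n, entryB w σ R * entryA w R τ =
      (-1) ^ (σ.winding + τ.winding) *
      w ^ ((n : ℤ) - σ.winding - leftDownCount σ + τ.winding +
        ∑ c ∈ τ.chords, if (σ.pos c.2 : ℕ) < σ.posOne then 1 else 0) *
      ∑ μ : CyclicDyckPath n with μ.Dominates σ, (ci σ μ : ℂ) *
        ∏ c ∈ τ.chords, chordFactor w σ μ c := by
  let f : CyclicDyckPath n → Fin (2 * n) → ℂ := fun μ r => (-1) ^ ((r : ℤ) + 1) *
    w ^ (-(if r ∈ μ.upLabels then 1 else 0) + (if (σ.pos r : ℕ) < σ.posOne then 1 else 0) -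
      (if ∃ y, (r, y) ∈ τ.chords ∧ y < r then 1 else 0) : ℤ)
  have hterm : ∀ R : HalfSubset n, entryB w σ R * entryA w R τ =
      ∑ μ : CyclicDyckPath n with μ.Dominates σ, ((-1) ^ (σ.winding + n) *
        (-1) ^ (∑ x ∈ τ.upLabels, (x : ℤ) + τ.winding) *
        w ^ ((n : ℤ) - σ.winding - leftDownCount σ + τ.winding)) * (ci σ μ : ℂ) *
        (if MeetsEachChordOnce R.1 τ then ∏ r ∈ R.1, f μ r else 0) := by
    intro R
    rw [entryA_eq]
    unfold entryB
    by_cases h : MeetsEachChordOnce R.1 τ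
    · simp only [if_pos h]
      rw [Finset.mul_sum, Finset.sum_mul]
      refine Finset.sum_congr rfl fun μ _ => ?_
      have hf : ∏ r ∈ R.1, f μ r = (-1) ^ (∑ r ∈ R.1, ((r : ℤ) + 1)) *
          w ^ (-(upCount R.1 μ : ℤ) + leftCount R.1 σ - wrappedCount R.1 τ) := by
        rw [Finset.prod_mul_distrib, ← zpow_sum_eq_prod (by norm_num), ← zpow_sum_eq_prod hw,
          upCount_eq, leftCount_eq, wrappedCount_eq, ← Finset.sum_neg_distrib,
          ← Finset.sum_add_distrib, ← Finset.sum_sub_distrib]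
      rw [hf, show ((∑ r ∈ R.1, ((r : ℤ) + 1)) + σ.winding + n) =
          (∑ r ∈ R.1, ((r : ℤ) + 1)) + (σ.winding + n) by ring, zpow_add₀ (by norm_num : (-1 : ℂ) ≠ 0),
        show (n : ℤ) - σ.winding - upCount R.1 μ + leftCount R.1 σ - leftDownCount σ =
          ((n : ℤ) - σ.winding - leftDownCount σ) + (-(upCount R.1 μ : ℤ) + leftCount R.1 σ) by ring,
        zpow_add₀ hw, zpow_sub₀ hw τ.winding, zpow_add₀ hw (_ - _) τ.winding, zpow_sub₀ hw (_ + _) _]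
      ring
    · simp [if_neg h]
  have hfac : ∀ μ : CyclicDyckPath n, ∀ c ∈ τ.chords, f μ c.1 + f μ c.2 =
      (-1) ^ ((c.1 : ℤ) + 1) * w ^ (if (σ.pos c.2 : ℕ) < σ.posOne then 1 else 0 : ℤ) *
        chordFactor w σ μ c := by
    intro μ c hc
    have hne : c.1 ≠ c.2 := fun h => by
      have := pos_lt_pos_of_mem_chords hc; rw [h] at this; omega
    have h1 : (∃ y, (c.1, y) ∈ τ.chords ∧ y < c.1) ↔ c.2 < c.1 :=
      ⟨fun ⟨y, hy, hlt⟩ => by rwa [chords_right_unique hc hy], fun h => ⟨c.2, hc, h⟩⟩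
    have h2 : ¬ ∃ y, (c.2, y) ∈ τ.chords ∧ y < c.2 := fun ⟨y, hy, _⟩ =>
      (upLabels_of_mem_chords hc).2 (upLabels_of_mem_chords hy).1
    have h3 := σ.left_sub_left hne
    obtain ⟨a, ha⟩ := odd_snd_sub_fst hc
    have h4 : (-1 : ℂ) ^ ((c.2 : ℤ) + 1) = - (-1) ^ ((c.1 : ℤ) + 1) := by
      rw [show (c.2 : ℤ) + 1 = (c.1 + 1) + (2 * a + 1) by linarith, zpow_add₀ (by norm_num),
        Odd.neg_one_zpow ⟨a, rfl⟩]
      ring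
    simp only [f, h1, h2, h4, if_false, chordFactor]
    rw [mul_sub, mul_assoc, mul_assoc, ← zpow_add₀ hw, ← zpow_add₀ hw, add_sub_assoc, h3, sub_zero,
      neg_mul, ← sub_eq_add_neg]
    congr 3 <;> ring
  simp only [hterm]
  rw [Finset.sum_comm, Finset.mul_sum]
  refine Finset.sum_congr rfl fun μ _ => ?_
  rw [← Finset.mul_sum, sum_meetsEachChordOnce τ (f μ), Finset.prod_congr rfl (hfac μ),
    Finset.prod_mul_distrib, Finset.prod_mul_distrib, ← zpow_sum_eq_prod (by norm_num),
    ← zpow_sum_eq_prod hw, zpow_add₀ hw _ (∑ c ∈ τ.chords, _),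
    τ.sum_chords_fst (fun x => ((x : ℕ) : ℤ) + 1), Finset.sum_add_distrib, Finset.sum_const,
    card_upLabels]
  have hsgn : (-1 : ℂ) ^ (σ.winding + n) * (-1) ^ (∑ x ∈ τ.upLabels, ((x : ℕ) : ℤ) + τ.winding) *
      (-1) ^ (∑ x ∈ τ.upLabels, ((x : ℕ) : ℤ) + n • 1) = (-1) ^ (σ.winding + τ.winding) := by
    rw [← zpow_add₀ (by norm_num), ← zpow_add₀ (by norm_num)]
    apply neg_one_zpow_congr
    exact ⟨n + ∑ x ∈ τ.upLabels, ((x : ℕ) : ℤ), by simp; ring⟩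
  rw [← hsgn]
  ring

theorem flipSign_eq_prod (μ τ : CyclicDyckPath n) (h : μ.first = τ.first) :
    open Classical in
    flipSign n μ.height τ.height = ∏ x ∈ τ.upLabels, if x ∈ μ.upLabels then 1 else -1 := by
  classical
  unfold flipSign
  rw [Finset.prod_range, ← τ.labelEquiv.symm.prod_comp, ← Finset.prod_mul_prod_compl τ.upLabels]
  rw [Finset.prod_eq_one (s := τ.upLabelsᶜ), mul_one]
  · refine Finset.prod_congr rfl fun x hx => ?_
    rw [show τ.labelEquiv.symm x = τ.pos x from rfl]
    have hst := μ.isDyckHeight.step _ (τ.pos x).2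
    simp only [(τ.mem_upLabels x).1 hx, mem_upLabels, pos_congr h, true_and]
    split_ifs <;> omega
  · intro x hx
    rw [show τ.labelEquiv.symm x = τ.pos x from rfl]
    rw [Finset.mem_compl, mem_upLabels] at hx
    rw [if_neg fun h => hx h.1]

open Classical in
theorem prod_chordFactor (w : ℂ) {σ μ τ : CyclicDyckPath n} (h : μ.first = τ.first)
    (h' : σ.first = τ.first) : ∏ c ∈ τ.chords, chordFactor w σ μ c =
      if Refines n μ.height τ.height then (w⁻¹ - 1) ^ n * (flipSign n μ.height τ.height : ℂ) else 0 := by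
  have hlt : ∀ c ∈ τ.chords, ¬ σ.pos c.2 < σ.pos c.1 := by
    intro c hc
    have := pos_lt_pos_of_mem_chords hc
    rw [pos_congr h', pos_congr h', Fin.lt_def]
    omega
  split_ifs with href
  · rw [flipSign_eq_prod μ τ h, ← prod_chords_fst, Int.cast_prod]
    have hpow : (w⁻¹ - 1) ^ n = ∏ c ∈ τ.chords, (w⁻¹ - 1) := by
      rw [Finset.prod_const, card_chords]
    rw [hpow, ← Finset.prod_mul_distrib]
    refine Finset.prod_congr rfl fun c hc => ?_
    have hopp := href.opposite μ.isDyckHeight τ.isDyckHeight (isArc_of_mem_chords hc) (τ.pos c.2).2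
    rw [← pos_congr h, ← pos_congr h, ← mem_upLabels, ← mem_upLabels] at hopp
    unfold chordFactor
    rw [if_neg (hlt c hc)]
    by_cases h1 : c.1 ∈ μ.upLabels
    · have h2 := hopp.1 h1
      simp [h1, h2]
    · have h2 : c.2 ∈ μ.upLabels := by tauto
      simp [h1, h2]
  · rw [Finset.prod_eq_zero_iff]
    by_contra hcon
    push Not at hcon
    apply href
    intro i k
    refine eq_of_arcs_opposite (N := 2 * n) (fun j hj => τ.isDyckHeight.step j hj)
      (fun j hj => μ.isDyckHeight.step j hj) (fun i j harc hj => ?_) i k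
    have hi := harc.lt
    have hc : (τ.label ⟨i, by omega⟩, τ.label ⟨j, hj⟩) ∈ τ.chords := by
      rw [mem_chords_iff_pos, pos_label, pos_label]; exact harc
    have h1 := hcon _ hc
    have h2 := μ.mem_upLabels (τ.label ⟨i, by omega⟩)
    have h3 := μ.mem_upLabels (τ.label ⟨j, hj⟩)
    rw [pos_congr h, pos_label] at h2 h3
    unfold chordFactor at h1
    rw [if_neg (hlt _ hc)] at h1
    dsimp only at h1 h2 h3
    rw [← h2, ← h3]
    by_contra hcon'
    apply h1
    by_cases e1 : τ.label ⟨i, by omega⟩ ∈ μ.upLabels <;>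
      by_cases e2 : τ.label ⟨j, hj⟩ ∈ μ.upLabels <;> simp [e1, e2] at hcon' ⊢

/-- If no cyclic Dyck path equivalent to `τ` starts at the first label of `σ`, then some chord of
`τ` does not contribute. -/
theorem prod_chordFactor_eq_zero (w : ℂ) {σ μ τ : CyclicDyckPath n} (h : μ.first = σ.first)
    (hτ : ∀ τ' : CyclicDyckPath n, τ' ≈ τ → τ'.first ≠ σ.first) :
    ∏ c ∈ τ.chords, chordFactor w σ μ c = 0 := by
  classical
  rw [Finset.prod_eq_zero_iff]
  by_contra hcon
  push Not at hcon
  set g : ℕ → ℤ := fun k => labelHeight τ.upLabels (σ.first + k) - labelHeight τ.upLabels σ.first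
    with hg
  have hgstep : ∀ j, g (j + 1) = g j + 1 ∨ g (j + 1) = g j - 1 := by
    intro j
    have := labelHeight_step τ.upLabels (σ.first + j)
    simp only [hg, ← add_assoc]
    omega
  have hg0 : g 0 = 0 := by simp [hg]
  have hgper : ∀ k, g (k + 2 * n) = g k := by
    intro k
    simp only [hg, ← add_assoc, labelHeight_add_period τ.card_upLabels]
  have hneg : ∃ k ≤ 2 * n, g k < 0 := by
    by_contra hcon'
    push Not at hcon'
    obtain ⟨τ', h1, h2⟩ := exists_of_upLabels τ.card_upLabels σ.first fun k hk => by
      have := hcon' k hk; simp only [hg] at this; omega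
    exact hτ τ' (equiv_iff.2 h2) h1
  obtain ⟨k, hk, hgk⟩ := hneg
  have hg2n : g (2 * n) = 0 := by have := hgper 0; rw [zero_add] at this; rw [this, hg0]
  obtain ⟨q, hq1, hq2, hq3, hq4⟩ := exists_first_visit (s := g) (i := 0) k
    (fun j _ _ => hgstep j) (c := -1) (by omega) (by rw [zero_add]; omega)
  obtain ⟨p, hp1, hp2, hp3, hp4⟩ := exists_last_visit (s := g) (i := k) (2 * n - k)
    (fun j _ _ => hgstep j) (c := -1) (by omega)
    (by rw [show k + (2 * n - k) = 2 * n by omega, hg2n]; omega)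
  have hpq : q ≤ p := by
    by_contra hlt
    have := hq4 p (by omega) (by omega)
    omega
  have hglab : ∀ i, labelHeight τ.upLabels (σ.first + i) = g i + labelHeight τ.upLabels σ.first := by
    intro i; simp only [hg]; ring
  have hchord : ∀ i j : Fin (2 * n), IsArc g i j → (σ.label i, σ.label j) ∈ τ.chords := by
    intro i j harc
    rw [mem_chords_iff]
    refine ⟨σ.first + i, σ.first + j, (σ.label_val i).symm, (σ.label_val j).symm, by omega, ?_⟩
    have hlt := harc.lt
    refine ⟨by omega, fun k h1 h2 => ?_, ?_⟩
    · have := harc.gt (k - σ.first) (by omega) (by omega)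
      have e := hglab (k - σ.first)
      rw [show (σ.first + (k - σ.first) : ℕ) = k by omega] at e
      have := hglab i
      omega
    · have := harc.eq
      have e1 := hglab i
      have e2 := hglab (j + 1)
      rw [add_assoc]
      omega
  have hup : ∀ i : Fin (2 * n), σ.label i ∈ μ.upLabels ↔ μ.height (i + 1) = μ.height i + 1 := by
    intro i
    rw [mem_upLabels, pos_congr h, pos_label]
  have hrefines := eq_of_arcs_opposite (g := g) (m := μ.height) (N := 2 * n) (fun j _ => hgstep j)
    (fun j hj => μ.isDyckHeight.step j hj) (fun i j harc hj => by
      have hlt := harc.lt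
      have h1 := hcon _ (hchord ⟨i, by omega⟩ ⟨j, hj⟩ harc)
      unfold chordFactor at h1
      have h2 := hup ⟨i, by omega⟩
      have h3 := hup ⟨j, hj⟩
      dsimp only at h1 h2 h3
      have hnlt : ¬ (⟨j, hj⟩ : Fin (2 * n)) < ⟨i, by omega⟩ := by
        rw [Fin.lt_def]; dsimp only; omega
      rw [pos_label, pos_label, if_neg hnlt] at h1
      rw [← h2, ← h3]
      by_contra hcon'
      apply h1
      by_cases e1 : σ.label ⟨i, by omega⟩ ∈ μ.upLabels <;>
        by_cases e2 : σ.label ⟨j, hj⟩ ∈ μ.upLabels <;> simp [e1, e2] at hcon' ⊢)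
  have hq5 := hgstep (q - 1)
  have hq6 := hq4 (q - 1) (by omega) (by omega)
  rw [show q - 1 + 1 = q by omega] at hq5
  have hp5 := hgstep p
  have hp6 := hp4 (p + 1) (by omega) (by omega)
  have e1 := hrefines 0 (q - 1) (by omega) (by omega) (by omega) (fun j _ hj => by
    have := hq4 j (by omega) (by omega); omega)
  have e2 := hrefines (p + 1) (2 * n) (by omega) le_rfl (by omega) (fun j hj1 hj2 => by
    have := hp4 j (by omega) (by omega); omega)
  rw [μ.isDyckHeight.zero] at e1
  rw [μ.isDyckHeight.eq_zero _ le_rfl] at e2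
  have hd : σ.label ⟨q - 1, by omega⟩ ∈ μ.upLabels := by
    rw [hup]
    dsimp only
    rcases μ.isDyckHeight.step (q - 1) (by omega) with h1 | h1
    · exact h1
    · have := μ.isDyckHeight.nonneg (q - 1 + 1); omega
  have hu : σ.label ⟨p, by omega⟩ ∉ μ.upLabels := by
    rw [hup]
    dsimp only
    have := μ.isDyckHeight.nonneg p
    omega
  have hc : (σ.label ⟨p, by omega⟩, σ.label ⟨q - 1, by omega⟩) ∈ τ.chords := by
    rw [mem_chords_iff]
    refine ⟨σ.first + p, σ.first + (q - 1 + 2 * n), (σ.label_val ⟨p, by omega⟩).symm, ?_, by omega,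
      by omega, fun j hj1 hj2 => ?_, ?_⟩
    · rw [label_val, ← add_assoc, Nat.add_mod_right]
    · have e := hglab (j - σ.first)
      rw [show (σ.first + (j - σ.first) : ℕ) = j by omega] at e
      rw [hglab p, e, hp3]
      by_cases hj : j - σ.first.val ≤ 2 * n
      · have := hp4 (j - σ.first) (by omega) (by omega); omega
      · have h1 := hgper (j - σ.first - 2 * n)
        rw [show j - σ.first.val - 2 * n + 2 * n = j - σ.first by omega] at h1
        have := hq4 (j - σ.first - 2 * n) (by omega) (by omega); omega
    · rw [show (σ.first + (q - 1 + 2 * n) + 1 : ℕ) = σ.first + (q + 2 * n) by omega, hglab, hglab,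
        hgper]
      omega
  apply hcon _ hc
  unfold chordFactor
  dsimp only
  have hlt : (⟨q - 1, by omega⟩ : Fin (2 * n)) < ⟨p, by omega⟩ := by
    rw [Fin.lt_def]; dsimp only; omega
  rw [pos_label, pos_label, if_pos hlt, if_neg hu, if_pos hd]
  simp

open Classical in
theorem sum_entryB_mul_entryA_eq (w : ℂ) (hw : w ≠ 0) (σ τ : CyclicDyckPath n) :
    ∑ R : HalfSubset n, entryB w σ R * entryA w R τ = if σ ≈ τ then (1 - w) ^ n else 0 := by
  by_cases hex : ∃ τ' : CyclicDyckPath n, τ' ≈ τ ∧ τ'.first = σ.first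
  · obtain ⟨τ', h1, h2⟩ := hex
    have hcongr : ∀ R, entryA w R τ = entryA w R τ' := fun R => entryA_congr w R (Setoid.symm h1)
    have hiff : (σ ≈ τ) ↔ σ = τ' :=
      ⟨fun h => eq_of_upLabels_eq h2.symm (equiv_iff.1 (Setoid.trans h (Setoid.symm h1))),
        fun h => h ▸ h1⟩
    simp only [hcongr, hiff]
    rw [sum_entryB_mul_entryA w hw]
    have hsum : ∑ μ : CyclicDyckPath n with μ.Dominates σ, (ci σ μ : ℂ) *
        ∏ c ∈ τ'.chords, chordFactor w σ μ c = (w⁻¹ - 1) ^ n * if σ = τ' then 1 else 0 := by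
      have h3 := congrArg (Int.cast : ℤ → ℂ) (sum_ci_flipSign σ τ' h2.symm)
      rw [Finset.sum_filter]
      push_cast at h3
      rw [← h3, Finset.mul_sum]
      refine Finset.sum_congr rfl fun μ _ => ?_
      by_cases h4 : μ.Dominates σ
      · rw [if_pos h4, prod_chordFactor w (h4.1.trans h2.symm) h2.symm]
        by_cases h5 : Refines n μ.height τ'.height
        · rw [if_pos h5, if_pos ⟨h4, h5⟩]; ring
        · rw [if_neg h5, if_neg fun h => h5 h.2]; ring
      · rw [if_neg h4, if_neg fun h => h4 h.1]; ring
    rw [hsum]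
    split_ifs with h
    · subst h
      rw [← leftDownCount_eq, Even.neg_one_zpow ⟨σ.winding, rfl⟩, one_mul, mul_one,
        show (n : ℤ) - σ.winding - leftDownCount σ + σ.winding + leftDownCount σ = n by ring,
        zpow_natCast, ← mul_pow]
      congr 1
      field_simp
    · ring
  · push Not at hex
    rw [sum_entryB_mul_entryA w hw, if_neg fun h => hex σ h rfl]
    refine mul_eq_zero_of_right _ (Finset.sum_eq_zero fun μ hμ => ?_)
    rw [prod_chordFactor_eq_zero w (Finset.mem_filter.1 hμ).2.1 hex, mul_zero]

/-! ## The inverse matrices -/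

/-- The equivalence classes of cyclic Dyck paths correspond to the sets of up labels. -/
def quotientEquiv (hn : 1 ≤ n) : Quotient (pairingSetoid n) ≃ HalfSubset n :=
  Equiv.ofBijective (Quotient.lift (fun σ => (⟨σ.upLabels, σ.card_upLabels⟩ : HalfSubset n))
    fun _ _ h => Subtype.ext (equiv_iff.1 h)) (by
      constructor
      · rintro ⟨σ⟩ ⟨τ⟩ h
        exact Quotient.sound (equiv_iff.2 (congrArg Subtype.val h))
      · intro U
        obtain ⟨σ, hσ⟩ := exists_upLabels_eq U.2 hn
        exact ⟨Quotient.mk _ σ, Subtype.ext hσ⟩)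

open Classical in
theorem matrixB_mul_matrixA (w : ℂ) (hw : w ≠ 0) :
    matrixB n w * matrixA n w = (1 - w) ^ n • (1 : Matrix _ _ ℂ) := by
  ext q q'
  rw [Matrix.mul_apply, Matrix.smul_apply, Matrix.one_apply]
  simp only [matrixA, matrixB, Matrix.of_apply, sum_entryB_mul_entryA_eq w hw]
  have : (q.out ≈ q'.out) ↔ q = q' := by rw [Quotient.out_equiv_out]
  simp only [this, smul_eq_mul, mul_ite, mul_one, mul_zero]

open Classical in
theorem matrixA_mul_matrixB_of_ne (hn : 1 ≤ n) (w : ℂ) (hw : w ≠ 0) (hw1 : w ≠ 1) :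
    matrixA n w * matrixB n w = (1 - w) ^ n • (1 : Matrix _ _ ℂ) := by
  have hc : (1 - w) ^ n ≠ 0 := pow_ne_zero _ (sub_ne_zero.2 hw1.symm)
  have h1 : (((1 - w) ^ n)⁻¹ • matrixB n w) * matrixA n w = 1 := by
    rw [Matrix.smul_mul, matrixB_mul_matrixA w hw, smul_smul, inv_mul_cancel₀ hc, one_smul]
  have h2 := (Matrix.mul_eq_one_comm_of_equiv (quotientEquiv hn)).1 h1
  rw [Matrix.mul_smul] at h2
  rw [← h2, smul_smul, mul_inv_cancel₀ hc, one_smul]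

open Classical in
theorem continuousAt_entryA (R : HalfSubset n) (σ : CyclicDyckPath n) :
    ContinuousAt (fun w => entryA w R σ) 1 := by
  unfold entryA
  split_ifs
  · exact continuousAt_const.mul (continuousAt_zpow₀ _ _ (Or.inl one_ne_zero))
  · exact continuousAt_const

theorem continuousAt_entryB (R : HalfSubset n) (σ : CyclicDyckPath n) :
    ContinuousAt (fun w => entryB w σ R) 1 := by
  unfold entryB
  exact continuousAt_const.mul (tendsto_finsetSum _ fun μ _ =>
    continuousAt_const.mul (continuousAt_zpow₀ _ _ (Or.inl one_ne_zero)))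

open Classical in
theorem matrixA_mul_matrixB (hn : 1 ≤ n) (w : ℂ) (hw : w ≠ 0) :
    matrixA n w * matrixB n w = (1 - w) ^ n • (1 : Matrix _ _ ℂ) := by
  by_cases hw1 : w = 1
  · subst hw1
    ext R R'
    have h1 : ContinuousAt (fun w => (matrixA n w * matrixB n w) R R') 1 := by
      simp only [Matrix.mul_apply, matrixA, matrixB, Matrix.of_apply]
      exact tendsto_finsetSum _ fun q _ => (continuousAt_entryA _ _).mul (continuousAt_entryB _ _)
    have h2 : ContinuousAt (fun w : ℂ => ((1 - w) ^ n • (1 : Matrix (HalfSubset n) (HalfSubset n) ℂ)) R R') 1 := by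
      simp only [Matrix.smul_apply]
      fun_prop
    refine tendsto_nhds_unique_of_eventuallyEq (l := nhdsWithin 1 {1}ᶜ)
      (h1.tendsto.mono_left nhdsWithin_le_nhds) (h2.tendsto.mono_left nhdsWithin_le_nhds) ?_
    have h0 : ∀ᶠ w : ℂ in nhdsWithin 1 {1}ᶜ, w ≠ 0 :=
      nhdsWithin_le_nhds (isOpen_ne.mem_nhds one_ne_zero)
    filter_upwards [self_mem_nhdsWithin, h0] with w h3 h4
    rw [matrixA_mul_matrixB_of_ne hn w h4 h3]
  · exact matrixA_mul_matrixB_of_ne hn w hw hw1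

end CyclicDyckPath

end

section
namespace OutEdges

open Relation

section Basic

variable {V : Type*} {g g' : OutEdges V}

theorem Arrow.unique {u v v' : V} (h : g.Arrow u v) (h' : g.Arrow u v') : v = v' := by
  unfold Arrow at h h'
  rw [h] at h'
  simpa using h'

theorem rightUnique_arrow : Relator.RightUnique g.Arrow := fun _ _ _ h h' => h.unique h'

theorem not_arrow {d v : V} (hd : g d = none) : ¬ g.Arrow d v := by
  simp [Arrow, hd]

theorem eq_of_reaches {d v : V} (hd : g d = none) (h : ReflTransGen g.Arrow d v) : v = d := by
  rcases h.cases_head with h | ⟨w, h, _⟩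
  · exact h.symm
  · exact absurd h (not_arrow hd)

theorem sink_unique {u d e : V} (h : ReflTransGen g.Arrow u d) (h' : ReflTransGen g.Arrow u e)
    (hd : g d = none) (he : g e = none) : d = e := by
  rcases h.total_of_right_unique rightUnique_arrow h' with h | h
  · exact (eq_of_reaches hd h).symm
  · exact eq_of_reaches he h

theorem reaches_of_arrow {u v d : V} (h : g.Arrow u v) (hu : ReflTransGen g.Arrow u d)
    (hd : g d = none) : ReflTransGen g.Arrow v d := by
  rcases hu.cases_head with rfl | ⟨w, h1, h2⟩
  · exact absurd h (not_arrow hd)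
  · rwa [h.unique h1]

theorem reaches_trans {u v d : V} (h : ReflTransGen g.Arrow u v) (hu : ReflTransGen g.Arrow u d)
    (hd : g d = none) : ReflTransGen g.Arrow v d := by
  induction h with
  | refl => exact hu
  | tail _ h ih => exact reaches_of_arrow h ih hd

theorem not_transGen_self {u d : V} (h : ReflTransGen g.Arrow u d) (hd : g d = none) :
    ¬ TransGen g.Arrow u u := by
  induction h using ReflTransGen.head_induction_on with
  | refl =>
    intro h
    obtain ⟨w, h1, _⟩ := TransGen.head'_iff.1 h
    exact not_arrow hd h1
  | head h _ ih =>
    intro h'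
    obtain ⟨w, h1, h2⟩ := TransGen.head'_iff.1 h'
    rw [← h.unique h1] at h2
    exact ih (TransGen.tail' h2 h)

/-- The value of `f` on the edge going out of `u`, or `x` if this edge is missing or goes to the
root. -/
def arrowVal {M : Type*} (g : OutEdges V) (x : M) (f : V → V → M) (u : V) : M :=
  match g u with
  | some (some v) => f u v
  | _ => x

theorem arrowVal_of_arrow {M : Type*} {x : M} {f : V → V → M} {u v : V} (h : g.Arrow u v) :
    arrowVal g x f u = f u v := by
  unfold Arrow at h
  simp [arrowVal, h]

theorem arrowVal_of_not {M : Type*} {x : M} {f : V → V → M} {u : V} (h : ∀ v, ¬ g.Arrow u v) :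
    arrowVal g x f u = x := by
  unfold arrowVal
  split
  · next h' => exact absurd h' (h _)
  · rfl

theorem arrowVal_of_none {M : Type*} {x : M} {f : V → V → M} {u : V} (h : g u = none) :
    arrowVal g x f u = x := by
  simp [arrowVal, h]

theorem arrowVal_congr {M : Type*} {x : M} {f : V → V → M} {u : V} (h : g u = g' u) :
    arrowVal g x f u = arrowVal g' x f u := by
  simp [arrowVal, h]

theorem edgeProd_eq (φ : V → V → ℂ) (C : Finset V) :
    g.edgeProd φ C = ∏ u ∈ C, arrowVal g 1 φ u := rfl

theorem edgeSum_eq (κ : V → V → ℤ) (C : Finset V) :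
    g.edgeSum κ C = ∑ u ∈ C, arrowVal g 0 κ u := rfl

theorem IsCycle.congr {C : Finset V} (hC : g.IsCycle C) (h : ∀ x ∈ C, g' x = g x) :
    g'.IsCycle C := by
  refine ⟨hC.1, fun u hu v => ?_⟩
  rw [hC.2 u hu v]
  constructor
  · intro hv
    induction hv with
    | single h1 => exact .single (by unfold Arrow at h1 ⊢; rwa [h _ hu])
    | tail h0 h1 ih =>
      exact ih.tail (by unfold Arrow at h1 ⊢; rwa [h _ ((hC.2 u hu _).2 h0)])
  · intro hv
    induction hv with
    | single h1 => exact .single (by unfold Arrow at h1 ⊢; rwa [← h _ hu])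
    | tail h0 h1 ih =>
      exact ih.tail (by unfold Arrow at h1 ⊢; rwa [← h _ ((hC.2 u hu _).2 ih)])

theorem IsCycle.transGen_self {C : Finset V} (hC : g.IsCycle C) {u : V} (hu : u ∈ C) :
    TransGen g.Arrow u u := (hC.2 u hu u).1 hu

end Basic

variable {V : Type*} [Fintype V] {g g' : OutEdges V}

theorem mem_trail {u v : V} : v ∈ g.trail u ↔ ReflTransGen g.Arrow u v := by
  simp [trail]

theorem self_mem_trail (u : V) : u ∈ g.trail u := mem_trail.2 .refl

theorem trail_of_none {u : V} (h : g u = none) : g.trail u = {u} := by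
  ext v
  rw [mem_trail, Finset.mem_singleton]
  exact ⟨eq_of_reaches h, fun h => h ▸ .refl⟩

theorem mem_trail_of_arrow {u v x : V} (h : g.Arrow u v) :
    x ∈ g.trail u ↔ x = u ∨ x ∈ g.trail v := by
  rw [mem_trail, mem_trail]
  constructor
  · intro h'
    rcases h'.cases_head with rfl | ⟨w, h1, h2⟩
    · exact Or.inl rfl
    · rw [h.unique h1]; exact Or.inr h2
  · rintro (rfl | h')
    · exact .refl
    · exact .head h h'

theorem notMem_trail_of_arrow {u v d : V} (h : g.Arrow u v) (hv : ReflTransGen g.Arrow v d)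
    (hd : g d = none) : u ∉ g.trail v := fun h' =>
  not_transGen_self hv hd (TransGen.tail' (mem_trail.1 h') h)

open Classical in
theorem trail_of_arrow {u v : V} (h : g.Arrow u v) : g.trail u = insert u (g.trail v) := by
  ext x
  rw [mem_trail_of_arrow h, Finset.mem_insert]

theorem edgeProd_trail {u v d : V} (φ : V → V → ℂ) (h : g.Arrow u v)
    (hv : ReflTransGen g.Arrow v d) (hd : g d = none) :
    g.edgeProd φ (g.trail u) = φ u v * g.edgeProd φ (g.trail v) := by
  classical
  rw [edgeProd_eq, trail_of_arrow h, Finset.prod_insert (notMem_trail_of_arrow h hv hd),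
    arrowVal_of_arrow h]
  rfl

/-- If two paths meet, they end at the same vertex. -/
theorem sink_eq_of_not_disjoint {u v d e : V} (h : ¬ Disjoint (g.trail u) (g.trail v))
    (hu : ReflTransGen g.Arrow u d) (hv : ReflTransGen g.Arrow v e) (hd : g d = none)
    (he : g e = none) : d = e := by
  obtain ⟨x, h1, h2⟩ := Finset.not_disjoint_iff.1 h
  exact sink_unique (reaches_trans (mem_trail.1 h1) hu hd) (reaches_trans (mem_trail.1 h2) hv he)
    hd he

theorem trail_congr {u : V} (h : ∀ x ∈ g.trail u, g' x = g x) : g'.trail u = g.trail u := by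
  ext x
  rw [mem_trail]
  constructor
  · intro hx
    induction hx with
    | refl => exact self_mem_trail u
    | tail _ h1 ih =>
      refine mem_trail.2 ((mem_trail.1 ih).tail ?_)
      unfold Arrow at h1 ⊢
      rwa [← h _ ih]
  · intro hx
    rw [mem_trail] at hx
    induction hx with
    | refl => exact .refl
    | tail h0 h1 ih =>
      refine ih.tail ?_
      unfold Arrow at h1 ⊢
      rwa [h _ (mem_trail.2 h0)]

theorem reaches_congr {u v : V} (h : ∀ x ∈ g.trail u, g' x = g x)
    (hv : ReflTransGen g.Arrow u v) : ReflTransGen g'.Arrow u v := by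
  rw [← mem_trail, trail_congr h, mem_trail]; exact hv

theorem edgeSum_trail_congr {u : V} (κ : V → V → ℤ) (h : ∀ x ∈ g.trail u, g' x = g x) :
    g'.edgeSum κ (g'.trail u) = g.edgeSum κ (g.trail u) := by
  rw [trail_congr h]
  exact Finset.sum_congr rfl fun x hx => arrowVal_congr (h x hx)

/-! ### Reversing the path going out of a vertex -/

open Classical in
/-- Reverse the edges of the path starting at `a`. -/
def reversePath (g : OutEdges V) (a : V) : OutEdges V := fun v =>
  if h : ∃ p ∈ g.trail a, g.Arrow p v then some (some h.choose)
  else if v = a then none else g v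

section Reverse

variable {a d : V}

theorem eq_of_arrow_of_mem_trail (ha : ReflTransGen g.Arrow a d) (hd : g d = none) {p p' v : V}
    (hp : p ∈ g.trail a) (hp' : p' ∈ g.trail a) (h : g.Arrow p v) (h' : g.Arrow p' v) :
    p = p' := by
  have key : ∀ {p p'}, p ∈ g.trail a → ReflTransGen g.Arrow p p' → g.Arrow p v → g.Arrow p' v →
      p = p' := by
    intro p p' hp hpp h h'
    rcases hpp.cases_head with e | ⟨w, h1, h2⟩
    · exact e
    · rw [← h.unique h1] at h2
      exact absurd (TransGen.tail' h2 h')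
        (not_transGen_self (reaches_of_arrow h (reaches_trans (mem_trail.1 hp) ha hd) hd) hd)
  rcases (mem_trail.1 hp).total_of_right_unique rightUnique_arrow (mem_trail.1 hp') with h1 | h1
  · exact key hp h1 h h'
  · exact (key hp' h1 h' h).symm

theorem reversePath_arrow (ha : ReflTransGen g.Arrow a d) (hd : g d = none) {p v : V}
    (hp : p ∈ g.trail a) (h : g.Arrow p v) : (g.reversePath a).Arrow v p := by
  have hex : ∃ p ∈ g.trail a, g.Arrow p v := ⟨p, hp, h⟩
  unfold Arrow reversePath
  rw [dif_pos hex, eq_of_arrow_of_mem_trail ha hd hex.choose_spec.1 hp hex.choose_spec.2 h]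

theorem reversePath_start (ha : ReflTransGen g.Arrow a d) (hd : g d = none) :
    g.reversePath a a = none := by
  unfold reversePath
  rw [dif_neg, if_pos rfl]
  rintro ⟨p, hp, h⟩
  exact not_transGen_self ha hd (TransGen.tail' (mem_trail.1 hp) h)

theorem reversePath_of_notMem {v : V} (hv : v ∉ g.trail a) : g.reversePath a v = g v := by
  unfold reversePath
  rw [dif_neg, if_neg]
  · rintro rfl; exact hv (self_mem_trail _)
  · rintro ⟨p, hp, h⟩
    exact hv (mem_trail.2 ((mem_trail.1 hp).tail h))

theorem exists_arrow_of_mem_trail {v : V} (hv : v ∈ g.trail a) (hne : v ≠ a) :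
    ∃ p ∈ g.trail a, g.Arrow p v := by
  rcases (mem_trail.1 hv).cases_tail with h | ⟨p, h1, h2⟩
  · exact absurd h hne
  · exact ⟨p, mem_trail.2 h1, h2⟩

theorem exists_next_of_mem_trail (ha : ReflTransGen g.Arrow a d) (hd : g d = none) {v : V}
    (hv : v ∈ g.trail a) (hne : v ≠ d) : ∃ x ∈ g.trail a, g.Arrow v x := by
  rcases (reaches_trans (mem_trail.1 hv) ha hd).cases_head with h | ⟨x, h1, _⟩
  · exact absurd h hne
  · exact ⟨x, mem_trail.2 ((mem_trail.1 hv).tail h1), h1⟩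

theorem reversePath_reaches (ha : ReflTransGen g.Arrow a d) (hd : g d = none) {v : V}
    (hv : v ∈ g.trail a) : ReflTransGen (g.reversePath a).Arrow v a := by
  rw [mem_trail] at hv
  induction hv with
  | refl => exact .refl
  | tail h0 h ih => exact .head (reversePath_arrow ha hd (mem_trail.2 h0) h) ih

theorem trail_reversePath (ha : ReflTransGen g.Arrow a d) (hd : g d = none) :
    (g.reversePath a).trail d = g.trail a := by
  ext v
  constructor
  · intro hv
    rw [mem_trail] at hv
    induction hv with
    | refl => exact mem_trail.2 ha
    | @tail x y _ h ih =>
      by_cases e : x = a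
      · subst e
        exact absurd h (not_arrow (reversePath_start ha hd))
      · obtain ⟨p, hp, h1⟩ := exists_arrow_of_mem_trail ih e
        rw [h.unique (reversePath_arrow ha hd hp h1)]
        exact hp
  · intro hv
    have hvd := reaches_trans (mem_trail.1 hv) ha hd
    induction hvd using ReflTransGen.head_induction_on with
    | refl => exact self_mem_trail d
    | head h _ ih =>
      exact mem_trail.2 ((mem_trail.1 (ih (mem_trail.2 ((mem_trail.1 hv).tail h)))).tail
        (reversePath_arrow ha hd hv h))

theorem reversePath_reversePath (ha : ReflTransGen g.Arrow a d) (hd : g d = none) :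
    (g.reversePath a).reversePath d = g := by
  have h1 := reversePath_reaches ha hd (mem_trail.2 ha)
  have h2 := reversePath_start ha hd
  have h3 := trail_reversePath ha hd
  funext v
  by_cases hv : v ∈ g.trail a
  · by_cases hvd : v = d
    · subst hvd
      rw [reversePath_start h1 h2, hd]
    · obtain ⟨x, hx, h⟩ := exists_next_of_mem_trail ha hd hv hvd
      have h4 := reversePath_arrow h1 h2 (h3 ▸ hx) (reversePath_arrow ha hd hv h)
      unfold Arrow at h h4
      rw [h, h4]
  · rw [reversePath_of_notMem (h3 ▸ hv), reversePath_of_notMem hv]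

theorem reversePath_eq_none_iff (ha : ReflTransGen g.Arrow a d) (hd : g d = none) {v : V} :
    g.reversePath a v = none ↔ v = a ∨ (v ≠ d ∧ g v = none) := by
  by_cases hv : v ∈ g.trail a
  · by_cases hva : v = a
    · subst hva
      simp [reversePath_start ha hd]
    · obtain ⟨p, hp, h⟩ := exists_arrow_of_mem_trail hv hva
      have h1 := reversePath_arrow ha hd hp h
      unfold Arrow at h1
      simp only [h1, hva, reduceCtorEq, false_or, false_iff, not_and]
      intro hvd
      obtain ⟨x, _, h2⟩ := exists_next_of_mem_trail ha hd hv hvd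
      unfold Arrow at h2
      simp [h2]
  · have h1 : v ≠ a := by rintro rfl; exact hv (self_mem_trail _)
    have h2 : v ≠ d := by rintro rfl; exact hv (mem_trail.2 ha)
    simp [reversePath_of_notMem hv, h1, h2]

@[to_additive]
theorem prod_reversePath {M : Type*} [CommMonoid M] (ha : ReflTransGen g.Arrow a d)
    (hd : g d = none) (f : V → V → M) :
    ∏ v ∈ g.trail a, arrowVal (g.reversePath a) 1 f v =
      ∏ v ∈ g.trail a, arrowVal g 1 (fun u v => f v u) v := by
  classical
  rw [← Finset.mul_prod_erase _ _ (self_mem_trail a),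
    ← Finset.mul_prod_erase (g.trail a) (fun v => arrowVal g 1 _ v) (mem_trail.2 ha),
    arrowVal_of_none hd, arrowVal_of_none (reversePath_start ha hd)]
  congr 1
  symm
  have hnext : ∀ v ∈ (g.trail a).erase d, ∃ x ∈ g.trail a, g.Arrow v x := fun v hv =>
    exists_next_of_mem_trail ha hd (Finset.mem_of_mem_erase hv) (Finset.ne_of_mem_erase hv)
  refine Finset.prod_bij (fun v hv => (hnext v hv).choose) ?_ ?_ ?_ ?_
  · intro v hv
    obtain ⟨h1, h2⟩ := (hnext v hv).choose_spec
    refine Finset.mem_erase.2 ⟨fun h => ?_, h1⟩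
    rw [h] at h2
    exact not_transGen_self ha hd (TransGen.tail' (mem_trail.1 (Finset.mem_of_mem_erase hv)) h2)
  · intro v hv v' hv' h
    have h1 := (hnext v hv).choose_spec.2
    have h2 := (hnext v' hv').choose_spec.2
    rw [← h] at h2
    exact eq_of_arrow_of_mem_trail ha hd (Finset.mem_of_mem_erase hv)
      (Finset.mem_of_mem_erase hv') h1 h2
  · intro v hv
    obtain ⟨p, hp, h⟩ := exists_arrow_of_mem_trail (Finset.mem_of_mem_erase hv)
      (Finset.ne_of_mem_erase hv)
    have hpd : p ∈ (g.trail a).erase d :=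
      Finset.mem_erase.2 ⟨fun e => not_arrow hd (e ▸ h), hp⟩
    exact ⟨p, hpd, (hnext p hpd).choose_spec.2.unique h⟩
  · intro v hv
    have h2 := (hnext v hv).choose_spec.2
    rw [arrowVal_of_arrow h2,
      arrowVal_of_arrow (reversePath_arrow ha hd (Finset.mem_of_mem_erase hv) h2)]

theorem edgeSum_reversePath (ha : ReflTransGen g.Arrow a d) (hd : g d = none) {κ : V → V → ℤ}
    (hκ : ∀ u v, κ v u = - κ u v) :
    (g.reversePath a).edgeSum κ (g.trail a) = - g.edgeSum κ (g.trail a) := by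
  rw [edgeSum_eq, edgeSum_eq, sum_reversePath ha hd, ← Finset.sum_neg_distrib]
  refine Finset.sum_congr rfl fun v hv => ?_
  by_cases hvd : v = d
  · subst hvd
    simp [arrowVal_of_none hd]
  · obtain ⟨x, _, h⟩ := exists_next_of_mem_trail ha hd hv hvd
    rw [arrowVal_of_arrow h, arrowVal_of_arrow h, hκ]

theorem edgeProd_reversePath_univ (ha : ReflTransGen g.Arrow a d) (hd : g d = none)
    {f : V → V → ℂ} (hf : ∀ u v, f u v = f v u) :
    (g.reversePath a).edgeProd f Finset.univ = g.edgeProd f Finset.univ := by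
  classical
  rw [edgeProd_eq, edgeProd_eq, ← Finset.prod_mul_prod_compl (g.trail a), prod_reversePath ha hd,
    ← Finset.prod_mul_prod_compl (g.trail a) (arrowVal g 1 f)]
  have hff : (fun u v => f v u) = f := by ext u v; exact hf v u
  rw [hff]
  congr 1
  exact Finset.prod_congr rfl fun v hv =>
    arrowVal_congr (reversePath_of_notMem (Finset.mem_compl.1 hv))

theorem IsCycle.notMem_trail {C : Finset V} (hC : g.IsCycle C) (ha : ReflTransGen g.Arrow a d)
    (hd : g d = none) {x : V} (hx : x ∈ C) : x ∉ g.trail a := fun h =>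
  not_transGen_self (reaches_trans (mem_trail.1 h) ha hd) hd (hC.transGen_self hx)

theorem IsCycle.reversePath {C : Finset V} (hC : g.IsCycle C) (ha : ReflTransGen g.Arrow a d)
    (hd : g d = none) : (g.reversePath a).IsCycle C :=
  hC.congr fun _ hx => reversePath_of_notMem (hC.notMem_trail ha hd hx)

theorem isCycle_reversePath_iff (ha : ReflTransGen g.Arrow a d) (hd : g d = none) {C : Finset V} :
    (g.reversePath a).IsCycle C ↔ g.IsCycle C := by
  refine ⟨fun h => ?_, fun h => h.reversePath ha hd⟩
  have := h.reversePath (reversePath_reaches ha hd (mem_trail.2 ha)) (reversePath_start ha hd)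
  rwa [reversePath_reversePath ha hd] at this

open Classical in
theorem prod_isCycle_reversePath (ha : ReflTransGen g.Arrow a d) (hd : g d = none)
    (φ : V → V → ℂ) :
    ∏ C : Finset V with (g.reversePath a).IsCycle C, (1 - (g.reversePath a).edgeProd φ C) =
      ∏ C : Finset V with g.IsCycle C, (1 - g.edgeProd φ C) := by
  simp only [isCycle_reversePath_iff ha hd]
  refine Finset.prod_congr rfl fun C hC => ?_
  rw [edgeProd_eq, edgeProd_eq]
  congr 1
  exact Finset.prod_congr rfl fun x hx => arrowVal_congr
    (reversePath_of_notMem ((Finset.mem_filter.1 hC).2.notMem_trail ha hd hx))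

end Reverse

end OutEdges

end

section
/-- If the rows of `M` outside `p` are those of the identity, its determinant is that of the
block `p`. -/
theorem Matrix.det_eq_det_toSquareBlockProp {m R : Type*} [Fintype m] [DecidableEq m] [CommRing R]
    (M : Matrix m m R) (p : m → Prop) [DecidablePred p]
    (h : ∀ i, ¬ p i → M i = Pi.single i 1) : M.det = (M.toSquareBlockProp p).det := by
  rw [Matrix.twoBlockTriangular_det M p fun i hi j hj => by
    rw [h i hi, Pi.single_eq_of_ne]; rintro rfl; exact hi hj]
  have : M.toSquareBlockProp (fun i => ¬ p i) = 1 := by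
    ext i j
    rw [Matrix.toSquareBlockProp_def, Matrix.of_apply, h i i.2, Pi.single_apply, Matrix.one_apply]
    simp [Subtype.ext_iff, eq_comm]
  rw [this, Matrix.det_one, mul_one]

namespace OutEdges

open Relation Classical

/-! ### Removing an edge -/

section Update

variable {V : Type*} {g : OutEdges V} {φ : V → V → ℂ} {u v : V}

theorem update_none_arrow_iff {x y : V} :
    Arrow (Function.update g u none) x y ↔ x ≠ u ∧ g.Arrow x y := by
  unfold Arrow
  by_cases hx : x = u
  · subst hx; simp
  · simp [hx]

theorem reaches_of_update {x y : V} (h : ReflTransGen (Arrow (Function.update g u none)) x y) :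
    ReflTransGen g.Arrow x y :=
  h.lift id fun _ _ h => (update_none_arrow_iff.1 h).2

theorem update_reaches_iff (huv : g.Arrow u v) {y : V} :
    ReflTransGen (Arrow (Function.update g u none)) v y ↔ ReflTransGen g.Arrow v y := by
  refine ⟨reaches_of_update, fun h => ?_⟩
  induction h with
  | refl => exact .refl
  | @tail x y _ h ih =>
    by_cases hx : x = u
    · subst hx
      rw [h.unique huv]
    · exact ih.tail (update_none_arrow_iff.2 ⟨hx, h⟩)

theorem IsCycle.ne_none {C : Finset V} (hC : g.IsCycle C) {x : V} (hx : x ∈ C) : g x ≠ none := by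
  intro h
  exact not_transGen_self .refl h (hC.transGen_self hx)

theorem isCycle_iff_of_notMem {C : Finset V} (hu : u ∉ C) :
    g.IsCycle C ↔ IsCycle (Function.update g u none) C :=
  ⟨fun h => h.congr fun x hx => Function.update_of_ne (by rintro rfl; exact hu hx) _ _,
    fun h => h.congr fun x hx => (Function.update_of_ne (by rintro rfl; exact hu hx) _ _).symm⟩

theorem edgeProd_congr {g' : OutEdges V} {C : Finset V} (h : ∀ x ∈ C, g x = g' x) :
    g.edgeProd φ C = g'.edgeProd φ C :=
  Finset.prod_congr rfl fun x hx => arrowVal_congr (h x hx)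

end Update

/-! ### The determinant of the connection Laplacian of an oriented subgraph -/

variable {V : Type*} (g : OutEdges V) (φ : V → V → ℂ)

/-- The row at `u` of the connection matrix of an oriented subgraph: the edges going out of `u`,
or their absence, contribute the option in the last argument. -/
def connectionRow (h : V → V) (u : V) : Option (Option V) → V → ℂ
  | none => Pi.single (h u) 1
  | some none => Pi.single u 1
  | some (some v) => Pi.single u 1 - φ u v • Pi.single v 1

/-- The connection Laplacian of an oriented subgraph, the row of a sink `u` being the unit vector
at `h u`. -/
def connectionMatrix (h : V → V) : Matrix V V ℂ :=
  Matrix.of fun u => connectionRow φ h u (g u)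

variable {g φ}

theorem connectionMatrix_of_none {h : V → V} {u : V} (hu : g u = none) :
    g.connectionMatrix φ h u = Pi.single (h u) 1 := by
  change connectionRow φ h u (g u) = _
  rw [hu]
  rfl

theorem connectionMatrix_of_arrow {h : V → V} {u v : V} (hu : g.Arrow u v) :
    g.connectionMatrix φ h u = Pi.single u 1 - φ u v • Pi.single v 1 := by
  unfold Arrow at hu
  change connectionRow φ h u (g u) = _
  rw [hu]
  rfl

theorem connectionMatrix_of_root {h : V → V} {u : V} (hu : g u = some none) :
    g.connectionMatrix φ h u = Pi.single u 1 := by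
  change connectionRow φ h u (g u) = _
  rw [hu]
  rfl

theorem IsCycle.notMem_of_update {u : V} {C : Finset V} (hC : IsCycle (Function.update g u none) C) :
    u ∉ C := fun h => hC.ne_none h (Function.update_self _ _ _)

variable [Fintype V]

theorem det_connectionMatrix_eq_zero {h : V → V} {r : V} (hr : g r = none)
    (hnot : ∀ r', g r' = none → ¬ ReflTransGen g.Arrow (h r') r) :
    (g.connectionMatrix φ h).det = 0 := by
  rw [← Matrix.exists_mulVec_eq_zero_iff]
  refine ⟨fun v => if ReflTransGen g.Arrow v r then g.edgeProd φ (g.trail v) else 0, ?_, ?_⟩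
  · intro h0
    have := congrFun h0 r
    simp only [ReflTransGen.refl, if_true, Pi.zero_apply, trail_of_none hr] at this
    rw [edgeProd_eq, Finset.prod_singleton, arrowVal_of_none hr] at this
    exact one_ne_zero this
  · funext u
    rw [Matrix.mulVec]
    rcases hu : g u with _ | _ | v
    · rw [connectionMatrix_of_none hu, single_one_dotProduct, if_neg (hnot u hu), Pi.zero_apply]
    · rw [connectionMatrix_of_root hu, single_one_dotProduct, if_neg, Pi.zero_apply]
      intro h1
      rcases h1.cases_head with rfl | ⟨w, h2, _⟩
      · rw [hu] at hr; simp at hr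
      · unfold Arrow at h2; rw [hu] at h2; simp at h2
    · have hv : g.Arrow u v := hu
      rw [connectionMatrix_of_arrow hv, sub_dotProduct, smul_dotProduct, single_one_dotProduct,
        single_one_dotProduct, Pi.zero_apply, smul_eq_mul]
      by_cases h1 : ReflTransGen g.Arrow v r
      · rw [if_pos h1, if_pos (.head hv h1), edgeProd_trail φ hv h1 hr, sub_self]
      · rw [if_neg h1, if_neg fun h2 => h1 (reaches_of_arrow hv h2 hr), mul_zero, sub_zero]

theorem exists_vecMul_connectionMatrix {v d : V} (hv : ReflTransGen g.Arrow v d)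
    (hd : g d = none) : ∃ k : V → ℂ, Matrix.vecMul k (g.connectionMatrix φ id) = Pi.single v 1 ∧
      ∀ e, g e = none → k e = if e = d then g.edgeProd φ (g.trail v) else 0 := by
  induction hv using ReflTransGen.head_induction_on with
  | refl =>
    refine ⟨Pi.single d 1, ?_, fun e _ => ?_⟩
    · rw [Matrix.single_one_vecMul, Matrix.row, connectionMatrix_of_none hd, id]
    · rw [Pi.single_apply, trail_of_none hd, edgeProd_eq, Finset.prod_singleton,
        arrowVal_of_none hd]
  | @head u v h hv ih =>
    obtain ⟨k, h1, h2⟩ := ih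
    refine ⟨Pi.single u 1 + φ u v • k, ?_, fun e he => ?_⟩
    · rw [Matrix.add_vecMul, Matrix.smul_vecMul, h1, Matrix.single_one_vecMul, Matrix.row,
        connectionMatrix_of_arrow h, sub_add_cancel]
    · have : e ≠ u := by rintro rfl; exact not_arrow he h
      rw [Pi.add_apply, Pi.smul_apply, h2 e he, Pi.single_eq_of_ne this, zero_add,
        edgeProd_trail φ h hv hd, smul_eq_mul, mul_ite, mul_zero]

theorem det_connectionMatrix_of_perm {h : V → V} (e : Equiv.Perm V)
    (he : ∀ r, g r = none → ReflTransGen g.Arrow (h r) (e r) ∧ g (e r) = none)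
    (he' : ∀ u, g u ≠ none → e u = u) :
    (g.connectionMatrix φ h).det = (Equiv.Perm.sign e : ℤ) *
      (∏ r with g r = none, g.edgeProd φ (g.trail (h r))) * (g.connectionMatrix φ id).det := by
  choose! k hk1 hk2 using fun r (hr : g r = none) =>
    exists_vecMul_connectionMatrix (φ := φ) (he r hr).1 (he r hr).2
  let K : Matrix V V ℂ := Matrix.of fun u => if g u = none then k u else Pi.single u 1
  let D : V → ℂ := fun u => if g u = none then g.edgeProd φ (g.trail (h u)) else 1
  let P : Matrix V V ℂ := Matrix.diagonal D * e.permMatrix ℂ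
  have hP : ∀ u v, P u v = if v = e u then D u else 0 := by
    intro u v
    simp only [P]
    rw [Matrix.diagonal_mul, Equiv.Perm.permMatrix, PEquiv.toMatrix_apply]
    simp [Equiv.toPEquiv_apply, eq_comm]
  have hKT : K * g.connectionMatrix φ id = g.connectionMatrix φ h := by
    funext u
    rw [Matrix.mul_apply_eq_vecMul]
    by_cases hu : g u = none
    · rw [show K u = k u from if_pos hu, hk1 u hu, connectionMatrix_of_none hu]
    · rw [show K u = Pi.single u 1 from if_neg hu, Matrix.single_one_vecMul, Matrix.row]
      rcases hu' : g u with _ | _ | v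
      · exact absurd hu' hu
      · rw [connectionMatrix_of_root hu', connectionMatrix_of_root hu']
      · rw [connectionMatrix_of_arrow hu', connectionMatrix_of_arrow hu']
  have hdet : K.det = P.det := by
    rw [Matrix.det_eq_det_toSquareBlockProp K (fun u => g u = none) fun u hu => if_neg hu,
      Matrix.det_eq_det_toSquareBlockProp P (fun u => g u = none) fun u hu => ?_]
    · congr 1
      ext i j
      rw [Matrix.toSquareBlockProp_def, Matrix.toSquareBlockProp_def, Matrix.of_apply,
        Matrix.of_apply, hP, show K i = k i from if_pos i.2, hk2 i i.2 j j.2,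
        show D i = _ from if_pos i.2]
    · funext v
      rw [hP, he' u hu, Pi.single_apply, show D u = 1 from if_neg hu]
  rw [← hKT, Matrix.det_mul, hdet, Matrix.det_mul, Matrix.det_diagonal, Matrix.det_permutation,
    Finset.prod_ite, Finset.prod_const_one, mul_one, mul_comm (∏ r with _, _)]

theorem isCycle_iff_of_mem {u v : V} (huv : g.Arrow u v) {C : Finset V} (hu : u ∈ C) :
    g.IsCycle C ↔ ReflTransGen (Arrow (Function.update g u none)) v u ∧
      C = trail (Function.update g u none) v := by
  have hup : ∀ y, TransGen g.Arrow u y ↔ ReflTransGen (Arrow (Function.update g u none)) v y := by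
    intro y
    rw [update_reaches_iff huv, TransGen.head'_iff]
    exact ⟨fun ⟨w, h1, h2⟩ => by rwa [huv.unique h1], fun h => ⟨v, huv, h⟩⟩
  constructor
  · intro hC
    refine ⟨(hup u).1 (hC.transGen_self hu), ?_⟩
    ext y
    rw [hC.2 u hu y, hup, mem_trail]
  · rintro ⟨h1, rfl⟩
    refine ⟨⟨u, hu⟩, fun x hx y => ?_⟩
    rw [mem_trail, ← hup] at hx ⊢
    have hxu : ReflTransGen g.Arrow x u := reaches_of_update
      (reaches_trans ((hup x).1 hx) h1 (Function.update_self _ _ _))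
    constructor
    · intro hy
      exact TransGen.trans_right hxu hy
    · intro hy
      exact hx.trans hy

theorem prod_isCycle_update {u v : V} (huv : g.Arrow u v) :
    ∏ C : Finset V with g.IsCycle C, (1 - g.edgeProd φ C) =
      (if ReflTransGen (Arrow (Function.update g u none)) v u then
        1 - φ u v * edgeProd (Function.update g u none) φ (trail (Function.update g u none) v)
        else 1) *
      ∏ C : Finset V with IsCycle (Function.update g u none) C,
        (1 - edgeProd (Function.update g u none) φ C) := by
  have hne : ∀ C : Finset V, IsCycle (Function.update g u none) C → ∀ x ∈ C,
      Function.update g u none x = g x := fun C hC x hx =>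
    Function.update_of_ne (by rintro rfl; exact hC.notMem_of_update hx) _ _
  have hsame : ∏ C : Finset V with IsCycle (Function.update g u none) C,
      (1 - edgeProd (Function.update g u none) φ C) =
      ∏ C : Finset V with IsCycle (Function.update g u none) C, (1 - edgeProd g φ C) :=
    Finset.prod_congr rfl fun C hC => by
      rw [edgeProd_congr (hne C (Finset.mem_filter.1 hC).2)]
  rw [hsame]
  split_ifs with h
  · set C₀ := trail (Function.update g u none) v with hC₀
    have hu : u ∈ C₀ := mem_trail.2 h
    have hins : Finset.univ.filter (fun C => g.IsCycle C) =
        insert C₀ (Finset.univ.filter fun C => IsCycle (Function.update g u none) C) := by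
      ext C
      simp only [Finset.mem_filter, Finset.mem_univ, true_and, Finset.mem_insert]
      by_cases huC : u ∈ C
      · rw [isCycle_iff_of_mem huv huC]
        constructor
        · exact fun h => Or.inl h.2
        · rintro (h1 | h1)
          · exact ⟨h, h1⟩
          · exact absurd huC h1.notMem_of_update
      · rw [isCycle_iff_of_notMem huC]
        constructor
        · exact Or.inr
        · rintro (rfl | h1)
          · exact absurd hu huC
          · exact h1
    rw [hins, Finset.prod_insert fun hmem => (Finset.mem_filter.1 hmem).2.notMem_of_update hu]
    congr 2
    rw [edgeProd_eq, edgeProd_eq, ← Finset.mul_prod_erase _ _ hu,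
      ← Finset.mul_prod_erase C₀ (arrowVal (Function.update g u none) 1 φ) hu,
      arrowVal_of_arrow huv, arrowVal_of_none (Function.update_self _ _ _), one_mul]
    congr 1
    exact Finset.prod_congr rfl fun x hx =>
      arrowVal_congr (Function.update_of_ne (Finset.ne_of_mem_erase hx) _ _).symm
  · rw [one_mul]
    congr 1
    ext C
    simp only [Finset.mem_filter, Finset.mem_univ, true_and]
    by_cases huC : u ∈ C
    · rw [isCycle_iff_of_mem huv huC]
      exact ⟨fun h1 => absurd h1.1 h, fun h1 => absurd huC h1.notMem_of_update⟩
    · exact isCycle_iff_of_notMem huC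

theorem det_connectionMatrix_id (g : OutEdges V) (φ : V → V → ℂ) :
    (g.connectionMatrix φ id).det = ∏ C : Finset V with g.IsCycle C, (1 - g.edgeProd φ C) := by
  obtain ⟨m, hm⟩ : ∃ m, (Finset.univ.filter fun u => ∃ v, g.Arrow u v).card = m := ⟨_, rfl⟩
  induction m generalizing g with
  | zero =>
    rw [Finset.card_eq_zero, Finset.filter_eq_empty_iff] at hm
    have h1 : g.connectionMatrix φ id = 1 := by
      funext u
      rcases hu : g u with _ | _ | v
      · rw [connectionMatrix_of_none hu, id]; ext v; rw [Matrix.one_apply, Pi.single_apply]; simp [eq_comm]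
      · rw [connectionMatrix_of_root hu]; ext v; rw [Matrix.one_apply, Pi.single_apply]; simp [eq_comm]
      · exact absurd ⟨v, hu⟩ (hm (Finset.mem_univ u))
    rw [h1, Matrix.det_one, Finset.prod_eq_one]
    intro C hC
    have hC := (Finset.mem_filter.1 hC).2
    obtain ⟨u, hu⟩ := hC.1
    obtain ⟨w, h2, _⟩ := TransGen.head'_iff.1 (hC.transGen_self hu)
    exact absurd ⟨w, h2⟩ (hm (Finset.mem_univ u))
  | succ m ih =>
    obtain ⟨u, hu⟩ : (Finset.univ.filter fun u => ∃ v, g.Arrow u v).Nonempty := by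
      rw [← Finset.card_pos]; omega
    obtain ⟨v, huv⟩ := (Finset.mem_filter.1 hu).2
    set g' : OutEdges V := Function.update g u none with hg'
    have hgu : g' u = none := Function.update_self _ _ _
    have hgx : ∀ x ≠ u, g' x = g x := fun x hx => Function.update_of_ne hx _ _
    have hcard : (Finset.univ.filter fun u => ∃ v, g'.Arrow u v).card = m := by
      rw [← Finset.card_erase_add_one hu] at hm
      rw [← Nat.succ_injective hm]
      congr 1
      ext x
      simp only [Finset.mem_filter, Finset.mem_univ, true_and, Finset.mem_erase, hg',
        update_none_arrow_iff, exists_and_left]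
    have hrow : ∀ h : V → V, (∀ x ≠ u, h x = x) →
        g'.connectionMatrix φ h = (g'.connectionMatrix φ id).updateRow u (Pi.single (h u) 1) := by
      intro h hh
      funext x
      by_cases hx : x = u
      · subst hx
        rw [Matrix.updateRow_self, connectionMatrix_of_none hgu]
      · rw [Matrix.updateRow_ne hx]
        rcases hx' : g' x with _ | _ | y
        · rw [connectionMatrix_of_none hx', connectionMatrix_of_none hx', hh x hx, id]
        · rw [connectionMatrix_of_root hx', connectionMatrix_of_root hx']
        · rw [connectionMatrix_of_arrow hx', connectionMatrix_of_arrow hx']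
    have hT : g.connectionMatrix φ id = (g'.connectionMatrix φ id).updateRow u
        (Pi.single u 1 + (-φ u v) • Pi.single v 1) := by
      funext x
      by_cases hx : x = u
      · subst hx
        rw [Matrix.updateRow_self, connectionMatrix_of_arrow huv, neg_smul, sub_eq_add_neg]
      · rw [Matrix.updateRow_ne hx]
        change connectionRow φ id x (g x) = connectionRow φ id x (g' x)
        rw [hgx x hx]
    have hup : ∀ x ≠ u, Function.update id u v x = x := fun x hx => Function.update_of_ne hx _ _
    have hdet : (g.connectionMatrix φ id).det = (g'.connectionMatrix φ id).det -
        φ u v * (g'.connectionMatrix φ (Function.update id u v)).det := by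
      rw [hT, Matrix.det_updateRow_add, Matrix.det_updateRow_smul, hrow _ hup,
        Function.update_self, neg_mul, ← sub_eq_add_neg]
      congr 2
      conv_rhs => rw [hrow id fun _ _ => rfl]
      rfl
    rw [hdet, prod_isCycle_update huv, ← hg', ← ih g' hcard]
    split_ifs with h
    · rw [det_connectionMatrix_of_perm (h := Function.update id u v) (1 : Equiv.Perm V) (fun r hr => ?_) fun _ _ => rfl,
        Finset.prod_eq_single u]
      · simp only [Equiv.Perm.sign_one, Units.val_one, Int.cast_one, Function.update_self]
        ring
      · intro r hr hne
        rw [hup r hne, trail_of_none (Finset.mem_filter.1 hr).2, edgeProd_eq,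
          Finset.prod_singleton, arrowVal_of_none (Finset.mem_filter.1 hr).2]
      · intro hnot
        exact absurd (Finset.mem_filter.2 ⟨Finset.mem_univ u, hgu⟩) hnot
      · refine ⟨?_, hr⟩
        by_cases hne : r = u
        · subst hne
          rw [Function.update_self]; exact h
        · rw [hup r hne]; exact .refl
    · rw [det_connectionMatrix_eq_zero (h := Function.update id u v) hgu fun r hr => ?_]
      · ring
      · by_cases hne : r = u
        · subst hne
          rw [Function.update_self]; exact h
        · rw [hup r hne]
          intro h1
          exact hne (eq_of_reaches hr h1).symm

end OutEdges

end

section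
namespace Network

open Classical

variable {V : Type*} [Fintype V] {n : ℕ}

theorem crossing_swap (N : Network V n) (u v : V) : N.crossing v u = - N.crossing u v := by
  unfold crossing
  ring

/-- `g` is an oriented cycle-rooted spanning forest whose sinks are the nodes with label in `R`. -/
structure IsRootedAt (N : Network V n) (R : Finset (Fin (2 * n))) (g : OutEdges V) : Prop where
  adj : ∀ u v, g u = some (some v) → N.graph.Adj u v
  wired : ∀ u, g u = some none → u ∈ N.wired
  sink : ∀ u, g u = none ↔ ∃ r ∈ R, u = N.node r

/-- The node with the `i`-th smallest label in `R`. -/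
def rowNode (N : Network V n) (R : HalfSubset n) (i : Fin n) : V :=
  N.node (R.1.orderEmbOfFin R.2 i)

/-- The node with the `i`-th smallest label in the complement of `R`. -/
def colNode (N : Network V n) (R : HalfSubset n) (i : Fin n) : V :=
  N.node (R.1ᶜ.orderEmbOfFin R.card_compl i)

theorem rowNode_injective (N : Network V n) (R : HalfSubset n) :
    Function.Injective (N.rowNode R) :=
  N.node_injective.comp (R.1.orderEmbOfFin R.2).injective

theorem mem_range_rowNode (N : Network V n) (R : HalfSubset n) (u : V) :
    u ∈ Set.range (N.rowNode R) ↔ ∃ r ∈ R.1, u = N.node r := by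
  constructor
  · rintro ⟨i, rfl⟩
    exact ⟨_, R.1.orderEmbOfFin_mem R.2 i, rfl⟩
  · rintro ⟨r, hr, rfl⟩
    have : r ∈ Set.range (R.1.orderEmbOfFin R.2) := by rw [Finset.range_orderEmbOfFin]; exact hr
    obtain ⟨i, rfl⟩ := this
    exact ⟨i, rfl⟩

/-- Send the nodes with label in `R` to those with label in its complement, in ascending order. -/
def nodeShift (N : Network V n) (R : HalfSubset n) : V → V :=
  Function.extend (N.rowNode R) (N.colNode R) id

theorem nodeShift_rowNode (N : Network V n) (R : HalfSubset n) (i : Fin n) :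
    N.nodeShift R (N.rowNode R i) = N.colNode R i :=
  (N.rowNode_injective R).extend_apply _ _ _

/-- The transposed Laplacian, the rows of the nodes with label in `R` being replaced with the unit
vectors at the nodes with label in the complement of `R`. -/
def shiftedLaplacian (N : Network V n) (z : ℂ) (R : HalfSubset n) : Matrix V V ℂ :=
  Matrix.of fun u => if u ∈ Set.range (N.rowNode R) then Pi.single (N.nodeShift R u) 1
    else (N.laplacian z).transpose u

theorem det_shiftedLaplacian (N : Network V n) (z : ℂ) (R : HalfSubset n)
    (hdet : (N.laplacian z).det ≠ 0) :
    (N.shiftedLaplacian z R).det = (N.laplacian z).det * N.greenMinor z R := by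
  have hrow : ∀ u, (N.shiftedLaplacian z R * (N.green z).transpose) u =
      if u ∈ Set.range (N.rowNode R) then (N.green z).transpose (N.nodeShift R u)
        else Pi.single u 1 := by
    intro u
    rw [Matrix.mul_apply_eq_vecMul]
    split_ifs with hu
    · rw [show N.shiftedLaplacian z R u = Pi.single (N.nodeShift R u) 1 from if_pos hu,
        Matrix.single_one_vecMul]
      rfl
    · rw [show N.shiftedLaplacian z R u = (N.laplacian z).transpose u from if_neg hu,
        ← Matrix.mul_apply_eq_vecMul, ← Matrix.transpose_mul, green,
        Matrix.nonsing_inv_mul _ (isUnit_iff_ne_zero.2 hdet), Matrix.transpose_one]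
      ext v
      rw [Matrix.one_apply, Pi.single_apply]
      simp [eq_comm]
  let e : Fin n ≃ {u : V // ∃ i, N.rowNode R i = u} :=
    Equiv.ofInjective _ (N.rowNode_injective R)
  have hminor : (N.shiftedLaplacian z R * (N.green z).transpose).det = N.greenMinor z R := by
    rw [Matrix.det_eq_det_toSquareBlockProp _ (fun u => ∃ i, N.rowNode R i = u)
      fun u hu => by rw [hrow]; exact if_neg hu, greenMinor, ← Matrix.det_transpose,
      ← Matrix.det_submatrix_equiv_self e]
    congr 1
    ext i j
    rw [Matrix.submatrix_apply, Matrix.transpose_apply, Matrix.toSquareBlockProp_def,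
      Matrix.of_apply, hrow, if_pos (Set.mem_range.2 (e j).2)]
    rw [show (e j : V) = N.rowNode R j from rfl, nodeShift_rowNode]
    rfl
  rw [← hminor, Matrix.det_mul, Matrix.det_transpose, green, Matrix.det_nonsing_inv,
    Ring.inverse_eq_inv', mul_comm, mul_assoc, inv_mul_cancel₀ hdet, mul_one]

/-- The weight of an edge going out of `u` in a spanning forest rooted at the nodes with label in
`R`. -/
def edgeCoeff (N : Network V n) (R : HalfSubset n) (u : V) : Option (Option V) → ℂ
  | none => if u ∈ Set.range (N.rowNode R) then 1 else 0
  | some none => if u ∈ Set.range (N.rowNode R) then 0 else if u ∈ N.wired then 1 else 0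
  | some (some v) => if u ∈ Set.range (N.rowNode R) then 0 else
      if N.graph.Adj u v then (N.conductance u v : ℂ) else 0

theorem shiftedLaplacian_row (N : Network V n) (z : ℂ) (R : HalfSubset n) (u : V) :
    N.shiftedLaplacian z R u = ∑ o, N.edgeCoeff R u o •
      OutEdges.connectionRow (N.transport z) (N.nodeShift R) u o := by
  rw [Fintype.sum_option, Fintype.sum_option]
  by_cases hu : u ∈ Set.range (N.rowNode R)
  · rw [show N.shiftedLaplacian z R u = Pi.single (N.nodeShift R u) 1 from if_pos hu]
    simp only [edgeCoeff, hu, if_true, zero_smul, Finset.sum_const_zero, add_zero, one_smul,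
      OutEdges.connectionRow]
  · rw [show N.shiftedLaplacian z R u = (N.laplacian z).transpose u from if_neg hu]
    simp only [edgeCoeff, hu, if_false, zero_smul, zero_add, OutEdges.connectionRow]
    ext v
    simp only [Matrix.transpose_apply, laplacian, Matrix.of_apply, Pi.add_apply, Pi.smul_apply,
      Finset.sum_apply, Pi.sub_apply, Pi.single_apply, smul_eq_mul]
    have hsum : ∑ x, (if N.graph.Adj u x then (N.conductance u x : ℂ) else 0) *
        ((if v = u then 1 else 0) - N.transport z u x * if v = x then 1 else 0) =
        (if v = u then ∑ x : V with N.graph.Adj u x, (N.conductance u x : ℂ) else 0) -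
          if N.graph.Adj u v then (N.conductance u v : ℂ) * N.transport z u v else 0 := by
      simp only [mul_sub, Finset.sum_sub_distrib, ← Finset.sum_mul, Finset.sum_filter]
      congr 1
      · split_ifs <;> simp
      · rw [Finset.sum_eq_single v]
        · simp only [if_true, mul_one, ite_mul, zero_mul]
        · intro x _ hx
          simp [hx.symm]
        · simp
    rw [hsum]
    have htr : (N.transport z v u)⁻¹ = N.transport z u v := by
      rw [transport, transport, N.crossing_swap u v, zpow_neg, inv_inv]
    by_cases hvu : v = u
    · subst hvu
      simp [add_comm]
    · rw [if_neg hvu, if_neg hvu, if_neg hvu, htr, N.conductance_symm v u, N.graph.adj_comm v u]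
      split_ifs <;> simp

theorem prod_edgeCoeff (N : Network V n) (R : HalfSubset n) (g : OutEdges V) :
    ∏ u, N.edgeCoeff R u (g u) = if N.IsRootedAt R.1 g then
      g.edgeProd (fun u v => (N.conductance u v : ℂ)) Finset.univ else 0 := by
  split_ifs with hg
  · rw [OutEdges.edgeProd_eq]
    refine Finset.prod_congr rfl fun u _ => ?_
    have hu := hg.sink u
    rw [← N.mem_range_rowNode] at hu
    unfold OutEdges.arrowVal
    rcases h : g u with _ | _ | v
    · simp only [edgeCoeff, if_pos (hu.1 h)]
    · have hnot := fun h' => (Option.some_ne_none _) (h.symm.trans (hu.2 h'))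
      simp only [edgeCoeff, if_neg hnot, if_pos (hg.wired u h)]
    · have hnot := fun h' => (Option.some_ne_none _) (h.symm.trans (hu.2 h'))
      simp only [edgeCoeff, if_neg hnot, if_pos (hg.adj u v h)]
  · by_contra hne
    rw [← Ne, Finset.prod_ne_zero_iff] at hne
    apply hg
    refine ⟨fun u v h => ?_, fun u h => ?_, fun u => ?_⟩
    · have := hne u (Finset.mem_univ _)
      rw [h] at this
      by_contra hcon
      simp [edgeCoeff, hcon] at this
    · have := hne u (Finset.mem_univ _)
      rw [h] at this
      by_contra hcon
      simp [edgeCoeff, hcon] at this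
    · have := hne u (Finset.mem_univ _)
      rw [← N.mem_range_rowNode]
      by_cases hu : u ∈ Set.range (N.rowNode R)
      · refine iff_of_true ?_ hu
        rcases h : g u with _ | _ | v
        · rfl
        · rw [h] at this; simp only [edgeCoeff, if_pos hu] at this; exact absurd rfl this
        · rw [h] at this; simp only [edgeCoeff, if_pos hu] at this; exact absurd rfl this
      · refine iff_of_false (fun h => ?_) hu
        rw [h] at this; simp only [edgeCoeff, if_neg hu] at this; exact absurd rfl this

theorem det_mul_greenMinor (N : Network V n) (z : ℂ) (R : HalfSubset n)
    (hdet : (N.laplacian z).det ≠ 0) :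
    (N.laplacian z).det * N.greenMinor z R = ∑ g : OutEdges V with N.IsRootedAt R.1 g,
      g.edgeProd (fun u v => (N.conductance u v : ℂ)) Finset.univ *
        (g.connectionMatrix (N.transport z) (N.nodeShift R)).det := by
  rw [← N.det_shiftedLaplacian z R hdet]
  have h1 : N.shiftedLaplacian z R = fun u => ∑ o, N.edgeCoeff R u o •
      OutEdges.connectionRow (N.transport z) (N.nodeShift R) u o :=
    funext (N.shiftedLaplacian_row z R)
  have h2 := (Matrix.detRowAlternating (n := V) (R := ℂ)).toMultilinearMap.map_sum
    fun u o => N.edgeCoeff R u o • OutEdges.connectionRow (N.transport z) (N.nodeShift R) u o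
  rw [← h1] at h2
  rw [Finset.sum_filter]
  refine Eq.trans h2 (Finset.sum_congr rfl fun g _ => ?_)
  rw [MultilinearMap.map_smul_univ, prod_edgeCoeff, smul_eq_mul, ite_mul, zero_mul]
  rfl

end Network

end

section
theorem Equiv.Perm.SameCycle.apply_eq_of_invariant {α β : Type*} [Finite α] {ρ : Equiv.Perm α}
    {f : α → β} (hf : ∀ a, f (ρ a) = f a) {a b : α} (h : ρ.SameCycle a b) : f a = f b := by
  obtain ⟨i, _, rfl⟩ := h.exists_pow_eq'
  induction i with
  | zero => rfl
  | succ i ih =>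
    rw [pow_succ', Equiv.Perm.mul_apply, hf]
    exact ih (by omega) (Equiv.Perm.sameCycle_pow_right.2 (.refl _ _))

namespace PlanarMap

open Classical

variable {V : Type*} [Fintype V] (M : PlanarMap V)

theorem facePerm_apply (d : M.graph.Dart) : M.facePerm d = M.rot.symm d.symm := rfl

theorem facePerm_symm_rot (d : M.graph.Dart) : M.facePerm (M.rot d).symm = d := by
  rw [facePerm_apply, SimpleGraph.Dart.symm_symm, Equiv.symm_apply_apply]

theorem rot_fst (d : M.graph.Dart) : (M.rot d).fst = d.fst :=
  ((M.rot_sameCycle d (M.rot d)).1 (Equiv.Perm.sameCycle_apply_right.2 (.refl _ _))).symm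

/-- A property of vertices that propagates along the edges holds everywhere. -/
theorem vertex_induction {p : V → Prop} {x : V} (hx : p x)
    (hadj : ∀ d : M.graph.Dart, p d.fst → p d.snd) (y : V) : p y := by
  have h := M.connected.preconnected x y
  rw [SimpleGraph.reachable_iff_reflTransGen] at h
  induction h with
  | refl => exact hx
  | tail _ h ih => exact hadj ⟨(_, _), h⟩ ih

/-- The faces of the map. -/
abbrev Face : Type _ := Quotient (Equiv.Perm.SameCycle.setoid M.facePerm)

/-- The antisymmetric functions on oriented edges. -/
def chains : Submodule ℚ (M.graph.Dart → ℚ) where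
  carrier := {c | ∀ d, c d.symm = - c d}
  add_mem' ha hb d := by simp only [Pi.add_apply, ha d, hb d]; ring
  zero_mem' d := by simp
  smul_mem' r a ha d := by simp [ha d]

/-- The divergence of an antisymmetric function. -/
def divergence : M.chains →ₗ[ℚ] (V → ℚ) where
  toFun c x := ∑ d : M.graph.Dart with d.fst = x, c.1 d
  map_add' a b := by ext x; simp [Finset.sum_add_distrib]
  map_smul' r a := by ext x; simp [Finset.mul_sum]

/-- The boundary of a function on faces. -/
def boundary : (M.Face → ℚ) →ₗ[ℚ] M.chains where
  toFun h := ⟨fun d => h (Quotient.mk _ d) - h (Quotient.mk _ d.symm), fun d => by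
    dsimp only
    rw [SimpleGraph.Dart.symm_symm]; ring⟩
  map_add' a b := by ext d; simp only [Pi.add_apply, Submodule.coe_add]; ring
  map_smul' r a := by ext d; simp [mul_sub]

theorem mk_facePerm (d : M.graph.Dart) :
    (Quotient.mk _ (M.facePerm d) : M.Face) = Quotient.mk _ d :=
  Quotient.sound (Equiv.Perm.sameCycle_apply_left.2 (.refl _ _))

theorem divergence_boundary (h : M.Face → ℚ) : M.divergence (M.boundary h) = 0 := by
  ext x
  change ∑ d : M.graph.Dart with d.fst = x,
    (h (Quotient.mk _ d) - h (Quotient.mk _ d.symm)) = 0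
  rw [Finset.sum_sub_distrib, sub_eq_zero]
  refine Finset.sum_equiv M.rot (fun d => ?_) fun d _ => ?_
  · simp [rot_fst]
  · rw [← M.mk_facePerm (M.rot d).symm, facePerm_symm_rot]

theorem finrank_chains_le : Module.finrank ℚ M.chains ≤ Nat.card M.graph.edgeSet := by
  have hdart : ∀ e : M.graph.edgeSet, ∃ d : M.graph.Dart, d.edge = e := by
    rintro ⟨e, he⟩
    induction e with
    | _ u v => exact ⟨⟨(u, v), he⟩, rfl⟩
  choose s hs using hdart
  let F : M.chains →ₗ[ℚ] (M.graph.edgeSet → ℚ) :=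
    { toFun := fun c e => c.1 (s e)
      map_add' := fun a b => rfl
      map_smul' := fun r a => rfl }
  have hF : Function.Injective F := by
    rw [← LinearMap.ker_eq_bot, LinearMap.ker_eq_bot']
    intro c hc
    ext d
    have h1 : c.1 (s ⟨d.edge, d.edge_mem⟩) = 0 := congrFun hc ⟨d.edge, d.edge_mem⟩
    rcases (SimpleGraph.dart_edge_eq_iff _ _).1 (hs ⟨d.edge, d.edge_mem⟩) with h2 | h2
    · rw [h2] at h1; exact h1
    · rw [h2, c.2 d, neg_eq_zero] at h1; exact h1
  have := LinearMap.finrank_le_finrank_of_injective hF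
  rwa [Module.finrank_fintype_fun_eq_card, ← Nat.card_eq_fintype_card] at this

theorem card_le_finrank_range_divergence :
    Fintype.card V ≤ Module.finrank ℚ (LinearMap.range M.divergence) + 1 := by
  obtain ⟨x⟩ := M.connected.nonempty
  have htop : LinearMap.range M.divergence ⊔ Submodule.span ℚ {Pi.single x 1} = ⊤ := by
    have hmem : ∀ y, (Pi.single y 1 : V → ℚ) ∈
        LinearMap.range M.divergence ⊔ Submodule.span ℚ {Pi.single x 1} := by
      refine M.vertex_induction (x := x)
        (Submodule.mem_sup_right (Submodule.mem_span_singleton_self _)) fun d hd => ?_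
      have hc : (Pi.single d 1 - Pi.single d.symm 1 : M.graph.Dart → ℚ) ∈ M.chains := by
        intro e
        simp only [Pi.sub_apply, Pi.single_apply, SimpleGraph.Dart.symm_involutive.eq_iff,
          SimpleGraph.Dart.symm_symm]
        simp only [neg_sub]
      have hdiv : M.divergence ⟨_, hc⟩ = Pi.single d.fst 1 - Pi.single d.snd 1 := by
        ext y
        change ∑ e : M.graph.Dart with e.fst = y,
          (Pi.single d 1 - Pi.single d.symm 1 : M.graph.Dart → ℚ) e = _
        simp only [Pi.sub_apply, Finset.sum_sub_distrib, Pi.single_apply, Finset.sum_ite_eq',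
          Finset.mem_filter, Finset.mem_univ, true_and, eq_comm (a := y)]
        rfl
      have h2 : (Pi.single d.snd 1 : V → ℚ) =
          Pi.single d.fst 1 - M.divergence ⟨_, hc⟩ := by rw [hdiv]; abel
      rw [h2]
      exact Submodule.sub_mem _ hd (Submodule.mem_sup_left (LinearMap.mem_range_self _ _))
    rw [eq_top_iff]
    intro f _
    rw [pi_eq_sum_univ' f]
    exact Submodule.sum_mem _ fun y _ => Submodule.smul_mem _ _ (hmem y)
  have h1 := Submodule.finrank_add_le_finrank_add_finrank (LinearMap.range M.divergence)
    (Submodule.span ℚ {(Pi.single x 1 : V → ℚ)})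
  rw [htop, finrank_top, Module.finrank_fintype_fun_eq_card,
    finrank_span_singleton (by simp)] at h1
  exact h1

theorem card_face_le_finrank_range_boundary :
    Nat.card M.Face ≤ Module.finrank ℚ (LinearMap.range M.boundary) + 1 := by
  have hker : Module.finrank ℚ (LinearMap.ker M.boundary) ≤ 1 := by
    have hle : LinearMap.ker M.boundary ≤ Submodule.span ℚ {(1 : M.Face → ℚ)} := by
      intro h hh
      rw [LinearMap.mem_ker] at hh
      have hsymm : ∀ d : M.graph.Dart, h (Quotient.mk _ d) = h (Quotient.mk _ d.symm) := fun d =>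
        sub_eq_zero.1 (congrFun (congrArg Subtype.val hh) d)
      have hrot : ∀ d : M.graph.Dart,
          h (Quotient.mk _ (M.rot d)) = h (Quotient.mk _ d) := fun d => by
        rw [hsymm, ← M.mk_facePerm (M.rot d).symm, facePerm_symm_rot]
      rw [Submodule.mem_span_singleton]
      by_cases hne : Nonempty M.graph.Dart
      · obtain ⟨d₀⟩ := hne
        have hall := M.vertex_induction (x := d₀.fst)
          (p := fun y => ∀ e : M.graph.Dart, e.fst = y →
            h (Quotient.mk _ e) = h (Quotient.mk _ d₀))
          (fun e he => Equiv.Perm.SameCycle.apply_eq_of_invariant (ρ := M.rot)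
            (f := fun d => h (Quotient.mk _ d)) hrot ((M.rot_sameCycle _ _).2 he))
          (fun d hd e he => by
            rw [← hd d rfl, hsymm d]
            exact Equiv.Perm.SameCycle.apply_eq_of_invariant (ρ := M.rot)
              (f := fun d => h (Quotient.mk _ d)) hrot ((M.rot_sameCycle _ _).2 he))
        refine ⟨h (Quotient.mk _ d₀), ?_⟩
        ext f
        induction f using Quotient.inductionOn with
        | _ d => simp [hall d.fst d rfl]
      · refine ⟨0, ?_⟩
        ext f
        induction f using Quotient.inductionOn with
        | _ d => exact absurd ⟨d⟩ hne
    calc _ ≤ Module.finrank ℚ (Submodule.span ℚ {(1 : M.Face → ℚ)}) :=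
          Submodule.finrank_mono hle
      _ ≤ 1 := (finrank_span_le_card _).trans (by simp)
  have h1 := LinearMap.finrank_range_add_finrank_ker M.boundary
  rw [Module.finrank_fintype_fun_eq_card, ← Nat.card_eq_fintype_card] at h1
  omega

/-- On a planar map, the antisymmetric functions without divergence derive from a function on
the faces. -/
theorem exists_face_potential (c : M.graph.Dart → ℚ) (hc : ∀ d, c d.symm = - c d)
    (hdiv : ∀ x, ∑ d : M.graph.Dart with d.fst = x, c d = 0) :
    ∃ h : M.graph.Dart → ℚ, (∀ d, h (M.facePerm d) = h d) ∧ ∀ d, c d = h d - h d.symm := by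
  have hle : LinearMap.range M.boundary ≤ LinearMap.ker M.divergence := by
    rintro _ ⟨h, rfl⟩
    exact M.divergence_boundary h
  have heq : LinearMap.range M.boundary = LinearMap.ker M.divergence := by
    refine Submodule.eq_of_le_of_finrank_le hle ?_
    have h1 := LinearMap.finrank_range_add_finrank_ker M.divergence
    have h2 := M.finrank_chains_le
    have h3 := M.card_le_finrank_range_divergence
    have h4 := M.card_face_le_finrank_range_boundary
    have h5 : Fintype.card V + Nat.card M.Face = Nat.card M.graph.edgeSet + 2 := M.euler
    omega
  have hmem : (⟨c, hc⟩ : M.chains) ∈ LinearMap.ker M.divergence := funext hdiv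
  rw [← heq] at hmem
  obtain ⟨h, hh⟩ := hmem
  refine ⟨fun d => h (Quotient.mk _ d), fun d => congrArg h (M.mk_facePerm d), fun d => ?_⟩
  exact (congrFun (congrArg Subtype.val hh) d).symm

end PlanarMap

end

section
/-- A function whose only increments along a cycle of a permutation are `1` after `p` and `-1`
after `q` takes at most two consecutive values there. -/
theorem Equiv.Perm.SameCycle.bounds_of_jumps {α : Type*} [Finite α] [DecidableEq α]
    {ρ : Equiv.Perm α} {f : α → ℤ} {s : Set α} {p q : α}
    (hs : ∀ a ∈ s, ∀ b ∈ s, ρ.SameCycle a b) (hρ : ∀ a ∈ s, ρ a ∈ s) (hp : p ∈ s)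
    (hf : ∀ a ∈ s, f (ρ a) - f a = (if a = p then 1 else 0) - if a = q then 1 else 0)
    (a : α) (ha : a ∈ s) : (f p ≤ f a ∧ f a ≤ f p + 1) ∧ (p = q → f a = f p) := by
  have hpow : ∀ b ∈ s, ∀ i : ℕ, (ρ ^ i) b ∈ s := fun b hb i => by
    induction i with
    | zero => exact hb
    | succ i ih => rw [pow_succ', Equiv.Perm.mul_apply]; exact hρ _ ih
  refine ⟨⟨?_, ?_⟩, ?_⟩
  · by_contra hlt
    obtain ⟨i, _, hi⟩ := (hs a ha p hp).exists_pow_eq'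
    have key : ∀ i : ℕ, f ((ρ ^ i) a) < f p := by
      intro i
      induction i with
      | zero => simpa using hlt
      | succ i ih =>
        have h1 := hf _ (hpow a ha i)
        rw [if_neg (fun h => by rw [h] at ih; omega)] at h1
        rw [pow_succ', Equiv.Perm.mul_apply]
        split_ifs at h1 <;> omega
    have := key i
    rw [hi] at this
    omega
  · by_contra hlt
    obtain ⟨i, _, hi⟩ := (hs p hp a ha).exists_pow_eq'
    have key : ∀ i : ℕ, f ((ρ ^ i) p) ≤ f p + 1 := by
      intro i
      induction i with
      | zero => simp
      | succ i ih =>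
        have h1 := hf _ (hpow p hp i)
        rw [pow_succ', Equiv.Perm.mul_apply]
        by_cases hip : (ρ ^ i) p = p
        · rw [hip] at h1 ⊢
          split_ifs at h1 <;> omega
        · rw [if_neg hip] at h1
          split_ifs at h1 <;> omega
    have := key i
    rw [hi] at this
    omega
  · rintro rfl
    obtain ⟨i, _, rfl⟩ := (hs p hp a ha).exists_pow_eq'
    clear ha
    induction i with
    | zero => rfl
    | succ i ih =>
      have h1 := hf _ (hpow p hp i)
      rw [pow_succ', Equiv.Perm.mul_apply]
      rw [sub_self] at h1
      rw [← ih (by omega)]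
      omega

theorem List.sum_map_sub_of_isChain {α : Type*} (f f' : α → ℤ) (l : List α) (hne : l ≠ [])
    (h : l.IsChain fun d e => f' d = f e) :
    (l.map fun d => f d - f' d).sum = f (l.head hne) - f' (l.getLast hne) := by
  induction l with
  | nil => exact absurd rfl hne
  | cons a l ih =>
    rcases l with _ | ⟨b, l⟩
    · simp
    · rw [List.isChain_cons_cons] at h
      have hne' : b :: l ≠ [] := List.cons_ne_nil _ _
      rw [List.map_cons, List.sum_cons, ih hne' h.2, List.head_cons, List.head_cons,
        List.getLast_cons hne', h.1]
      ring

namespace PlanarMap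

open Classical Relation

variable {V : Type*} [Fintype V] (M : PlanarMap V)

theorem exists_int_face_potential (c : M.graph.Dart → ℤ) (hc : ∀ d, c d.symm = - c d)
    (hdiv : ∀ x, ∑ d : M.graph.Dart with d.fst = x, c d = 0) :
    ∃ h : M.graph.Dart → ℤ, (∀ d, h (M.facePerm d) = h d) ∧ ∀ d, c d = h d - h d.symm := by
  obtain ⟨h, h1, h2⟩ := M.exists_face_potential (fun d => (c d : ℚ))
    (fun d => by rw [hc]; push_cast; rfl) (fun x => by exact_mod_cast hdiv x)
  refine ⟨fun d => ⌊h d⌋, fun d => congrArg Int.floor (h1 d), fun d => ?_⟩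
  have h3 : h d = h d.symm + (c d : ℚ) := by rw [h2 d]; ring
  dsimp only
  rw [h3, Int.floor_add_intCast]
  ring

/-- The function on oriented edges counting the edges of the path of `g` starting at `u`. -/
def pathFlow (g : OutEdges V) (u : V) (d : M.graph.Dart) : ℤ :=
  if d.fst ∈ g.trail u ∧ g.Arrow d.fst d.snd then 1 else 0

variable {M} {g : OutEdges V} {u x : V}

theorem pathFlow_of_notMem {d : M.graph.Dart} (h : d.fst ∉ g.trail u) : M.pathFlow g u d = 0 :=
  if_neg fun h' => h h'.1

theorem pathFlow_symm_of_notMem {d : M.graph.Dart} (h : d.fst ∉ g.trail u) :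
    M.pathFlow g u d.symm = 0 :=
  if_neg fun h' => h (OutEdges.mem_trail.2 ((OutEdges.mem_trail.1 h'.1).tail h'.2))

theorem sum_pathFlow {b : V} (hadj : ∀ u v, g u = some (some v) → M.graph.Adj u v)
    (hu : ReflTransGen g.Arrow u b) (hb : g b = none) (x : V) :
    ∑ d : M.graph.Dart with d.fst = x, (M.pathFlow g u d - M.pathFlow g u d.symm) =
      (if x = u then 1 else 0) - if x = b then 1 else 0 := by
  induction hu using ReflTransGen.head_induction_on with
  | refl =>
    rw [sub_self]
    refine Finset.sum_eq_zero fun d _ => ?_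
    have h0 : ∀ d : M.graph.Dart, M.pathFlow g b d = 0 := fun d => if_neg fun h => by
      rw [OutEdges.trail_of_none hb, Finset.mem_singleton] at h
      exact OutEdges.not_arrow (h.1 ▸ hb) h.2
    rw [h0, h0, sub_self]
  | @head u v h hv ih =>
    let d₀ : M.graph.Dart := ⟨(u, v), hadj u v h⟩
    have hd₀ : ∀ d : M.graph.Dart, d = d₀ ↔ d.fst = u ∧ d.snd = v := fun d => by
      rw [SimpleGraph.Dart.ext_iff, Prod.ext_iff]
    have hflow : ∀ d : M.graph.Dart, M.pathFlow g u d =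
        (if d = d₀ then 1 else 0) + M.pathFlow g v d := by
      intro d
      unfold pathFlow
      simp only [OutEdges.mem_trail_of_arrow h, hd₀]
      have hnot := OutEdges.notMem_trail_of_arrow h hv hb
      by_cases hdu : d.fst = u
      · rw [hdu]
        have : g.Arrow u d.snd ↔ d.snd = v := ⟨fun h' => h'.unique h, fun e => e ▸ h⟩
        simp [hnot, this]
      · simp [hdu]
    have hsymm : ∀ d : M.graph.Dart, d.symm = d₀ ↔ d = d₀.symm :=
      fun d => SimpleGraph.Dart.symm_involutive.eq_iff
    have e1 : ∑ d : M.graph.Dart with d.fst = x, (if d = d₀ then 1 else 0) =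
        if x = u then (1 : ℤ) else 0 := by
      rw [Finset.sum_ite_eq']
      simp [d₀, eq_comm]
    have e2 : ∑ d : M.graph.Dart with d.fst = x, (if d.symm = d₀ then 1 else 0) =
        if x = v then (1 : ℤ) else 0 := by
      simp only [hsymm]
      rw [Finset.sum_ite_eq']
      simp [d₀, eq_comm]
    have e3 : ∀ d : M.graph.Dart, M.pathFlow g u d - M.pathFlow g u d.symm =
        ((if d = d₀ then 1 else 0) - (if d.symm = d₀ then 1 else 0)) +
          (M.pathFlow g v d - M.pathFlow g v d.symm) := fun d => by
      rw [hflow, hflow]; ring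
    simp only [e3]
    rw [Finset.sum_add_distrib, Finset.sum_sub_distrib, e1, e2, ih]
    ring

theorem snd_eq_facePerm_fst (d : M.graph.Dart) : (M.facePerm d).fst = d.snd := by
  have h := M.rot_fst (M.facePerm d)
  rw [facePerm_apply, Equiv.apply_symm_apply] at h
  exact h.symm

variable (M) in
/-- The boundary edges met when following clockwise the face on the left of `s`. -/
def boundaryDart (s : M.graph.Dart) (k : ℕ) : M.graph.Dart := (M.facePerm.symm ^ k) s

theorem facePerm_boundaryDart (s : M.graph.Dart) (k : ℕ) :
    M.facePerm (M.boundaryDart s (k + 1)) = M.boundaryDart s k := by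
  rw [boundaryDart, pow_succ', Equiv.Perm.mul_apply, Equiv.apply_symm_apply]
  rfl

theorem boundaryDart_snd (s : M.graph.Dart) (k : ℕ) :
    (M.boundaryDart s (k + 1)).snd = (M.boundaryDart s k).fst := by
  rw [← snd_eq_facePerm_fst, facePerm_boundaryDart]

theorem sameFace_boundaryDart (s : M.graph.Dart) (k : ℕ) : M.SameFace (M.boundaryDart s k) s := by
  have h : ∀ k, M.facePerm.SameCycle s (M.boundaryDart s k) := fun k => by
    unfold boundaryDart
    rw [← Equiv.Perm.sameCycle_inv]
    exact Equiv.Perm.sameCycle_pow_right.2 (.refl _ _)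
  exact (h k).symm

theorem boundaryDart_injOn (s : M.graph.Dart) {k l : ℕ}
    (hk : k < Function.minimalPeriod M.facePerm s) (hl : l < Function.minimalPeriod M.facePerm s)
    (h : M.boundaryDart s k = M.boundaryDart s l) : k = l := by
  have key : ∀ k l, l < Function.minimalPeriod M.facePerm s → k < l →
      M.boundaryDart s k ≠ M.boundaryDart s l := by
    intro k l hl hkl h
    have h1 : ∀ i j, (M.facePerm ^ i) (M.boundaryDart s (j + i)) = M.boundaryDart s j := by
      intro i
      induction i with
      | zero => intro j; rfl
      | succ i ih =>
        intro j
        rw [pow_succ, Equiv.Perm.mul_apply, ← add_assoc, facePerm_boundaryDart, ih]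
    have h2 := h1 k 0
    have h3 := h1 k (l - k)
    rw [zero_add] at h2
    rw [show l - k + k = l by omega, ← h, h2] at h3
    have h4 := h1 (l - k) 0
    rw [zero_add, ← h3] at h4
    have h5 : Function.IsPeriodicPt M.facePerm (l - k) s := by
      rw [Function.IsPeriodicPt, Function.IsFixedPt, Equiv.Perm.iterate_eq_pow]
      exact h4
    have := h5.minimalPeriod_le (by omega)
    omega
  rcases lt_trichotomy k l with h' | h' | h'
  · exact absurd h (key k l hl h')
  · exact h'
  · exact absurd h.symm (key l k hk h')

variable (M) in
/-- The function on oriented edges counting the `m` boundary edges that follow the `k`-th one. -/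
def arcFlow (s : M.graph.Dart) (k m : ℕ) (d : M.graph.Dart) : ℤ :=
  ∑ i ∈ Finset.range m, if d = M.boundaryDart s (k + i + 1) then 1 else 0

theorem sum_arcFlow (s : M.graph.Dart) (k m : ℕ) (x : V) :
    ∑ d : M.graph.Dart with d.fst = x, (M.arcFlow s k m d - M.arcFlow s k m d.symm) =
      (if x = (M.boundaryDart s (k + m)).fst then 1 else 0) -
        if x = (M.boundaryDart s k).fst then 1 else 0 := by
  have h1 : ∀ e : M.graph.Dart, ∑ d : M.graph.Dart with d.fst = x,
      ((if d = e then (1 : ℤ) else 0) - if d.symm = e then 1 else 0) =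
        (if x = e.fst then 1 else 0) - if x = e.snd then 1 else 0 := by
    intro e
    have hsymm : ∀ d : M.graph.Dart, d.symm = e ↔ d = e.symm :=
      fun d => SimpleGraph.Dart.symm_involutive.eq_iff
    simp only [hsymm]
    rw [Finset.sum_sub_distrib, Finset.sum_ite_eq', Finset.sum_ite_eq']
    simp [eq_comm]
  unfold arcFlow
  simp only [← Finset.sum_sub_distrib]
  rw [Finset.sum_comm]
  simp only [h1, boundaryDart_snd]
  exact Finset.sum_range_sub
    (fun i => if x = (M.boundaryDart s (k + i)).fst then (1 : ℤ) else 0) m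

theorem arcFlow_facePerm (s : M.graph.Dart) (k m : ℕ) (d : M.graph.Dart) :
    M.arcFlow s k m (M.facePerm d) - M.arcFlow s k m d =
      (if M.facePerm d = M.boundaryDart s (k + m) then 1 else 0) -
        if M.facePerm d = M.boundaryDart s k then 1 else 0 := by
  unfold arcFlow
  have h1 : ∀ i, d = M.boundaryDart s (k + i + 1) ↔ M.facePerm d = M.boundaryDart s (k + i) :=
    fun i => by rw [← facePerm_boundaryDart s (k + i), M.facePerm.injective.eq_iff]
  simp only [h1]
  rw [← Finset.sum_sub_distrib]
  exact Finset.sum_range_sub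
    (fun i => if M.facePerm d = M.boundaryDart s (k + i) then (1 : ℤ) else 0) m

theorem arcFlow_boundaryDart (s : M.graph.Dart) {k m j : ℕ}
    (hm : k + m < Function.minimalPeriod M.facePerm s)
    (hj : j < Function.minimalPeriod M.facePerm s) :
    M.arcFlow s k m (M.boundaryDart s j) = if k < j ∧ j ≤ k + m then 1 else 0 := by
  unfold arcFlow
  have h1 : ∀ i ∈ Finset.range m, (if M.boundaryDart s j = M.boundaryDart s (k + i + 1) then
      (1 : ℤ) else 0) = if j = k + i + 1 then 1 else 0 := by
    intro i hi
    rw [Finset.mem_range] at hi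
    have : M.boundaryDart s j = M.boundaryDart s (k + i + 1) ↔ j = k + i + 1 :=
      ⟨boundaryDart_injOn s hj (by omega), fun h => h ▸ rfl⟩
    simp only [this]
  rw [Finset.sum_congr rfl h1]
  split_ifs with h
  · rw [Finset.sum_eq_single (j - k - 1)]
    · rw [if_pos (by omega)]
    · intro i _ hi
      rw [if_neg (by omega)]
    · intro hi
      rw [Finset.mem_range] at hi
      omega
  · refine Finset.sum_eq_zero fun i hi => ?_
    rw [Finset.mem_range] at hi
    rw [if_neg (by omega)]

theorem arcFlow_of_not_sameFace {s d : M.graph.Dart} (k m : ℕ) (h : ¬ M.SameFace d s) :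
    M.arcFlow s k m d = 0 :=
  Finset.sum_eq_zero fun _ _ => if_neg (by rintro rfl; exact h (sameFace_boundaryDart s _))

end PlanarMap

end

section
namespace Network

open Classical Relation PlanarMap OutEdges

variable {V : Type*} [Fintype V] {n : ℕ} (N : Network V n)

/-- The boundary edge of the outer face crossed by the zipper. -/
def outerDart : N.graph.Dart := (N.zipper.getLast N.zipper_ne_nil).symm

/-- The rank of a node along the boundary of the outer face. -/
def nodePos : Fin (2 * n) → ℕ := N.node_boundary.choose

theorem nodePos_strictMono : StrictMono N.nodePos := N.node_boundary.choose_spec.1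

theorem nodePos_lt (c : Fin (2 * n)) :
    N.nodePos c < Function.minimalPeriod N.toPlanarMap.facePerm N.outerDart :=
  (N.node_boundary.choose_spec.2 c).1

/-- The boundary edge of the outer face going out of a node. -/
def nodeDart (c : Fin (2 * n)) : N.graph.Dart :=
  N.toPlanarMap.boundaryDart N.outerDart (N.nodePos c)

theorem nodeDart_fst (c : Fin (2 * n)) : (N.nodeDart c).fst = N.node c :=
  (N.node_boundary.choose_spec.2 c).2.symm

/-- The function `H` tells the two sides of a path with vertex set `P` from the node `a` to the
node `b`, where `a < b`, which crosses the zipper `κ` times. -/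
structure IsSide (P : Finset V) (a b : Fin (2 * n)) (κ : ℤ) (H : N.graph.Dart → ℤ) : Prop where
  values : ∀ d, H d = 0 ∨ H d = -1
  symm : ∀ d : N.graph.Dart, d.fst ∉ P → H d.symm = H d
  fst : ∀ d e : N.graph.Dart, d.fst = e.fst → d.fst ∉ P → H d = H e
  node : ∀ c, H (N.nodeDart c) = if a < c ∧ c ≤ b then -1 else 0
  crossing : H (N.zipper.head N.zipper_ne_nil) = κ

theorem edgeSum_crossing_trail (g : OutEdges V) (u : V) :
    g.edgeSum N.crossing (g.trail u) =
      (N.zipper.map fun d => N.toPlanarMap.pathFlow g u d -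
        N.toPlanarMap.pathFlow g u d.symm).sum := by
  have hone : ∀ d : N.graph.Dart, ∑ x ∈ g.trail u, arrowVal g (0 : ℤ)
      (fun v w => if d.toProd = (v, w) then 1 else 0) x = N.toPlanarMap.pathFlow g u d := by
    intro d
    have hval : ∀ x, arrowVal g (0 : ℤ) (fun v w => if d.toProd = (v, w) then 1 else 0) x =
        if x = d.fst ∧ g.Arrow d.fst d.snd then 1 else 0 := by
      intro x
      by_cases hx : ∃ y, g.Arrow x y
      · obtain ⟨y, hy⟩ := hx
        rw [arrowVal_of_arrow hy]
        have : d.toProd = (x, y) ↔ x = d.fst ∧ g.Arrow d.fst d.snd := by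
          rw [Prod.ext_iff]
          constructor
          · rintro ⟨rfl, rfl⟩; exact ⟨rfl, hy⟩
          · rintro ⟨rfl, h⟩; exact ⟨rfl, h.unique hy⟩
        simp only [this]
      · push Not at hx
        rw [arrowVal_of_not hx, if_neg]
        rintro ⟨rfl, h⟩
        exact hx _ h
    simp only [hval]
    unfold pathFlow
    by_cases h : g.Arrow d.fst d.snd
    · simp [h]
    · simp [h]
  have key : ∀ l : List N.graph.Dart, ∑ x ∈ g.trail u, arrowVal g (0 : ℤ)
      (fun v w => ((l.map SimpleGraph.Dart.toProd).count (v, w) : ℤ) -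
        ((l.map SimpleGraph.Dart.toProd).count (w, v) : ℤ)) x =
      (l.map fun d => N.toPlanarMap.pathFlow g u d -
        N.toPlanarMap.pathFlow g u d.symm).sum := by
    intro l
    induction l with
    | nil =>
      refine Finset.sum_eq_zero fun x _ => ?_
      unfold arrowVal
      split <;> simp
    | cons d l ih =>
      rw [List.map_cons, List.map_cons, List.sum_cons, ← ih, ← hone, ← hone,
        ← Finset.sum_sub_distrib, ← Finset.sum_add_distrib]
      refine Finset.sum_congr rfl fun x _ => ?_
      by_cases hx : ∃ y, g.Arrow x y
      · obtain ⟨y, hy⟩ := hx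
        simp only [arrowVal_of_arrow hy, List.count_cons, beq_iff_eq]
        have : d.symm.toProd = (x, y) ↔ d.toProd = (y, x) := by
          simp only [SimpleGraph.Dart.symm_toProd, Prod.ext_iff, Prod.fst_swap, Prod.snd_swap]
          exact and_comm
        simp only [this]
        push_cast
        ring
      · push Not at hx
        simp only [arrowVal_of_not hx]
        ring
  exact key N.zipper

/-- A path between two nodes has two sides. -/
theorem exists_isSide_of_lt {g : OutEdges V}
    (hadj : ∀ u v, g u = some (some v) → N.graph.Adj u v) {a b : Fin (2 * n)} (hab : a < b)
    (hreach : ReflTransGen g.Arrow (N.node a) (N.node b)) (hb : g (N.node b) = none) :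
    ∃ H, N.IsSide (g.trail (N.node a)) a b
      (g.edgeSum N.crossing (g.trail (N.node a))) H := by
  set M := N.toPlanarMap with hM
  set s := N.outerDart
  set P := g.trail (N.node a) with hP
  have hpos := N.nodePos_strictMono hab
  obtain ⟨m, hm⟩ : ∃ m, N.nodePos b = N.nodePos a + m := ⟨_, (Nat.add_sub_of_le hpos.le).symm⟩
  set k := N.nodePos a
  have hmpos : 0 < m := by omega
  have hper : k + m < Function.minimalPeriod M.facePerm s := hm ▸ N.nodePos_lt b
  have hea : (M.boundaryDart s k).fst = N.node a := N.nodeDart_fst a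
  have heb : (M.boundaryDart s (k + m)).fst = N.node b := by rw [← hm]; exact N.nodeDart_fst b
  have hne : N.node a ≠ N.node b := fun h => hab.ne (N.node_injective h)
  have haP : N.node a ∈ P := self_mem_trail _
  have hbP : N.node b ∈ P := mem_trail.2 hreach
  obtain ⟨h, hface, hh⟩ := M.exists_int_face_potential
    (fun d => (M.pathFlow g (N.node a) d - M.pathFlow g (N.node a) d.symm) +
      (M.arcFlow s k m d - M.arcFlow s k m d.symm))
    (fun d => by rw [SimpleGraph.Dart.symm_symm]; ring) (fun x => by
      rw [Finset.sum_add_distrib, sum_pathFlow hadj hreach hb, sum_arcFlow, hea, heb]; ring)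
  set Γ := M.pathFlow g (N.node a) with hΓ
  set A := M.arcFlow s k m with hA
  have hsame : ∀ d e, M.SameFace d e → h d = h e := fun d e hde =>
    hde.apply_eq_of_invariant hface
  set H : N.graph.Dart → ℤ := fun d => h d - A d - h s with hH
  have hsymm : ∀ d, H d - H d.symm = Γ d - Γ d.symm := by
    intro d
    have := hh d
    simp only [hH]
    linarith
  have hrot : ∀ d, H (M.rot d) - H d = (Γ (M.rot d) +
      if d = M.boundaryDart s (k + m) then 1 else 0) - (Γ (M.rot d).symm +
      if d = M.boundaryDart s k then 1 else 0) := by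
    intro d
    have h1 := hsymm (M.rot d)
    have h2 := arcFlow_facePerm s k m (M.rot d).symm
    have h3 := hface (M.rot d).symm
    rw [facePerm_symm_rot] at h2 h3
    simp only [hH] at h1 ⊢
    linarith
  have hbd : ∀ j < Function.minimalPeriod M.facePerm s,
      H (M.boundaryDart s j) = if k < j ∧ j ≤ k + m then -1 else 0 := by
    intro j hj
    simp only [hH, hA]
    rw [hsame _ _ (sameFace_boundaryDart s j), arcFlow_boundaryDart s hper hj]
    split_ifs <;> ring
  have hfar : ∀ d e, M.SameFace d e → ¬ M.SameFace e s → H d = H e := by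
    intro d e hde hes
    simp only [hH, hA]
    rw [hsame d e hde, arcFlow_of_not_sameFace k m hes,
      arcFlow_of_not_sameFace k m fun hds => hes (hde.symm.trans hds)]
  have hoff : ∀ d : N.graph.Dart, d.fst ∉ P → H d.symm = H d := by
    intro d hd
    have := hsymm d
    rw [hΓ, pathFlow_of_notMem hd, pathFlow_symm_of_notMem hd] at this
    linarith
  have hfst : ∀ d e : N.graph.Dart, d.fst = e.fst → d.fst ∉ P → H d = H e := by
    intro d e hde hd
    have hinv := Equiv.Perm.SameCycle.apply_eq_of_invariant (ρ := M.rot)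
      (f := fun e : N.graph.Dart => if e.fst = d.fst then H e else 0) (a := d) (b := e)
      (fun c => by
        rw [M.rot_fst]
        split_ifs with hc
        · have h1 := hrot c
          have hc' : (M.rot c).fst ∉ P := by rw [M.rot_fst, hc]; exact hd
          rw [hΓ, pathFlow_of_notMem hc', pathFlow_symm_of_notMem hc', if_neg, if_neg] at h1
          · linarith
          · rintro rfl; rw [← hc, hea] at hd; exact hd haP
          · rintro rfl; rw [← hc, heb] at hd; exact hd hbP
        · rfl)
      ((M.rot_sameCycle _ _).2 hde)
    simpa [hde] using hinv
  have hcyc : ∀ x : V, ∀ d ∈ {d : N.graph.Dart | d.fst = x}, ∀ e ∈ {d : N.graph.Dart | d.fst = x},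
      M.rot.SameCycle d e := fun x d hd e he => (M.rot_sameCycle d e).2 (hd.trans he.symm)
  have hmaps : ∀ x : V, ∀ d ∈ {d : N.graph.Dart | d.fst = x},
      M.rot d ∈ {d : N.graph.Dart | d.fst = x} := fun x d hd => (M.rot_fst d).trans hd
  have hnocyc : ∀ x ∈ P, ¬ TransGen g.Arrow x x := fun x hx =>
    not_transGen_self (reaches_trans (mem_trail.1 hx) hreach hb) hb
  have hrotsymm : ∀ d, (M.rot.symm d).fst = d.fst := fun d => by
    have := M.rot_fst (M.rot.symm d)
    rw [Equiv.apply_symm_apply] at this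
    exact this.symm
  have hdown : ∀ x ∈ P, ∃ q : N.graph.Dart, q.fst = x ∧
      (∀ d : N.graph.Dart, d.fst = x → (Γ (M.rot d).symm +
        if d = M.boundaryDart s k then 1 else 0) = if d = q then 1 else 0) ∧
      ∀ i : N.graph.Dart, i.fst = x → i.snd ∈ P → g.Arrow i.snd x → i = M.rot q := by
    intro x hx
    by_cases hxa : x = N.node a
    · have hno : ∀ w ∈ P, ¬ g.Arrow w x := fun w hw hwx => by
        rw [hxa] at hwx
        exact hnocyc _ haP (TransGen.tail' (mem_trail.1 hw) hwx)
      refine ⟨M.boundaryDart s k, hea.trans hxa.symm, fun d hd => ?_, fun i _ h2 h3 =>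
        absurd h3 (hno _ h2)⟩
      rw [show Γ (M.rot d).symm = 0 from if_neg fun h' => hno _ h'.1 ?_, zero_add]
      have := h'.2
      rwa [show ((M.rot d).symm).snd = x from (M.rot_fst d).trans hd] at this
    · obtain ⟨w, hw, hwx⟩ := exists_arrow_of_mem_trail hx hxa
      have hdart : ∀ i : N.graph.Dart, i.fst = x → (i.snd ∈ P ∧ g.Arrow i.snd x ↔
          i = ⟨(x, w), (hadj w x hwx).symm⟩) := by
        intro i hi
        rw [SimpleGraph.Dart.ext_iff, Prod.ext_iff]
        constructor
        · rintro ⟨h1, h2⟩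
          exact ⟨hi, eq_of_arrow_of_mem_trail hreach hb h1 hw h2 hwx⟩
        · rintro ⟨_, h2⟩
          dsimp only at h2
          rw [h2]
          exact ⟨hw, hwx⟩
      refine ⟨M.rot.symm ⟨(x, w), (hadj w x hwx).symm⟩, hrotsymm _, fun d hd => ?_,
        fun i h1 h2 h3 => ?_⟩
      · have h1 : (M.rot d).fst = x := (M.rot_fst d).trans hd
        have h2 : Γ (M.rot d).symm = if d = M.rot.symm ⟨(x, w), (hadj w x hwx).symm⟩
            then 1 else 0 := by
          have h3 := hdart (M.rot d) h1
          rw [← Equiv.eq_symm_apply] at h3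
          refine if_congr (Iff.trans ?_ h3) rfl rfl
          rw [show (M.rot d).symm.snd = x from h1]
          rfl
        rw [h2, if_neg (c := d = M.boundaryDart s k), add_zero]
        rintro rfl
        exact hxa (hd.symm.trans hea)
      · rw [Equiv.apply_symm_apply]
        exact (hdart i h1).1 ⟨h2, h3⟩
  have hup : ∀ x ∈ P, ∀ p : N.graph.Dart, p.fst = x →
      (x = N.node b → p = M.boundaryDart s (k + m)) →
      (x ≠ N.node b → g.Arrow x (M.rot p).snd) →
      ∀ d : N.graph.Dart, d.fst = x → (Γ (M.rot d) +
        if d = M.boundaryDart s (k + m) then 1 else 0) = if d = p then 1 else 0 := by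
    intro x hx p hp hpb hpn d hd
    have h1 : (M.rot d).fst = x := (M.rot_fst d).trans hd
    by_cases hxb : x = N.node b
    · rw [hpb hxb, show Γ (M.rot d) = 0 from if_neg fun h' => ?_, zero_add]
      have := h'.2
      rw [h1, hxb] at this
      exact not_arrow hb this
    · have h2 : ((M.rot d).fst ∈ P ∧ g.Arrow (M.rot d).fst (M.rot d).snd) ↔ d = p := by
        rw [h1]
        constructor
        · rintro ⟨_, h2⟩
          apply M.rot.injective
          rw [SimpleGraph.Dart.ext_iff, Prod.ext_iff]
          exact ⟨h1.trans ((M.rot_fst p).trans hp).symm, h2.unique (hpn hxb)⟩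
        · rintro rfl
          exact ⟨hx, hpn hxb⟩
      rw [show Γ (M.rot d) = if d = p then 1 else 0 from if_congr h2 rfl rfl,
        if_neg (c := d = M.boundaryDart s (k + m)), add_zero]
      rintro rfl
      exact hxb (hd.symm.trans heb)
  have hpath : ∀ x, ReflTransGen g.Arrow x (N.node b) → x ∈ P →
      (∀ d : N.graph.Dart, d.fst = x → -1 ≤ H d ∧ H d ≤ 0) ∧
      ∀ i : N.graph.Dart, i.fst = x → i.snd ∈ P → g.Arrow i.snd x → H i = -1 := by
    intro x hx
    induction hx using ReflTransGen.head_induction_on with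
    | refl =>
      intro hxP
      obtain ⟨q, hq1, hq2, hq3⟩ := hdown _ hxP
      have hjump : ∀ d ∈ {d : N.graph.Dart | d.fst = N.node b}, H (M.rot d) - H d =
          (if d = M.boundaryDart s (k + m) then 1 else 0) - if d = q then 1 else 0 := by
        intro d hd
        rw [hrot, hq2 d hd, hup _ hxP _ heb (fun _ => rfl) (fun h => absurd rfl h) d hd]
      have hbounds := Equiv.Perm.SameCycle.bounds_of_jumps (hcyc (N.node b)) (hmaps _) heb hjump
      have hHp : H (M.boundaryDart s (k + m)) = -1 := by
        rw [hbd _ hper, if_pos (by omega)]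
      refine ⟨fun d hd => ?_, fun i h1 h2 h3 => ?_⟩
      · have := (hbounds d hd).1; omega
      · by_cases hpq : M.boundaryDart s (k + m) = q
        · rw [(hbounds i h1).2 hpq, hHp]
        · have e1 := hjump q hq1
          rw [if_neg (Ne.symm hpq), if_pos rfl, ← hq3 i h1 h2 h3] at e1
          have := (hbounds q hq1).1
          have := (hbounds i h1).1
          omega
    | @head x y hxy hy ih =>
      intro hxP
      have hyP : y ∈ P := mem_trail.2 ((mem_trail.1 hxP).tail hxy)
      obtain ⟨hy1, hy2⟩ := ih hyP
      obtain ⟨q, hq1, hq2, hq3⟩ := hdown x hxP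
      let o : N.graph.Dart := ⟨(x, y), hadj x y hxy⟩
      have ho : H o = 0 := by
        have h1 : H o.symm = -1 := hy2 o.symm rfl hxP hxy
        have h2 := hsymm o
        have h3 : Γ o = 1 := if_pos ⟨hxP, hxy⟩
        have h4 : Γ o.symm = 0 := if_neg fun h' =>
          hnocyc x hxP (TransGen.tail (TransGen.single hxy) h'.2)
        omega
      have hxb : x ≠ N.node b := by rintro rfl; exact not_arrow hb hxy
      have hp : (M.rot.symm o).fst = x := hrotsymm o
      have hjump : ∀ d ∈ {d : N.graph.Dart | d.fst = x}, H (M.rot d) - H d =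
          (if d = M.rot.symm o then 1 else 0) - if d = q then 1 else 0 := by
        intro d hd
        rw [hrot, hq2 d hd, hup _ hxP _ hp (fun h => absurd h hxb)
          (fun _ => by rw [Equiv.apply_symm_apply]; exact hxy) d hd]
      have hbounds := Equiv.Perm.SameCycle.bounds_of_jumps (hcyc x) (hmaps x) hp hjump
      by_cases hpq : M.rot.symm o = q
      · have h1 := (hbounds o rfl).2 hpq
        refine ⟨fun d hd => ?_, fun i h1 h2 h3 => ?_⟩
        · have := (hbounds d hd).2 hpq; omega
        · have h4 := hq3 i h1 h2 h3
          rw [← hpq, Equiv.apply_symm_apply] at h4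
          rw [h4] at h3
          exact absurd (TransGen.tail (TransGen.single hxy) h3) (hnocyc x hxP)
      · have e0 := hjump _ hp
        rw [if_pos rfl, if_neg hpq, Equiv.apply_symm_apply] at e0
        refine ⟨fun d hd => ?_, fun i h1 h2 h3 => ?_⟩
        · have := (hbounds d hd).1; omega
        · have e1 := hjump q hq1
          rw [if_neg (Ne.symm hpq), if_pos rfl, ← hq3 i h1 h2 h3] at e1
          have := (hbounds q hq1).1
          have := (hbounds i h1).1
          omega
  have hPvals : ∀ d : N.graph.Dart, d.fst ∈ P → H d = 0 ∨ H d = -1 := by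
    intro d hd
    have := (hpath d.fst (reaches_trans (mem_trail.1 hd) hreach hb) hd).1 d rfl
    omega
  refine ⟨H, fun d => ?_, hoff, hfst, fun c => ?_, ?_⟩
  · refine M.vertex_induction (x := N.node b)
      (p := fun x => ∀ d : N.graph.Dart, d.fst = x → H d = 0 ∨ H d = -1)
      (fun d hd => hPvals d (hd ▸ hbP)) (fun d hd e he => ?_) d.fst d rfl
    by_cases heP : e.fst ∈ P
    · exact hPvals e heP
    · have h1 : d.symm.fst = e.fst := he.symm
      rw [← hfst d.symm e h1 (h1 ▸ heP), ← hoff d.symm (h1 ▸ heP), SimpleGraph.Dart.symm_symm]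
      exact hd d rfl
  · rw [nodeDart, hbd _ (N.nodePos_lt c), ← hm]
    simp only [k, N.nodePos_strictMono.lt_iff_lt, N.nodePos_strictMono.le_iff_le]
  · rw [N.edgeSum_crossing_trail]
    have h1 : (fun d => M.pathFlow g (N.node a) d - M.pathFlow g (N.node a) d.symm) =
        fun d => H d - H d.symm := by
      funext d; exact (hsymm d).symm
    rw [h1, List.sum_map_sub_of_isChain H (fun d => H d.symm) N.zipper N.zipper_ne_nil
      (N.zipper_isChain.imp_of_mem_imp fun d e _ he hde => hfar _ _ hde (N.zipper_outer e he))]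
    have h2 : H (N.zipper.getLast N.zipper_ne_nil).symm = 0 := by
      have := hbd 0 (by omega)
      rwa [if_neg (by omega)] at this
    rw [h2, sub_zero]

end Network

end

section
theorem OutEdges.adj_reversePath {V : Type*} [Fintype V] {G : SimpleGraph V} {g : OutEdges V}
    (hadj : ∀ u v, g u = some (some v) → G.Adj u v) (a : V) (u v : V)
    (h : g.reversePath a u = some (some v)) : G.Adj u v := by
  unfold reversePath at h
  split_ifs at h with h1
  · have h2 := h1.choose_spec.2
    rw [Option.some_inj, Option.some_inj] at h
    rw [h] at h2
    exact (hadj v u h2).symm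
  · exact hadj u v h

/-- The pairs `(lo i, hi i)` are disjoint and do not cross. The set `F` of the flagged pairs is
closed under taking enclosing pairs, and any two flagged pairs are nested. -/
structure IsNoncrossing {ι : Type*} {m : ℕ} (lo hi : ι → Fin m) (F : ι → Prop) : Prop where
  lt : ∀ i, lo i < hi i
  lo_ne : ∀ i j, i ≠ j → lo i ≠ lo j
  hi_ne : ∀ i j, i ≠ j → hi i ≠ hi j
  lo_ne_hi : ∀ i j, i ≠ j → lo i ≠ hi j
  inside : ∀ i j, i ≠ j → (lo i < lo j ∧ lo j < hi i ↔ lo i < hi j ∧ hi j < hi i)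
  nested : ∀ i j, lo i < lo j → hi j < hi i → F j → F i
  disjoint : ∀ i j, hi i < lo j → F i → ¬ F j

namespace Network

open Classical Relation PlanarMap OutEdges

variable {V : Type*} [Fintype V] {n : ℕ} {N : Network V n} {g : OutEdges V}

theorem exists_isSide (hadj : ∀ u v, g u = some (some v) → N.graph.Adj u v)
    {a b : Fin (2 * n)} (hab : a ≠ b) (hreach : ReflTransGen g.Arrow (N.node a) (N.node b))
    (hb : g (N.node b) = none) : ∃ H, N.IsSide (g.trail (N.node a)) (min a b) (max a b)
      (if a < b then g.edgeSum N.crossing (g.trail (N.node a)) else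
        - g.edgeSum N.crossing (g.trail (N.node a))) H := by
  rcases lt_or_gt_of_ne hab with h | h
  · rw [if_pos h, min_eq_left h.le, max_eq_right h.le]
    exact N.exists_isSide_of_lt hadj h hreach hb
  · rw [if_neg h.not_gt, min_eq_right h.le, max_eq_left h.le,
      ← edgeSum_reversePath hreach hb N.crossing_swap, ← trail_reversePath hreach hb]
    exact N.exists_isSide_of_lt (adj_reversePath hadj _) h
      (reversePath_reaches hreach hb (mem_trail.2 hreach)) (reversePath_start hreach hb)

theorem IsSide.const {P : Finset V} {a b : Fin (2 * n)} {κ : ℤ} {H : N.graph.Dart → ℤ}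
    (hH : N.IsSide P a b κ H) (hadj : ∀ u v, g u = some (some v) → N.graph.Adj u v) {u : V}
    (hu : Disjoint P (g.trail u)) (d e : N.graph.Dart) (hd : d.fst = u)
    (he : e.fst ∈ g.trail u) : H d = H e := by
  obtain ⟨x, hx⟩ : ∃ x, e.fst = x := ⟨_, rfl⟩
  have hxu := he
  rw [hx, mem_trail] at hxu
  clear he
  induction hxu generalizing e with
  | refl =>
    have huP : d.fst ∉ P := hd ▸ Finset.disjoint_right.1 hu (self_mem_trail u)
    exact hH.fst d e (hd.trans hx.symm) huP
  | @tail y x hy h ih =>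
    have hyP : y ∉ P := Finset.disjoint_right.1 hu (mem_trail.2 hy)
    have hxP : x ∉ P := Finset.disjoint_right.1 hu (mem_trail.2 (hy.tail h))
    rw [ih ⟨(y, x), hadj y x h⟩ rfl, ← hH.symm ⟨(y, x), hadj y x h⟩ hyP]
    exact hH.fst _ e hx.symm hxP

theorem IsSide.eq_of_mem_trail {P : Finset V} {a b : Fin (2 * n)} {κ : ℤ}
    {H : N.graph.Dart → ℤ} (hH : N.IsSide P a b κ H)
    (hadj : ∀ u v, g u = some (some v) → N.graph.Adj u v) {u c : Fin (2 * n)}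
    (hu : Disjoint P (g.trail (N.node u))) (hc : N.node c ∈ g.trail (N.node u))
    (e : N.graph.Dart) (he : e.fst ∈ g.trail (N.node u)) :
    H e = if a < c ∧ c ≤ b then -1 else 0 := by
  rw [← hH.node, ← hH.const hadj hu (N.nodeDart u) e (N.nodeDart_fst u) he]
  exact hH.const hadj hu _ _ (N.nodeDart_fst u) (by rw [nodeDart_fst]; exact hc)

theorem IsSide.not_and {P P' : Finset V} {a b a' b' : Fin (2 * n)} {κ κ' : ℤ}
    {H H' : N.graph.Dart → ℤ} (hH : N.IsSide P a b κ H) (hH' : N.IsSide P' a' b' κ' H')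
    {α β : ℤ} (hP : ∀ d : N.graph.Dart, d.fst ∈ P → H' d ≠ β)
    (hP' : ∀ d : N.graph.Dart, d.fst ∈ P' → H d ≠ α) (hne : P.Nonempty) (d : N.graph.Dart) :
    ¬ (H d = α ∧ H' d = β) := by
  rintro ⟨h1, h2⟩
  have key : ∀ d : N.graph.Dart, H d = α → H' d = β → ∀ e : N.graph.Dart, e.fst = d.fst →
      (H e = α ∧ H' e = β) ∧ e.fst ∉ P ∧ e.fst ∉ P' := by
    intro d h1 h2 e he
    have h3 : e.fst ∉ P := fun h => hP d (he ▸ h) h2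
    have h4 : e.fst ∉ P' := fun h => hP' d (he ▸ h) h1
    exact ⟨⟨(hH.fst e d he h3).trans h1, (hH'.fst e d he h4).trans h2⟩, h3, h4⟩
  have hall := N.toPlanarMap.vertex_induction (x := d.fst)
    (p := fun x => ∃ d : N.graph.Dart, d.fst = x ∧ H d = α ∧ H' d = β)
    ⟨d, rfl, h1, h2⟩ (fun e ⟨d', h3, h4, h5⟩ => by
      obtain ⟨⟨h6, h7⟩, h8, h9⟩ := key d' h4 h5 e h3.symm
      exact ⟨e.symm, rfl, (hH.symm e h8).trans h6, (hH'.symm e h9).trans h7⟩)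
  obtain ⟨x, hx⟩ := hne
  obtain ⟨e, he, h3, h4⟩ := hall x
  exact (key e h3 h4 e rfl).2.1 (he ▸ hx)

/-- Disjoint paths between the nodes form a noncrossing pairing, flagged by the paths that go
around the marked face. -/
theorem exists_isNoncrossing (hadj : ∀ u v, g u = some (some v) → N.graph.Adj u v)
    {a b : Fin n → Fin (2 * n)} (hb : Function.Injective b) (hab : ∀ i j, a i ≠ b j)
    (hreach : ∀ i, ReflTransGen g.Arrow (N.node (a i)) (N.node (b i)))
    (hnone : ∀ i, g (N.node (b i)) = none) :
    ∃ F : Fin n → Prop, IsNoncrossing (fun i => min (a i) (b i)) (fun i => max (a i) (b i)) F ∧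
      ∀ i, g.edgeSum N.crossing (g.trail (N.node (a i))) =
        if F i then if a i < b i then -1 else 1 else 0 := by
  choose H hH using fun i => exists_isSide hadj (hab i i) (hreach i) (hnone i)
  have hdisj : ∀ i j, i ≠ j → Disjoint (g.trail (N.node (a i))) (g.trail (N.node (a j))) := by
    intro i j hij
    by_contra hcon
    exact hij (hb (N.node_injective (sink_eq_of_not_disjoint hcon (hreach i) (hreach j) (hnone i)
      (hnone j))))
  have hane : ∀ i j, i ≠ j → a i ≠ a j := fun i j hij h => by
    have := hdisj i j hij
    rw [h, disjoint_self, Finset.bot_eq_empty] at this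
    exact Finset.notMem_empty _ (this ▸ self_mem_trail (N.node (a j)))
  have ha_mem : ∀ i, N.node (a i) ∈ g.trail (N.node (a i)) := fun i => self_mem_trail _
  have hb_mem : ∀ i, N.node (b i) ∈ g.trail (N.node (a i)) := fun i => mem_trail.2 (hreach i)
  have hmin_mem : ∀ i, N.node (min (a i) (b i)) ∈ g.trail (N.node (a i)) := fun i => by
    rcases min_choice (a i) (b i) with h | h <;> rw [h]
    exacts [ha_mem i, hb_mem i]
  have hmax_mem : ∀ i, N.node (max (a i) (b i)) ∈ g.trail (N.node (a i)) := fun i => by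
    rcases max_choice (a i) (b i) with h | h <;> rw [h]
    exacts [ha_mem i, hb_mem i]
  have hside : ∀ i j, i ≠ j → ∀ c, N.node c ∈ g.trail (N.node (a j)) → ∀ e : N.graph.Dart,
      e.fst ∈ g.trail (N.node (a j)) →
      H i e = if min (a i) (b i) < c ∧ c ≤ max (a i) (b i) then -1 else 0 :=
    fun i j hij c hc e he => (hH i).eq_of_mem_trail hadj (hdisj i j hij) hc e he
  have hlt : ∀ i, min (a i) (b i) < max (a i) (b i) := fun i => min_lt_max.2 (hab i i)
  have hne : ∀ i j, i ≠ j → ∀ c ∈ ({a i, b i} : Set _), ∀ c' ∈ ({a j, b j} : Set _),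
      c ≠ c' := by
    rintro i j hij c (rfl | rfl) c' (rfl | rfl)
    · exact hane i j hij
    · exact hab i j
    · exact (hab j i).symm
    · exact fun h => hij (hb h)
  have hmin : ∀ i, min (a i) (b i) ∈ ({a i, b i} : Set _) := fun i => min_choice _ _
  have hmax : ∀ i, max (a i) (b i) ∈ ({a i, b i} : Set _) := fun i => max_choice _ _
  refine ⟨fun i => H i (N.zipper.head N.zipper_ne_nil) = -1, ⟨hlt, ?_, ?_, ?_, ?_, ?_, ?_⟩, ?_⟩
  · exact fun i j hij => hne i j hij _ (hmin i) _ (hmin j)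
  · exact fun i j hij => hne i j hij _ (hmax i) _ (hmax j)
  · exact fun i j hij => hne i j hij _ (hmin i) _ (hmax j)
  · intro i j hij
    have h1 := hside i j hij _ (hmin_mem j) (N.nodeDart (a j)) (by
      rw [nodeDart_fst]; exact ha_mem j)
    have h2 := hside i j hij _ (hmax_mem j) (N.nodeDart (a j)) (by
      rw [nodeDart_fst]; exact ha_mem j)
    have h3 := hne i j hij _ (hmax i) _ (hmin j)
    have h4 := hne i j hij _ (hmax i) _ (hmax j)
    rw [h1] at h2
    rw [← Ne.le_iff_lt h3.symm, ← Ne.le_iff_lt h4.symm]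
    split_ifs at h2 with h5 h6 h6 <;> omega
  · intro i j h1 h2 hF
    have hij : i ≠ j := by rintro rfl; exact lt_irrefl _ h1
    have h3 := (hH i).not_and (hH j) (α := 0) (β := -1)
      (fun d hd => by
        rw [hside j i hij.symm _ (hmin_mem i) d hd, if_neg fun h => lt_asymm h.1 h1]; decide)
      (fun d hd => by
        rw [hside i j hij _ (hmin_mem j) d hd, if_pos ⟨h1, ((hlt j).trans h2).le⟩]; decide)
      ⟨_, ha_mem i⟩ (N.zipper.head N.zipper_ne_nil)
    exact ((hH i).values _).resolve_left fun h => h3 ⟨h, hF⟩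
  · intro i j h1 hF hF'
    have hij : i ≠ j := by rintro rfl; exact lt_asymm h1 (hlt i)
    exact (hH i).not_and (hH j) (α := -1) (β := -1)
      (fun d hd => by
        rw [hside j i hij.symm _ (hmin_mem i) d hd,
          if_neg fun h => lt_asymm h.1 ((hlt i).trans h1)]; decide)
      (fun d hd => by
        rw [hside i j hij _ (hmax_mem j) d hd,
          if_neg fun h => not_lt_of_ge h.2 (h1.trans (hlt j))]; decide)
      ⟨_, ha_mem i⟩ (N.zipper.head N.zipper_ne_nil) ⟨hF, hF'⟩
  · intro i
    have h1 := (hH i).crossing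
    beta_reduce
    rcases (hH i).values (N.zipper.head N.zipper_ne_nil) with h2 | h2
    · rw [h2] at h1 ⊢
      rw [if_neg (by decide)]
      split_ifs at h1 <;> omega
    · rw [h2] at h1 ⊢
      rw [if_pos rfl]
      split_ifs at h1 ⊢ <;> omega

end Network

end

section
open Classical

namespace IsNoncrossing

variable {n : ℕ} {lo hi : Fin n → Fin (2 * n)} {F : Fin n → Prop}

theorem bijective (h : IsNoncrossing lo hi F) : Function.Bijective (Sum.elim lo hi) := by
  rw [Fintype.bijective_iff_injective_and_card]
  refine ⟨?_, by simp; omega⟩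
  rintro (i | i) (j | j) hij
  · by_contra hne
    exact h.lo_ne i j (fun e => hne (e ▸ rfl)) hij
  · by_cases e : i = j
    · subst e; exact absurd hij (h.lt i).ne
    · exact absurd hij (h.lo_ne_hi i j e)
  · by_cases e : i = j
    · subst e; exact absurd hij (h.lt i).ne'
    · exact absurd hij.symm (h.lo_ne_hi j i (Ne.symm e))
  · by_contra hne
    exact h.hi_ne i j (fun e => hne (e ▸ rfl)) hij

theorem prod_label {M : Type*} [CommMonoid M] (h : IsNoncrossing lo hi F) (f : Fin (2 * n) → M) :
    ∏ x, f x = ∏ i, f (lo i) * f (hi i) := by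
  rw [← h.bijective.prod_comp, Fintype.prod_sum_type, Finset.prod_mul_distrib]
  rfl

theorem eq_lo_or_hi (h : IsNoncrossing lo hi F) (x : Fin (2 * n)) :
    ∃ i, x = lo i ∨ x = hi i := by
  obtain ⟨i | i, hi⟩ := h.bijective.2 x
  · exact ⟨i, Or.inl hi.symm⟩
  · exact ⟨i, Or.inr hi.symm⟩

/-! ### The cyclic Dyck path of a noncrossing pairing -/

/-- The oriented pair: the flagged pairs are oriented from their highest to their lowest label. -/
def orient (lo hi : Fin n → Fin (2 * n)) (F : Fin n → Prop) (i : Fin n) :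
    Fin (2 * n) × Fin (2 * n) := if F i then (hi i, lo i) else (lo i, hi i)

/-- Whether the oriented pair of index `i` passes above the point just before the label `k`. -/
def cover (lo hi : Fin n → Fin (2 * n)) (F : Fin n → Prop) (k : ℕ) (i : Fin n) : ℤ :=
  if F i then (if k ≤ lo i ∨ (hi i : ℕ) < k then 1 else 0)
  else if (lo i : ℕ) < k ∧ k ≤ hi i then 1 else 0

theorem cover_of_pos {k : ℕ} {i : Fin n} (hF : F i) :
    cover lo hi F k i = if k ≤ lo i ∨ (hi i : ℕ) < k then 1 else 0 := if_pos hF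

theorem cover_of_neg {k : ℕ} {i : Fin n} (hF : ¬ F i) :
    cover lo hi F k i = if (lo i : ℕ) < k ∧ k ≤ hi i then 1 else 0 := if_neg hF

theorem facts (h : IsNoncrossing lo hi F) {i j : Fin n} (hij : i ≠ j) :
    ((lo i : ℕ) < lo j ∧ (lo j : ℕ) < hi i ↔ (lo i : ℕ) < hi j ∧ (hi j : ℕ) < hi i) ∧
    ((lo j : ℕ) < lo i ∧ (lo i : ℕ) < hi j ↔ (lo j : ℕ) < hi i ∧ (hi i : ℕ) < hi j) ∧
    (lo i : ℕ) < hi i ∧ (lo j : ℕ) < hi j ∧ (lo i : ℕ) ≠ lo j ∧ (hi i : ℕ) ≠ hi j ∧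
    (lo i : ℕ) ≠ hi j ∧ (lo j : ℕ) ≠ hi i :=
  ⟨h.inside i j hij, h.inside j i hij.symm, h.lt i, h.lt j, fun e => h.lo_ne i j hij (Fin.ext e),
    fun e => h.hi_ne i j hij (Fin.ext e), fun e => h.lo_ne_hi i j hij (Fin.ext e),
    fun e => h.lo_ne_hi j i hij.symm (Fin.ext e)⟩

theorem cover_le_of_neg (h : IsNoncrossing lo hi F) {i j : Fin n} (hij : i ≠ j) (hj : ¬ F j)
    {k : ℕ} (h1 : (lo j : ℕ) < k) (h2 : k ≤ hi j) :
    cover lo hi F (lo j) i ≤ cover lo hi F k i ∧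
      cover lo hi F (hi j + 1) i = cover lo hi F (lo j) i := by
  have h3 := h.facts hij
  by_cases hF : F i
  · have h4 : ¬ ((lo j : ℕ) < lo i ∧ (hi i : ℕ) < hi j) := fun h4 =>
      hj (h.nested j i h4.1 h4.2 hF)
    rw [cover_of_pos hF, cover_of_pos hF, cover_of_pos hF]
    split_ifs <;> omega
  · rw [cover_of_neg hF, cover_of_neg hF, cover_of_neg hF]
    split_ifs <;> omega

theorem cover_le_of_pos (h : IsNoncrossing lo hi F) {i j : Fin n} (hij : i ≠ j) (hj : F j)
    {k : ℕ} (hk : k ≤ lo j ∨ (hi j : ℕ) < k) :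
    cover lo hi F (hi j) i ≤ cover lo hi F k i ∧
      cover lo hi F (lo j + 1) i = cover lo hi F (hi j) i := by
  have h3 := h.facts hij
  by_cases hF : F i
  · have h5 : ¬ ((hi j : ℕ) < lo i) := fun h5 => h.disjoint j i h5 hj hF
    have h6 : ¬ ((hi i : ℕ) < lo j) := fun h6 => h.disjoint i j h6 hF hj
    rw [cover_of_pos hF, cover_of_pos hF, cover_of_pos hF]
    split_ifs <;> omega
  · have h4 : ¬ ((lo i : ℕ) < lo j ∧ (hi j : ℕ) < hi i) := fun h4 =>
      hF (h.nested i j h4.1 h4.2 hj)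
    rw [cover_of_neg hF, cover_of_neg hF, cover_of_neg hF]
    split_ifs <;> omega

theorem sum_cover_lt_of_neg (h : IsNoncrossing lo hi F) {j : Fin n} (hj : ¬ F j)
    {k : ℕ} (h1 : (lo j : ℕ) < k) (h2 : k ≤ hi j) :
    ∑ i, cover lo hi F (lo j) i < ∑ i, cover lo hi F k i ∧
      ∑ i, cover lo hi F (hi j + 1) i = ∑ i, cover lo hi F (lo j) i := by
  have h3 := h.lt j
  refine ⟨Finset.sum_lt_sum (fun i _ => ?_) ⟨j, Finset.mem_univ _, ?_⟩,
    Finset.sum_congr rfl fun i _ => ?_⟩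
  · by_cases hij : i = j
    · subst hij
      rw [cover_of_neg hj, cover_of_neg hj]
      split_ifs <;> omega
    · exact (h.cover_le_of_neg hij hj h1 h2).1
  · rw [cover_of_neg hj, cover_of_neg hj, if_neg (by omega), if_pos ⟨h1, h2⟩]
    decide
  · by_cases hij : i = j
    · subst hij
      rw [cover_of_neg hj, cover_of_neg hj]
      split_ifs <;> omega
    · exact (h.cover_le_of_neg hij hj h1 h2).2

theorem sum_cover_lt_of_pos (h : IsNoncrossing lo hi F) {j : Fin n} (hj : F j)
    {k : ℕ} (hk : k ≤ lo j ∨ (hi j : ℕ) < k) :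
    ∑ i, cover lo hi F (hi j) i < ∑ i, cover lo hi F k i ∧
      ∑ i, cover lo hi F (lo j + 1) i = ∑ i, cover lo hi F (hi j) i := by
  have h3 : (lo j : ℕ) < hi j := h.lt j
  refine ⟨Finset.sum_lt_sum (fun i _ => ?_) ⟨j, Finset.mem_univ _, ?_⟩,
    Finset.sum_congr rfl fun i _ => ?_⟩
  · by_cases hij : i = j
    · subst hij
      rw [cover_of_pos hj, cover_of_pos hj]
      split_ifs <;> omega
    · exact (h.cover_le_of_pos hij hj hk).1
  · rw [cover_of_pos hj, cover_of_pos hj, if_neg (by omega), if_pos hk]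
    decide
  · by_cases hij : i = j
    · subst hij
      rw [cover_of_pos hj, cover_of_pos hj]
      split_ifs <;> omega
    · exact (h.cover_le_of_pos hij hj hk).2

theorem orient_fst_injective (h : IsNoncrossing lo hi F) :
    Function.Injective fun i => (orient lo hi F i).1 := by
  intro i j hij
  by_contra hne
  simp only [orient] at hij
  split_ifs at hij
  · exact h.hi_ne i j hne hij
  · exact h.lo_ne_hi j i (Ne.symm hne) hij.symm
  · exact h.lo_ne_hi i j hne hij
  · exact h.lo_ne i j hne hij

/-- The set of the first labels of the oriented pairs. -/
def ups (lo hi : Fin n → Fin (2 * n)) (F : Fin n → Prop) : Finset (Fin (2 * n)) :=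
  Finset.univ.image fun i => (orient lo hi F i).1

theorem card_ups (h : IsNoncrossing lo hi F) : (ups lo hi F).card = n := by
  rw [ups, Finset.card_image_of_injective _ h.orient_fst_injective, Finset.card_univ,
    Fintype.card_fin]

theorem lo_mem_ups_iff (h : IsNoncrossing lo hi F) (j : Fin n) : lo j ∈ ups lo hi F ↔ ¬ F j := by
  simp only [ups, Finset.mem_image, Finset.mem_univ, true_and, orient]
  constructor
  · rintro ⟨i, hi⟩ hj
    by_cases hij : i = j
    · subst hij; rw [if_pos hj] at hi; exact (h.lt i).ne' hi
    · split_ifs at hi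
      · exact h.lo_ne_hi j i (Ne.symm hij) hi.symm
      · exact h.lo_ne i j hij hi
  · exact fun hj => ⟨j, by rw [if_neg hj]⟩

theorem hi_mem_ups_iff (h : IsNoncrossing lo hi F) (j : Fin n) : hi j ∈ ups lo hi F ↔ F j := by
  simp only [ups, Finset.mem_image, Finset.mem_univ, true_and, orient]
  constructor
  · rintro ⟨i, hi⟩
    by_contra hj
    by_cases hij : i = j
    · subst hij; rw [if_neg hj] at hi; exact (h.lt i).ne hi
    · split_ifs at hi
      · exact h.hi_ne i j hij hi
      · exact h.lo_ne_hi i j hij hi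
  · exact fun hj => ⟨j, by rw [if_pos hj]⟩

theorem labelHeight_ups (h : IsNoncrossing lo hi F) {k : ℕ} (hk : k ≤ 2 * n) :
    labelHeight (ups lo hi F) k =
      ∑ i, cover lo hi F k i - ∑ i, cover lo hi F 0 i := by
  induction k with
  | zero => rw [sub_self]; rfl
  | succ k ih =>
    rw [labelHeight_succ, ih (by omega)]
    have hmod : k % (2 * n) = (⟨k, by omega⟩ : Fin (2 * n)).val := Nat.mod_eq_of_lt (by omega)
    have key : ∑ i, cover lo hi F (k + 1) i - ∑ i, cover lo hi F k i =
        labelStep (ups lo hi F) k := by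
      rw [← Finset.sum_sub_distrib]
      obtain ⟨j, hj⟩ := h.eq_lo_or_hi ⟨k, by omega⟩
      have hjk : k = (lo j : ℕ) ∨ k = (hi j : ℕ) := hj.imp (congrArg Fin.val) (congrArg Fin.val)
      have h0 := h.lt j
      rw [Finset.sum_eq_single j]
      · rcases hj with hj | hj
        · have hkj : k = (lo j : ℕ) := congrArg Fin.val hj
          by_cases hF : F j
          · rw [labelStep_of_notMem hmod (hj ▸ fun h' => (h.lo_mem_ups_iff j).1 h' hF),
              cover_of_pos hF, cover_of_pos hF]
            split_ifs <;> omega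
          · rw [labelStep_of_mem hmod (hj ▸ (h.lo_mem_ups_iff j).2 hF),
              cover_of_neg hF, cover_of_neg hF]
            split_ifs <;> omega
        · have hkj : k = (hi j : ℕ) := congrArg Fin.val hj
          by_cases hF : F j
          · rw [labelStep_of_mem hmod (hj ▸ (h.hi_mem_ups_iff j).2 hF),
              cover_of_pos hF, cover_of_pos hF]
            split_ifs <;> omega
          · rw [labelStep_of_notMem hmod (hj ▸ fun h' => hF ((h.hi_mem_ups_iff j).1 h')),
              cover_of_neg hF, cover_of_neg hF]
            split_ifs <;> omega
      · intro i _ hij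
        have h3 := h.facts hij
        by_cases hF : F i
        · rw [cover_of_pos hF, cover_of_pos hF]
          split_ifs <;> omega
        · rw [cover_of_neg hF, cover_of_neg hF]
          split_ifs <;> omega
      · intro h'; exact absurd (Finset.mem_univ _) h'
    rw [← key]
    ring

theorem exists_cyclicDyckPath (h : IsNoncrossing lo hi F) (hn : 1 ≤ n) :
    ∃ σ : CyclicDyckPath n, ∀ j, orient lo hi F j ∈ σ.chords := by
  obtain ⟨σ, hσ⟩ := CyclicDyckPath.exists_upLabels_eq h.card_ups hn
  refine ⟨σ, fun j => ?_⟩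
  have hlt : (lo j : ℕ) < hi j := h.lt j
  have hlo := (lo j).2
  have hhi := (hi j).2
  by_cases hF : F j
  · rw [orient, if_pos hF, CyclicDyckPath.mem_chords_iff, hσ]
    refine ⟨hi j, lo j + 2 * n, Nat.mod_eq_of_lt hhi, ?_, by omega, by omega, ?_, ?_⟩
    · rw [Nat.add_mod_right, Nat.mod_eq_of_lt hlo]
    · intro k h1 h2
      rw [h.labelHeight_ups hhi.le]
      by_cases hk : k ≤ 2 * n
      · rw [h.labelHeight_ups hk]
        exact sub_lt_sub_right (h.sum_cover_lt_of_pos hF (Or.inr h1)).1 _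
      · obtain ⟨k, rfl⟩ : ∃ k', k = k' + 2 * n := ⟨k - 2 * n, by omega⟩
        rw [labelHeight_add_period h.card_ups, h.labelHeight_ups (by omega)]
        exact sub_lt_sub_right (h.sum_cover_lt_of_pos hF (Or.inl (by omega))).1 _
    · rw [add_right_comm, labelHeight_add_period h.card_ups, h.labelHeight_ups (by omega),
        h.labelHeight_ups hhi.le, (h.sum_cover_lt_of_pos hF (Or.inl le_rfl)).2]
  · rw [orient, if_neg hF, CyclicDyckPath.mem_chords_iff, hσ]
    refine ⟨lo j, hi j, Nat.mod_eq_of_lt hlo, Nat.mod_eq_of_lt hhi, by omega, hlt, ?_, ?_⟩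
    · intro k h1 h2
      rw [h.labelHeight_ups hlo.le, h.labelHeight_ups (by omega)]
      exact sub_lt_sub_right (h.sum_cover_lt_of_neg hF h1 h2).1 _
    · rw [h.labelHeight_ups (by omega), h.labelHeight_ups hlo.le,
        (h.sum_cover_lt_of_neg hF hlt le_rfl).2]

theorem sum_chords (h : IsNoncrossing lo hi F) {σ : CyclicDyckPath n}
    (hσ : ∀ j, orient lo hi F j ∈ σ.chords) {M : Type*} [AddCommMonoid M]
    (f : Fin (2 * n) × Fin (2 * n) → M) : ∑ c ∈ σ.chords, f c = ∑ j, f (orient lo hi F j) := by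
  have hinj : Function.Injective (orient lo hi F) := fun i j hij =>
    h.orient_fst_injective (congrArg Prod.fst hij)
  have himage : Finset.univ.image (orient lo hi F) = σ.chords := by
    refine Finset.eq_of_subset_of_card_le (fun c hc => ?_) ?_
    · obtain ⟨j, _, rfl⟩ := Finset.mem_image.1 hc
      exact hσ j
    · rw [σ.card_chords, Finset.card_image_of_injective _ hinj, Finset.card_univ,
        Fintype.card_fin]
  rw [← himage, Finset.sum_image fun i _ j _ hij => hinj hij]

/-! ### The sign of a noncrossing pairing -/

theorem neg_one_pow_lo (h : IsNoncrossing lo hi F) (i : Fin n) :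
    (-1 : ℤ) ^ (lo i : ℕ) = ∏ j ∈ {i}ᶜ, if lo j < lo i ∧ hi i < hi j then -1 else 1 := by
  have h1 : (-1 : ℤ) ^ (lo i : ℕ) = ∏ x : Fin (2 * n), if x < lo i then -1 else 1 := by
    rw [Finset.prod_ite, Finset.prod_const, Finset.prod_const_one, mul_one,
      Finset.filter_gt_eq_Iio, Fin.card_Iio]
  rw [h1, h.prod_label, ← Finset.prod_mul_prod_compl {i}, Finset.prod_singleton,
    if_neg (lt_irrefl _), if_neg (h.lt i).not_gt, one_mul, one_mul]
  refine Finset.prod_congr rfl fun j hj => ?_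
  have hij : i ≠ j := fun e => by simp [e] at hj
  have h2 := h.facts hij
  simp only [Fin.lt_def]
  split_ifs <;> omega

theorem sign_eq (h : IsNoncrossing lo hi F) {a b : Fin n → Fin (2 * n)} {π : Equiv.Perm (Fin n)}
    (ha : StrictMono a) (hb : StrictMono b) (hlo : ∀ i, lo i = min (a i) (b (π i)))
    (hhi : ∀ i, hi i = max (a i) (b (π i))) :
    (Equiv.Perm.sign π : ℤ) = ∏ i, (-1) ^ (lo i : ℕ) := by
  rw [Equiv.Perm.sign_eq_prod_prod_Ioi]
  simp only [h.neg_one_pow_lo]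
  rw [← Finset.prod_prod_Ioi_mul_eq_prod_prod_off_diag
    (fun j i => if lo j < lo i ∧ hi i < hi j then (-1 : ℤ) else 1)]
  push_cast
  refine Finset.prod_congr rfl fun i _ => Finset.prod_congr rfl fun j hj => ?_
  have hij : i < j := Finset.mem_Ioi.1 hj
  have h1 : (a i : ℕ) < a j := ha hij
  have h2 : π i < π j ↔ (b (π i) : ℕ) < b (π j) := hb.lt_iff_lt.symm
  have h3 := h.facts hij.ne
  have hmin : ∀ i, (lo i : ℕ) = min (a i : ℕ) (b (π i)) ∧
      (hi i : ℕ) = max (a i : ℕ) (b (π i)) := fun i => by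
    rw [hlo, hhi]
    rcases le_total (a i) (b (π i)) with h | h
    · rw [min_eq_left h, max_eq_right h, min_eq_left (Fin.le_def.1 h),
        max_eq_right (Fin.le_def.1 h)]
      exact ⟨rfl, rfl⟩
    · rw [min_eq_right h, max_eq_left h, min_eq_right (Fin.le_def.1 h),
        max_eq_left (Fin.le_def.1 h)]
      exact ⟨rfl, rfl⟩
  obtain ⟨h4, h5⟩ := hmin i
  obtain ⟨h6, h7⟩ := hmin j
  simp only [Fin.lt_def (a := lo _), Fin.lt_def (a := hi _), h2]
  by_cases h8 : (b (π i) : ℕ) < b (π j)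
  · rw [if_pos h8, if_neg (by omega), if_neg (by omega)]
    rfl
  · rw [if_neg h8]
    split_ifs
    · omega
    · rfl
    · rfl
    · omega

end IsNoncrossing

end

section
open Classical Relation

namespace CyclicDyckPath

variable {n : ℕ} (σ τ : CyclicDyckPath n)

/-- The labels `x` and `y` form a chord. -/
def Paired (x y : Fin (2 * n)) : Prop := (x, y) ∈ σ.chords ∨ (y, x) ∈ σ.chords

/-- The algebraic number of turns made by a path between the ends of a chord. -/
def turn (x y : Fin (2 * n)) : ℤ :=
  (if (x, y) ∈ σ.chords ∧ y < x then 1 else 0) - if (y, x) ∈ σ.chords ∧ x < y then 1 else 0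

variable {σ τ} {x y y' : Fin (2 * n)}

theorem Paired.symm (h : σ.Paired x y) : σ.Paired y x := Or.symm h

theorem turn_swap (x y : Fin (2 * n)) : σ.turn y x = - σ.turn x y := by
  unfold turn
  ring

theorem swap_notMem_chords (h : (x, y) ∈ σ.chords) : (y, x) ∉ σ.chords := fun h' =>
  (upLabels_of_mem_chords h).2 (upLabels_of_mem_chords h').1

theorem ne_of_mem_chords (h : (x, y) ∈ σ.chords) : x ≠ y := by
  rintro rfl
  exact swap_notMem_chords h h

theorem turn_of_mem (h : (x, y) ∈ σ.chords) : σ.turn x y = if y < x then 1 else 0 := by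
  simp [turn, h, swap_notMem_chords h]

theorem turn_of_swap_mem (h : (y, x) ∈ σ.chords) : σ.turn x y = if x < y then -1 else 0 := by
  rw [turn_swap, turn_of_mem h]
  split_ifs <;> rfl

theorem Paired.ne (h : σ.Paired x y) : x ≠ y :=
  h.elim ne_of_mem_chords fun h => (ne_of_mem_chords h).symm

theorem Paired.unique (h : σ.Paired x y) (h' : σ.Paired x y') : y = y' := by
  rcases h with h | h <;> rcases h' with h' | h'
  · exact chords_right_unique h h'
  · exact absurd (upLabels_of_mem_chords h).1 (upLabels_of_mem_chords h').2
  · exact absurd (upLabels_of_mem_chords h').1 (upLabels_of_mem_chords h).2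
  · exact chords_left_unique h h'

theorem exists_paired (σ : CyclicDyckPath n) (x : Fin (2 * n)) : ∃ y, σ.Paired x y := by
  by_cases hx : x ∈ σ.upLabels
  · obtain ⟨y, hy⟩ := exists_chord_of_mem hx
    exact ⟨y, Or.inl hy⟩
  · obtain ⟨y, hy⟩ := exists_chord_of_notMem hx
    exact ⟨y, Or.inr hy⟩

theorem meetsEachChordOnce_iff {R : Finset (Fin (2 * n))} :
    MeetsEachChordOnce R σ ↔ ∀ x y, σ.Paired x y → (x ∈ R ↔ y ∉ R) := by
  constructor
  · rintro h x y (hc | hc)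
    · have := h _ hc; simp only [Xor] at this; tauto
    · have := h _ hc; simp only [Xor] at this; tauto
  · intro h c hc
    have := h c.1 c.2 (Or.inl hc)
    simp only [Xor]
    tauto

end CyclicDyckPath

namespace Network

open OutEdges CyclicDyckPath

variable {V : Type*} [Fintype V] {n : ℕ}

/-- `g` is a cycle-rooted grove in the winding class encoded by `σ`, except that its sinks are the
nodes with label in `R`. -/
structure IsRootedGrove (N : Network V n) (σ : CyclicDyckPath n) (R : Finset (Fin (2 * n)))
    (g : OutEdges V) : Prop where
  rooted : N.IsRootedAt R g
  meets : ∀ x y, σ.Paired x y → (x ∈ R ↔ y ∉ R)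
  connects : ∀ s r, s ∉ R → r ∈ R → σ.Paired s r →
    ReflTransGen g.Arrow (N.node s) (N.node r) ∧
      g.edgeSum N.crossing (g.trail (N.node s)) = σ.turn s r

variable {N : Network V n} {σ τ : CyclicDyckPath n} {R : Finset (Fin (2 * n))} {g : OutEdges V}

theorem IsRootedAt.node_eq_none (h : N.IsRootedAt R g) {r : Fin (2 * n)} (hr : r ∈ R) :
    g (N.node r) = none := (h.sink _).2 ⟨r, hr, rfl⟩

theorem isRootedGrove_compl_iff : N.IsRootedGrove σ σ.upLabelsᶜ g ↔ N.IsGrove σ g := by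
  have hdown : ∀ u, (∃ r ∈ σ.upLabelsᶜ, u = N.node r) ↔ ∃ c ∈ σ.chords, u = N.node c.2 := by
    intro u
    rw [← image_snd_chords]
    simp only [Finset.mem_image]
    constructor
    · rintro ⟨_, ⟨c, hc, rfl⟩, rfl⟩; exact ⟨c, hc, rfl⟩
    · rintro ⟨c, hc, rfl⟩; exact ⟨_, ⟨c, hc, rfl⟩, rfl⟩
  have hmem : ∀ c ∈ σ.chords, c.1 ∉ σ.upLabelsᶜ ∧ c.2 ∈ σ.upLabelsᶜ := fun c hc => by
    have := upLabels_of_mem_chords hc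
    simpa using this
  constructor
  · intro h
    refine ⟨h.rooted.adj, h.rooted.wired, fun u => (h.rooted.sink u).trans (hdown u),
      fun c hc => ?_, fun c hc => ?_⟩
    · exact (h.connects _ _ (hmem c hc).1 (hmem c hc).2 (Or.inl hc)).1
    · rw [(h.connects _ _ (hmem c hc).1 (hmem c hc).2 (Or.inl hc)).2, turn_of_mem hc]
  · intro h
    refine ⟨⟨h.adj, h.wired, fun u => (h.sink u).trans (hdown u).symm⟩, ?_, ?_⟩
    · rintro x y (hc | hc)
      · have := hmem _ hc; tauto
      · have := hmem _ hc; tauto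
    · rintro s r hs hr (hc | hc)
      · refine ⟨h.connects _ hc, ?_⟩
        rw [turn_of_mem hc]
        exact h.winding _ hc
      · exact absurd hr (hmem _ hc).1

theorem IsRootedGrove.congr (h : N.IsRootedGrove σ R g) (hστ : σ.chords = τ.chords) :
    N.IsRootedGrove τ R g := by
  have h1 : τ.Paired = σ.Paired := by
    funext x y
    simp only [Paired, hστ]
  have h2 : τ.turn = σ.turn := by
    funext x y
    simp only [turn, hστ]
  exact ⟨h.rooted, h1 ▸ h.meets, h1 ▸ h2 ▸ h.connects⟩

theorem IsRootedGrove.mem_chords (h : N.IsRootedGrove σ R g) (h' : N.IsRootedGrove τ R g)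
    {x y : Fin (2 * n)} (hc : (x, y) ∈ σ.chords) : (x, y) ∈ τ.chords := by
  have key : ∀ s r, s ∉ R → r ∈ R → σ.Paired s r → τ.Paired s r ∧ σ.turn s r = τ.turn s r := by
    intro s r hs hr hsr
    obtain ⟨h1, h2⟩ := h.connects s r hs hr hsr
    obtain ⟨r', hr'⟩ := τ.exists_paired s
    have hr'R : r' ∈ R := by
      by_contra hcon; exact hs ((h'.meets s r' hr').2 hcon)
    obtain ⟨h3, h4⟩ := h'.connects s r' hs hr'R hr'
    have : r = r' := N.node_injective (sink_unique h1 h3 (h.rooted.node_eq_none hr)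
      (h.rooted.node_eq_none hr'R))
    subst this
    exact ⟨hr', h2.symm.trans h4⟩
  have hne := ne_of_mem_chords hc
  have hm := h.meets x y (Or.inl hc)
  by_cases hx : x ∈ R
  · obtain ⟨h1, h2⟩ := key y x (hm.1 hx) hx (Or.inr hc)
    rcases h1 with h1 | h1
    · rw [turn_of_swap_mem hc, turn_of_mem h1] at h2
      split_ifs at h2 <;> omega
    · exact h1
  · have hy : y ∈ R := by by_contra hcon; exact hx (hm.2 hcon)
    obtain ⟨h1, h2⟩ := key x y hx hy (Or.inl hc)
    rcases h1 with h1 | h1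
    · exact h1
    · rw [turn_of_mem hc, turn_of_swap_mem h1] at h2
      split_ifs at h2 <;> omega

/-- A forest determines its winding class. -/
theorem IsRootedGrove.chords_eq (h : N.IsRootedGrove σ R g) (h' : N.IsRootedGrove τ R g) :
    σ.chords = τ.chords := by
  ext ⟨x, y⟩
  exact ⟨h.mem_chords h', h'.mem_chords h⟩

/-! ### Changing the roots -/

theorem IsRootedGrove.reversePath (h : N.IsRootedGrove σ R g) {s r : Fin (2 * n)} (hs : s ∉ R)
    (hr : r ∈ R) (hsr : σ.Paired s r) :
    N.IsRootedGrove σ (insert s (R.erase r)) (g.reversePath (N.node s)) := by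
  obtain ⟨hreach, hturn⟩ := h.connects s r hs hr hsr
  have hnone := h.rooted.node_eq_none hr
  have hmem : ∀ x, x ∈ insert s (R.erase r) ↔ x = s ∨ x ≠ r ∧ x ∈ R := fun x => by
    rw [Finset.mem_insert, Finset.mem_erase]
  refine ⟨⟨adj_reversePath h.rooted.adj _, fun u hu => ?_, fun u => ?_⟩, ?_, ?_⟩
  · apply h.rooted.wired
    unfold OutEdges.reversePath at hu
    split_ifs at hu
    · simp at hu
    · exact hu
  · rw [reversePath_eq_none_iff hreach hnone, h.rooted.sink]
    simp only [hmem]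
    constructor
    · rintro (rfl | ⟨h1, x, hx, rfl⟩)
      · exact ⟨s, Or.inl rfl, rfl⟩
      · exact ⟨x, Or.inr ⟨fun e => h1 (e ▸ rfl), hx⟩, rfl⟩
    · rintro ⟨x, rfl | ⟨h1, hx⟩, rfl⟩
      · exact Or.inl rfl
      · exact Or.inr ⟨fun e => h1 (N.node_injective e), x, hx, rfl⟩
  · intro x y hxy
    have hm := h.meets x y hxy
    rw [hmem, hmem]
    by_cases hx : x = s
    · subst hx
      rw [← hsr.unique hxy]
      simp [hsr.ne.symm]
    by_cases hy : y = s
    · subst hy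
      rw [← hsr.unique hxy.symm]
      simp [hsr.ne.symm]
    by_cases hx' : x = r
    · subst hx'
      exact absurd (hxy.unique hsr.symm) hy
    by_cases hy' : y = r
    · subst hy'
      exact absurd (hxy.symm.unique hsr.symm) hx
    simp only [hx, hy, hx', hy', false_or, ne_eq, not_false_eq_true, true_and]
    exact hm
  · intro s' r' hs' hr' hsr'
    rw [hmem] at hs' hr'
    push Not at hs'
    by_cases e : s' = r
    · subst e
      rw [← hsr.symm.unique hsr']
      refine ⟨reversePath_reaches hreach hnone (mem_trail.2 hreach), ?_⟩
      rw [trail_reversePath hreach hnone, edgeSum_reversePath hreach hnone N.crossing_swap, hturn,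
        turn_swap s s']
    · have hs'R := hs'.2 e
      have hr's : r' ≠ s := fun e' => e (hsr'.symm.unique (e' ▸ hsr))
      have hr'R := (hr'.resolve_left hr's).2
      have hr'r := (hr'.resolve_left hr's).1
      obtain ⟨h1, h2⟩ := h.connects s' r' hs'R hr'R hsr'
      have hsame : ∀ x ∈ g.trail (N.node s'), g.reversePath (N.node s) x = g x := by
        intro x hx
        refine reversePath_of_notMem fun hx' => hr'r (N.node_injective ?_)
        exact sink_eq_of_not_disjoint (Finset.not_disjoint_iff.2 ⟨x, hx, hx'⟩) h1 hreach
          (h.rooted.node_eq_none hr'R) hnone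
      exact ⟨reaches_congr hsame h1, (edgeSum_trail_congr _ hsame).trans h2⟩

/-- The weight of a forest without its parallel transports between nodes. -/
def forestWeight (N : Network V n) (z : ℂ) (g : OutEdges V) : ℂ :=
  g.edgeProd (fun u v => (N.conductance u v : ℂ)) Finset.univ *
    ∏ C : Finset V with g.IsCycle C, (1 - g.edgeProd (N.transport z) C)

theorem forestWeight_reversePath (N : Network V n) (z : ℂ) {a d : V}
    (ha : ReflTransGen g.Arrow a d) (hd : g d = none) :
    N.forestWeight z (g.reversePath a) = N.forestWeight z g := by
  rw [forestWeight, edgeProd_reversePath_univ ha hd fun u v => by rw [N.conductance_symm],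
    prod_isCycle_reversePath ha hd]
  rfl

theorem sum_forestWeight_swap (N : Network V n) (z : ℂ) {s r : Fin (2 * n)} (hs : s ∉ R)
    (hr : r ∈ R) (hsr : σ.Paired s r) :
    ∑ g : OutEdges V with N.IsRootedGrove σ R g, N.forestWeight z g =
      ∑ g : OutEdges V with N.IsRootedGrove σ (insert s (R.erase r)) g, N.forestWeight z g := by
  have hs' : s ∈ insert s (R.erase r) := Finset.mem_insert_self _ _
  have hr' : r ∉ insert s (R.erase r) := by simp [hsr.ne.symm]
  have hback : insert r ((insert s (R.erase r)).erase s) = R := by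
    rw [Finset.erase_insert (by simp [hs]), Finset.insert_erase hr]
  refine Finset.sum_bij' (fun g _ => g.reversePath (N.node s))
    (fun g _ => g.reversePath (N.node r)) ?_ ?_ ?_ ?_ ?_
  · intro g hg
    exact Finset.mem_filter.2 ⟨Finset.mem_univ _, (Finset.mem_filter.1 hg).2.reversePath hs hr hsr⟩
  · intro g hg
    have := (Finset.mem_filter.1 hg).2.reversePath hr' hs' hsr.symm
    rw [hback] at this
    exact Finset.mem_filter.2 ⟨Finset.mem_univ _, this⟩
  · intro g hg
    have h := (Finset.mem_filter.1 hg).2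
    exact reversePath_reversePath (h.connects s r hs hr hsr).1 (h.rooted.node_eq_none hr)
  · intro g hg
    have h := (Finset.mem_filter.1 hg).2
    exact reversePath_reversePath (h.connects r s hr' hs' hsr.symm).1 (h.rooted.node_eq_none hs')
  · intro g hg
    have h := (Finset.mem_filter.1 hg).2
    exact (N.forestWeight_reversePath z (h.connects s r hs hr hsr).1
      (h.rooted.node_eq_none hr)).symm

theorem sum_forestWeight (N : Network V n) (z : ℂ) (hR : ∀ x y, σ.Paired x y → (x ∈ R ↔ y ∉ R)) :
    ∑ g : OutEdges V with N.IsRootedGrove σ R g, N.forestWeight z g =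
      ∑ g : OutEdges V with N.IsGrove σ g, N.forestWeight z g := by
  simp only [← isRootedGrove_compl_iff]
  obtain ⟨m, hm⟩ : ∃ m, (R ∩ σ.upLabels).card = m := ⟨_, rfl⟩
  induction m generalizing R with
  | zero =>
    rw [Finset.card_eq_zero] at hm
    have : R = σ.upLabelsᶜ := by
      ext x
      rw [Finset.mem_compl]
      constructor
      · intro hx hx'
        exact Finset.notMem_empty x (hm ▸ Finset.mem_inter.2 ⟨hx, hx'⟩)
      · intro hx
        obtain ⟨y, hy⟩ := exists_chord_of_notMem hx
        rw [hR x y (Or.inr hy)]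
        intro hy'
        exact Finset.notMem_empty y (hm ▸ Finset.mem_inter.2 ⟨hy', (upLabels_of_mem_chords hy).1⟩)
    rw [this]
  | succ m ih =>
    obtain ⟨u, hu⟩ : (R ∩ σ.upLabels).Nonempty := by rw [← Finset.card_pos]; omega
    obtain ⟨huR, huU⟩ := Finset.mem_inter.1 hu
    obtain ⟨d, hd⟩ := exists_chord_of_mem huU
    have hdU := (upLabels_of_mem_chords hd).2
    have hdR : d ∉ R := (hR u d (Or.inl hd)).1 huR
    rw [N.sum_forestWeight_swap z hdR huR (Or.inr hd)]
    apply ih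
    · intro x y hxy
      have h1 := hR x y hxy
      have hpair : σ.Paired d u := Or.inr hd
      simp only [Finset.mem_insert, Finset.mem_erase]
      by_cases hx : x = d
      · subst hx
        rw [← hpair.unique hxy]
        simp [hpair.ne.symm]
      by_cases hy : y = d
      · subst hy
        rw [← hpair.unique hxy.symm]
        simp [hpair.ne.symm]
      have hx' : x ≠ u := fun e => hy (hxy.unique (e ▸ hpair.symm))
      have hy' : y ≠ u := fun e => hx (hxy.symm.unique (e ▸ hpair.symm))
      simp only [hx, hy, hx', hy', false_or, ne_eq, not_false_eq_true, true_and]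
      exact h1
    · have : insert d (R.erase u) ∩ σ.upLabels = (R ∩ σ.upLabels).erase u := by
        rw [Finset.insert_inter_of_notMem hdU, Finset.erase_inter]
      rw [this, Finset.card_erase_of_mem hu, hm]
      rfl

theorem edgeProd_transport (N : Network V n) {z : ℂ} (hz : z ≠ 0) (g : OutEdges V)
    (C : Finset V) : g.edgeProd (N.transport z) C = z ^ g.edgeSum N.crossing C := by
  rw [edgeProd_eq, edgeSum_eq, zpow_sum_eq_prod hz]
  refine Finset.prod_congr rfl fun u _ => ?_
  unfold arrowVal
  split <;> simp [transport]

theorem partitionFunction_eq (N : Network V n) {z : ℂ} (hz : z ≠ 0) (σ : CyclicDyckPath n) :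
    N.partitionFunction z σ =
      z ^ (-σ.winding) * ∑ g : OutEdges V with N.IsGrove σ g, N.forestWeight z g := by
  unfold partitionFunction
  rw [Finset.mul_sum]
  refine Finset.sum_congr rfl fun g hg => ?_
  have h := (Finset.mem_filter.1 hg).2
  unfold groveWeight
  have h1 : ∏ c ∈ σ.chords, (g.edgeProd (N.transport z) (g.trail (N.node c.1)))⁻¹ =
      z ^ (-σ.winding) := by
    rw [winding_eq, ← Finset.sum_neg_distrib, zpow_sum_eq_prod hz]
    refine Finset.prod_congr rfl fun c hc => ?_
    rw [N.edgeProd_transport hz, h.winding c hc, zpow_neg]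
  rw [h1, forestWeight]
  ring

theorem partitionFunction_congr (N : Network V n) (z : ℂ) (h : σ.chords = τ.chords) :
    N.partitionFunction z σ = N.partitionFunction z τ := by
  have h1 : ∀ g, N.IsGrove σ g ↔ N.IsGrove τ g := fun g => by
    constructor
    · exact fun hg => ⟨hg.adj, hg.wired, h ▸ hg.sink, h ▸ hg.connects, h ▸ hg.winding⟩
    · exact fun hg => ⟨hg.adj, hg.wired, h ▸ hg.sink, h ▸ hg.connects, h ▸ hg.winding⟩
  unfold partitionFunction groveWeight
  simp only [h1, h]

end Network

end

section
open Classical Relation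

namespace IsNoncrossing

open CyclicDyckPath

variable {n : ℕ} {a b : Fin n → Fin (2 * n)} {F : Fin n → Prop} {σ : CyclicDyckPath n}

theorem paired_and_turn (h : IsNoncrossing (fun i => min (a i) (b i)) (fun i => max (a i) (b i)) F)
    (hσ : ∀ j, orient (fun i => min (a i) (b i)) (fun i => max (a i) (b i)) F j ∈ σ.chords)
    (j : Fin n) : σ.Paired (a j) (b j) ∧
      σ.turn (a j) (b j) = if F j then if a j < b j then -1 else 1 else 0 := by
  have hj := hσ j
  have hlt := h.lt j
  simp only [orient] at hj
  have hne : a j ≠ b j := fun e => by simp [e] at hlt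
  rcases lt_or_gt_of_ne hne with hab | hab
  · rw [min_eq_left hab.le, max_eq_right hab.le] at hj
    by_cases hF : F j
    · rw [if_pos hF] at hj
      exact ⟨Or.inr hj, by rw [turn_of_swap_mem hj, if_pos hab, if_pos hF, if_pos hab]⟩
    · rw [if_neg hF] at hj
      exact ⟨Or.inl hj, by rw [turn_of_mem hj, if_neg hab.not_gt, if_neg hF]⟩
  · rw [min_eq_right hab.le, max_eq_left hab.le] at hj
    by_cases hF : F j
    · rw [if_pos hF] at hj
      exact ⟨Or.inl hj, by rw [turn_of_mem hj, if_pos hab, if_pos hF, if_neg hab.not_gt]⟩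
    · rw [if_neg hF] at hj
      exact ⟨Or.inr hj, by rw [turn_of_swap_mem hj, if_neg hab.not_gt, if_neg hF]⟩

theorem sign_orient {lo hi : Fin n → Fin (2 * n)} (h : IsNoncrossing lo hi F)
    (hσ : ∀ j, orient lo hi F j ∈ σ.chords) :
    (-1 : ℂ) ^ (∑ x ∈ σ.upLabels, (x : ℤ) + σ.winding) = ∏ j, (-1) ^ (lo j : ℕ) := by
  rw [winding_eq, ← sum_chords_fst, ← Finset.sum_add_distrib, h.sum_chords hσ,
    zpow_sum_eq_prod (by norm_num)]
  refine Finset.prod_congr rfl fun j _ => ?_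
  rw [← zpow_natCast]
  apply neg_one_zpow_congr
  have hlt := h.lt j
  have hodd := odd_snd_sub_fst (hσ j)
  simp only [orient] at hodd ⊢
  by_cases hF : F j
  · simp only [if_pos hF, if_pos hlt] at hodd ⊢
    obtain ⟨k, hk⟩ := hodd
    exact ⟨-k, by omega⟩
  · simp only [if_neg hF, if_neg hlt.not_gt]
    simp

theorem winding_add_sum {R : Finset (Fin (2 * n))}
    (h : IsNoncrossing (fun i => min (a i) (b i)) (fun i => max (a i) (b i)) F)
    (hσ : ∀ j, orient (fun i => min (a i) (b i)) (fun i => max (a i) (b i)) F j ∈ σ.chords)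
    (ha : ∀ j, a j ∉ R) (hb : ∀ j, b j ∈ R) :
    2 * (σ.winding - wrappedCount R σ) - σ.winding =
      ∑ j, if F j then if a j < b j then -1 else 1 else 0 := by
  have h1 : (wrappedCount R σ : ℤ) = ∑ c ∈ σ.chords, if c.2 < c.1 ∧ c.1 ∈ R then 1 else 0 := by
    rw [wrappedCount, Finset.card_filter]
    push_cast
    rfl
  have h2 : 2 * (σ.winding - wrappedCount R σ) - σ.winding =
      σ.winding - 2 * wrappedCount R σ := by ring
  rw [h2, h1, winding_eq, h.sum_chords hσ, h.sum_chords hσ, Finset.mul_sum,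
    ← Finset.sum_sub_distrib]
  refine Finset.sum_congr rfl fun j _ => ?_
  have hlt := h.lt j
  have hne : a j ≠ b j := fun e => ha j (e ▸ hb j)
  simp only [orient]
  by_cases hF : F j
  · simp only [if_pos hF, if_pos hlt]
    rcases lt_or_gt_of_ne hne with hab | hab
    · rw [max_eq_right hab.le, min_eq_left hab.le, if_pos ⟨hab, hb j⟩, if_pos hab]; rfl
    · rw [max_eq_left hab.le, if_neg fun h => ha j h.2, if_neg hab.not_gt]; rfl
  · simp only [if_neg hF, hlt.not_gt, false_and, if_false]; rfl

end IsNoncrossing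

namespace Network

open OutEdges CyclicDyckPath

variable {V : Type*} [Fintype V] {n : ℕ} {N : Network V n} {R : HalfSubset n} {g : OutEdges V}

theorem not_isRootedGrove {i : Fin n}
    (hi : ∀ j, ¬ ReflTransGen g.Arrow (N.colNode R j) (N.rowNode R i)) (σ : CyclicDyckPath n) :
    ¬ N.IsRootedGrove σ R.1 g := by
  intro h
  obtain ⟨x, hx⟩ := σ.exists_paired (R.1.orderEmbOfFin R.2 i)
  have hR := R.1.orderEmbOfFin_mem R.2 i
  have hxR : x ∉ R.1 := (h.meets _ _ hx).1 hR
  have hxr : x ∈ Set.range (R.1ᶜ.orderEmbOfFin R.card_compl) := by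
    rw [Finset.range_orderEmbOfFin]; simpa using hxR
  obtain ⟨j, rfl⟩ := hxr
  exact hi j (h.connects _ _ hxR hR hx.symm).1

/-- The sinks are reached from the nodes with label in the complement of `R`, or the determinant
vanishes. -/
theorem exists_perm_or (hg : N.IsRootedAt R.1 g) :
    (∃ π : Equiv.Perm (Fin n), ∀ j,
      ReflTransGen g.Arrow (N.colNode R j) (N.rowNode R (π j))) ∨
    ∃ i, ∀ j, ¬ ReflTransGen g.Arrow (N.colNode R j) (N.rowNode R i) := by
  by_cases h : ∃ i, ∀ j, ¬ ReflTransGen g.Arrow (N.colNode R j) (N.rowNode R i)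
  · exact Or.inr h
  push Not at h
  choose f hf using h
  have hinj : Function.Injective f := fun i i' hii' => N.rowNode_injective R
    (sink_unique (hf i) (hii' ▸ hf i') (hg.node_eq_none (R.1.orderEmbOfFin_mem R.2 i))
      (hg.node_eq_none (R.1.orderEmbOfFin_mem R.2 i')))
  let π := Equiv.ofBijective f (Finite.injective_iff_bijective.1 hinj)
  refine Or.inl ⟨π.symm, fun j => ?_⟩
  conv => enter [2]; rw [← π.apply_symm_apply j]
  exact hf (π.symm j)

theorem det_connectionMatrix_nodeShift (hg : N.IsRootedAt R.1 g) (φ : V → V → ℂ)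
    {π : Equiv.Perm (Fin n)}
    (hπ : ∀ j, ReflTransGen g.Arrow (N.colNode R j) (N.rowNode R (π j))) :
    (g.connectionMatrix φ (N.nodeShift R)).det = (Equiv.Perm.sign π : ℤ) *
      (∏ j, g.edgeProd φ (g.trail (N.colNode R j))) *
        ∏ C : Finset V with g.IsCycle C, (1 - g.edgeProd φ C) := by
  let ρ : Fin n ↪ V := ⟨N.rowNode R, N.rowNode_injective R⟩
  have hsink : ∀ u, g u = none ↔ u ∈ Set.range (N.rowNode R) := fun u =>
    (hg.sink u).trans (N.mem_range_rowNode R u).symm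
  rw [det_connectionMatrix_of_perm (π.viaFintypeEmbedding ρ), det_connectionMatrix_id,
    Equiv.Perm.viaFintypeEmbedding_sign]
  · congr 2
    rw [show (Finset.univ.filter fun r => g r = none) = Finset.univ.map ρ by
      ext u; simp [hsink, ρ], Finset.prod_map]
    refine Finset.prod_congr rfl fun j _ => ?_
    rw [show ρ j = N.rowNode R j from rfl, nodeShift_rowNode]
  · intro r hr
    obtain ⟨j, rfl⟩ := (hsink r).1 hr
    rw [nodeShift_rowNode, show N.rowNode R j = ρ j from rfl,
      Equiv.Perm.viaFintypeEmbedding_apply_image]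
    exact ⟨hπ j, (hsink _).2 ⟨_, rfl⟩⟩
  · intro u hu
    exact Equiv.Perm.viaFintypeEmbedding_apply_notMem_range _ _ fun h => hu ((hsink u).2 h)

theorem exists_isRootedGrove (hn : 1 ≤ n) {z : ℂ} (hz : z ≠ 0) (hg : N.IsRootedAt R.1 g)
    {π : Equiv.Perm (Fin n)}
    (hπ : ∀ j, ReflTransGen g.Arrow (N.colNode R j) (N.rowNode R (π j))) :
    ∃ σ, N.IsRootedGrove σ R.1 g ∧
      (Equiv.Perm.sign π : ℤ) * (∏ j, g.edgeProd (N.transport z) (g.trail (N.colNode R j))) =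
        entryA (z ^ 2) R σ * z ^ (-σ.winding) := by
  let a : Fin n → Fin (2 * n) := fun j => R.1ᶜ.orderEmbOfFin R.card_compl j
  let b : Fin n → Fin (2 * n) := fun j => R.1.orderEmbOfFin R.2 j
  have haR : ∀ j, a j ∉ R.1 := fun j =>
    Finset.mem_compl.1 (R.1ᶜ.orderEmbOfFin_mem R.card_compl j)
  have hbR : ∀ j, b j ∈ R.1 := fun j => R.1.orderEmbOfFin_mem R.2 j
  have hrange : ∀ x, x ∉ R.1 → ∃ j, a j = x := fun x hx => by
    have : x ∈ Set.range (R.1ᶜ.orderEmbOfFin R.card_compl) := by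
      rw [Finset.range_orderEmbOfFin]; simpa using hx
    exact this
  have hrange' : ∀ x, x ∈ R.1 → ∃ j, b (π j) = x := fun x hx => by
    have : x ∈ Set.range (R.1.orderEmbOfFin R.2) := by
      rw [Finset.range_orderEmbOfFin]; exact hx
    obtain ⟨j, hj⟩ := this
    exact ⟨π.symm j, by rw [Equiv.apply_symm_apply]; exact hj⟩
  obtain ⟨F, hF, hsum⟩ := N.exists_isNoncrossing (a := a) (b := fun j => b (π j)) hg.adj
    ((R.1.orderEmbOfFin R.2).injective.comp π.injective)
    (fun i j e => haR i (e ▸ hbR _)) hπ fun i => hg.node_eq_none (hbR _)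
  obtain ⟨σ, hσ⟩ := hF.exists_cyclicDyckPath hn
  have hmeets : ∀ x y, σ.Paired x y → (x ∈ R.1 ↔ y ∉ R.1) := by
    intro x y hxy
    by_cases hx : x ∈ R.1
    · obtain ⟨j, rfl⟩ := hrange' x hx
      rw [← (hF.paired_and_turn hσ j).1.symm.unique hxy]
      exact iff_of_true hx (haR j)
    · obtain ⟨j, rfl⟩ := hrange x hx
      rw [← (hF.paired_and_turn hσ j).1.unique hxy]
      exact iff_of_false hx fun h => h (hbR _)
  refine ⟨σ, ⟨hg, hmeets, ?_⟩, ?_⟩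
  · intro s r hs hr hsr
    obtain ⟨j, rfl⟩ := hrange s hs
    obtain ⟨h1, h2⟩ := hF.paired_and_turn hσ j
    rw [← h1.unique hsr]
    exact ⟨hπ j, (hsum j).trans h2.symm⟩
  · rw [entryA_eq, if_pos (meetsEachChordOnce_iff.2 hmeets), hF.sign_orient hσ,
      hF.sign_eq (a := a) (b := b) (R.1ᶜ.orderEmbOfFin R.card_compl).strictMono
        (R.1.orderEmbOfFin R.2).strictMono (fun _ => rfl) (fun _ => rfl), mul_assoc]
    congr 1
    · push_cast; rfl
    · rw [← zpow_natCast z 2, ← zpow_mul, ← zpow_add₀ hz, ← sub_eq_add_neg,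
        show ((2 : ℕ) : ℤ) = 2 from rfl, hF.winding_add_sum hσ haR fun j => hbR _,
        zpow_sum_eq_prod hz]
      refine Finset.prod_congr rfl fun j _ => ?_
      rw [N.edgeProd_transport hz, ← hsum j]
      rfl

theorem det_connectionMatrix_eq_sum (hn : 1 ≤ n) {z : ℂ} (hz : z ≠ 0) (hg : N.IsRootedAt R.1 g) :
    (g.connectionMatrix (N.transport z) (N.nodeShift R)).det =
      ∑ q : Quotient (pairingSetoid n), if N.IsRootedGrove q.out R.1 g then
        entryA (z ^ 2) R q.out * z ^ (-q.out.winding) *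
          ∏ C : Finset V with g.IsCycle C, (1 - g.edgeProd (N.transport z) C) else 0 := by
  rcases exists_perm_or hg with ⟨π, hπ⟩ | ⟨i, hi⟩
  · obtain ⟨σ, hσ, hval⟩ := exists_isRootedGrove hn hz hg hπ
    have hout : (⟦σ⟧ : Quotient (pairingSetoid n)).out ≈ σ := Quotient.mk_out σ
    rw [det_connectionMatrix_nodeShift hg _ hπ, hval, Finset.sum_eq_single ⟦σ⟧,
      if_pos (hσ.congr (Eq.symm hout)), entryA_congr _ _ hout, winding_congr hout]
    · intro q _ hq
      refine if_neg fun h => hq ?_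
      rw [← Quotient.out_eq q]
      exact Quotient.sound (h.chords_eq hσ)
    · exact fun h => absurd (Finset.mem_univ _) h
  · rw [Finset.sum_eq_zero fun q _ => if_neg (not_isRootedGrove hi _)]
    refine det_connectionMatrix_eq_zero (hg.node_eq_none (R.1.orderEmbOfFin_mem R.2 i)) ?_
    intro r' hr'
    obtain ⟨j, rfl⟩ := (N.mem_range_rowNode R r').2 ((hg.sink r').1 hr')
    rw [nodeShift_rowNode]
    exact hi j

/-- The minors of the Green function in terms of the partition functions. -/
theorem det_mul_greenMinor_eq_sum (hn : 1 ≤ n) (N : Network V n) {z : ℂ} (hz : z ≠ 0)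
    (hdet : (N.laplacian z).det ≠ 0) (R : HalfSubset n) :
    (N.laplacian z).det * N.greenMinor z R =
      ∑ q : Quotient (pairingSetoid n), entryA (z ^ 2) R q.out * N.partitionFunction z q.out := by
  rw [N.det_mul_greenMinor z R hdet, Finset.sum_congr rfl fun g hg => by
    rw [det_connectionMatrix_eq_sum hn hz (Finset.mem_filter.1 hg).2, Finset.mul_sum],
    Finset.sum_comm]
  refine Finset.sum_congr rfl fun q _ => ?_
  have h1 : ∑ g : OutEdges V with N.IsRootedAt R.1 g,
      (g.edgeProd (fun u v => (N.conductance u v : ℂ)) Finset.univ *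
        if N.IsRootedGrove q.out R.1 g then
        entryA (z ^ 2) R q.out * z ^ (-q.out.winding) *
          ∏ C : Finset V with g.IsCycle C, (1 - g.edgeProd (N.transport z) C) else 0) =
      entryA (z ^ 2) R q.out * z ^ (-q.out.winding) *
        ∑ g : OutEdges V with N.IsRootedGrove q.out R.1 g, N.forestWeight z g := by
    rw [Finset.mul_sum, Finset.sum_filter, Finset.sum_filter]
    refine Finset.sum_congr rfl fun g _ => ?_
    by_cases h : N.IsRootedGrove q.out R.1 g
    · rw [if_pos h, if_pos h, if_pos h.rooted, forestWeight]
      ring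
    · rw [if_neg h, if_neg h, mul_zero, ite_self]
  rw [h1, N.partitionFunction_eq hz]
  by_cases h : MeetsEachChordOnce R.1 q.out
  · rw [N.sum_forestWeight z (meetsEachChordOnce_iff.1 h)]
    ring
  · rw [entryA_eq, if_neg h, zero_mul, zero_mul, zero_mul]

theorem partitionFunction_eq_sum_greenMinor (hn : 1 ≤ n) (N : Network V n) {z : ℂ} (hz : z ≠ 0)
    (hz1 : z ^ 2 ≠ 1) (hdet : (N.laplacian z).det ≠ 0) (σ : CyclicDyckPath n) :
    N.partitionFunction z σ = (N.laplacian z).det / (1 - z ^ 2) ^ n *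
      ∑ R : HalfSubset n, entryB (z ^ 2) σ R * N.greenMinor z R := by
  have h1 : (N.laplacian z).det * ∑ R : HalfSubset n, entryB (z ^ 2) σ R * N.greenMinor z R =
      (1 - z ^ 2) ^ n * N.partitionFunction z σ := by
    calc _ = ∑ R : HalfSubset n, ∑ q : Quotient (pairingSetoid n),
          entryB (z ^ 2) σ R * entryA (z ^ 2) R q.out * N.partitionFunction z q.out := by
          rw [Finset.mul_sum]
          refine Finset.sum_congr rfl fun R _ => ?_
          rw [mul_left_comm, N.det_mul_greenMinor_eq_sum hn hz hdet, Finset.mul_sum]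
          exact Finset.sum_congr rfl fun q _ => (mul_assoc _ _ _).symm
      _ = ∑ q : Quotient (pairingSetoid n), (if σ ≈ q.out then (1 - z ^ 2) ^ n else 0) *
          N.partitionFunction z q.out := by
          rw [Finset.sum_comm]
          refine Finset.sum_congr rfl fun q _ => ?_
          rw [← Finset.sum_mul, sum_entryB_mul_entryA_eq _ (pow_ne_zero 2 hz)]
      _ = _ := by
          have hout : (⟦σ⟧ : Quotient (pairingSetoid n)).out ≈ σ := Quotient.mk_out σ
          rw [Finset.sum_eq_single ⟦σ⟧, if_pos (Setoid.symm hout), N.partitionFunction_congr z hout]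
          · intro q _ hq
            rw [if_neg, zero_mul]
            intro h
            apply hq
            rw [← Quotient.out_eq q]
            exact Quotient.sound (Setoid.symm h)
          · exact fun h => absurd (Finset.mem_univ _) h
  have h2 : (1 - z ^ 2) ^ n ≠ 0 := pow_ne_zero _ (sub_ne_zero.2 hz1.symm)
  rw [div_mul_eq_mul_div, h1, mul_div_cancel_left₀ _ h2]

end Network

end

end

open Classical in
theorem proposition5p2 (n : ℕ) (hn : 1 ≤ n) (w : ℂ) (hw : w ≠ 0) :
    (∀ σ τ : CyclicDyckPath n,
      ∑ R : HalfSubset n, entryB w σ R * entryA w R τ = if σ ≈ τ then (1 - w) ^ n else 0) ∧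
    (matrixB n w * matrixA n w = (1 - w) ^ n • (1 : Matrix _ _ ℂ) ∧
      matrixA n w * matrixB n w = (1 - w) ^ n • (1 : Matrix _ _ ℂ)) ∧
    ∀ (V : Type*) [Fintype V] (N : Network V n) (z : ℂ), w = z ^ 2 → w ≠ 1 →
      (N.laplacian z).det ≠ 0 → ∀ σ : CyclicDyckPath n,
        N.partitionFunction z σ =
          (N.laplacian z).det / (1 - w) ^ n *
            ∑ R : HalfSubset n, entryB w σ R * N.greenMinor z R := by
  refine ⟨CyclicDyckPath.sum_entryB_mul_entryA_eq w hw,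
    ⟨CyclicDyckPath.matrixB_mul_matrixA w hw, CyclicDyckPath.matrixA_mul_matrixB hn w hw⟩, ?_⟩
  rintro V _ N z rfl hw1 hdet σ
  exact N.partitionFunction_eq_sum_greenMinor hn (fun hz => hw (by rw [hz, zero_pow two_ne_zero]))
    hw1 hdet σ
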